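/- **Setting.** Let $\mathcal P_2=\mathcal P_2(\mathbb R^n)$ be the Borel probability measures on $\mathbb R^n$ with finite second moment, with the Wasserstein distance $W_2$; write $\langle\mu,\psi\rangle=\int\psi\,d\mu$, $\langle|y|^k\rangle_\mu=\int|y|^k\mu(dy)$, and $|\cdot|$ for the Euclidean (Frobenius) norm. For $\psi:\mathcal P_2\to\mathbb R$, $\delta_\mu\psi(\mu;\cdot)$ is the function $h:\mathbb R^n\to\mathbb R$, integrable under every $\nu\in\mathcal P_2$, with $\langle\mu,h\rangle=0$ and $\lim_{s\downarrow0}s^{-1}[\psi((1-s)\mu+s\nu)-\psi(\mu)]=\langle\nu-\mu,h\rangle$ for all $\nu\in\mathcal P_2$; $\delta_{\mu\mu}\psi(\mu;y,z)$ is the derivative of $\mu\mapsto\delta_\mu\psi(\mu;y)$, with new variable $z$, and $\delta_{\mu\mu\mu}\psi(\mu;y,z,w)$ is defined likewise; for vector-valued functions they are taken componentwise. $\partial_x\psi$ is the (row) gradient, $\partial_x^2\psi=(\partial_{x_i}\partial_{x_j}\psi)_{ij}$, $\partial_{xy}\psi=(\partial_{x_i}(\partial_{y_j}\psi))_{ij}$.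 "Jointly continuous" means continuous on the product of $[0,T]$, copies of $\mathbb R^n$, and $\mathcal P_2$; time derivatives are one-sided at $0$ and $T$. $C$ denotes constants. **Data.** Let $T>0$, $\mathbb U\subseteq\mathbb R^{n_1}$ nonempty and closed, $\sigma\in\mathbb R^{n\times n_2}$, $\sigma_0\in\mathbb R^{n\times n_3}$, $\Sigma=\sigma\sigma^T$, $\Sigma_0=\sigma_0\sigma_0^T$. The drift $f:\mathbb R^n\times\mathbb U\times\mathcal P_2\to\mathbb R^n$ is continuous, Lipschitz in $(x,\mu)$ uniformly in $u$, with $|f(x,u,\mu)|\le C(1+|x|+|u|+\langle|y|\rangle_\mu)$; the costs $L:\mathbb R^n\times\mathbb U\times\mathcal P_2\to[0,\infty)$, $g:\mathbb R^n\times\mathcal P_2\to[0,\infty)$ are continuous with $L\le C(1+|x|^2+|u|^2+\langle|y|\rangle_\mu^2)$ and $g\le C(1+|x|^2+\langle|y|\rangle_\mu^2)$. **Generators.** For $\phi:[0,T]\times\mathbb R^n\times\mathcal P_2\to\mathbb U$ put $f^*(t,x,\mu)=f(x,\phi(t,x,\mu),\mu)$, $L^*(t,x,\mu)=L(x,\phi(t,x,\mu),\mu)$,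 $$\mathcal A_t\psi(\mu)=\langle\mu(dy),\partial_y\delta_\mu\psi(\mu;y)f^*(t,y,\mu)\rangle+\tfrac12\langle\mu(dy),\mathrm{Tr}[\partial_y^2\delta_\mu\psi(\mu;y)(\Sigma+\Sigma_0)]\rangle+\tfrac12\langle\mu^{\otimes2}(dydz),\mathrm{Tr}[\partial_{yz}\delta_{\mu\mu}\psi(\mu;y,z)\Sigma_0]\rangle,$$ $$\mathcal L_tF(x,\mu)=F_x f^*(t,x,\mu)+\tfrac12\mathrm{Tr}[F_{xx}(\Sigma+\Sigma_0)]+\mathcal A_t[F(x,\cdot)](\mu)+\langle\mu(dy),\mathrm{Tr}[\partial_{xy}\delta_\mu F(x,\mu;y)\Sigma_0]\rangle .$$ Call $F:[0,T]\times\mathbb R^n\times\mathcal P_2\to\mathbb R$ *regular* if $F,\partial_tF,F_x,F_{xx},\delta_\mu F(t,x,\mu;y),\delta_{\mu\mu}F(t,x,\mu;y,z),\partial_y\delta_\mu F,\partial_y^2\delta_\mu F,\partial_{xy}\delta_\mu F,\partial_{yz}\delta_{\mu\mu}F$ exist and are jointly continuous. **Assumption 1.** $(V,\phi)$ solves the master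 equation of the value function, with $V\in\mathcal C_V$. The first part means: $V$ is regular; $\phi$ is continuous with $|\phi|\le C(1+|x|+\langle|y|\rangle_\mu)$; for all $(t,x,\mu)$, $\phi(t,x,\mu)$ minimizes over $u\in\mathbb U$ $$V_x(t,x,\mu)f(x,u,\mu)+L(x,u,\mu)+\langle\mu(dy),\partial_x\delta_\mu V(t,y,\mu;x)f(x,u,\mu)\rangle ;$$ $-\partial_tV=\mathcal L_tV+L^*$ and $V(T,x,\mu)=g(x,\mu)$; and $$|\delta_\mu V|\le C(1+|x|^2+|y|^2+\langle|y|\rangle_\mu^2),\quad|\delta_{\mu\mu}V|\le C(1+|x|^2+|y|^2+|z|^2+\langle|y|\rangle_\mu^2),\quad|\partial_y\delta_\mu V|\le C(1+|x|+|y|+\langle|y|\rangle_\mu),$$ $$|\partial_y^2\delta_\mu V|,\ |\partial_{xy}\delta_\mu V|,\ |\partial_{yz}\delta_{\mu\mu}V|\le C .$$ The condition $V\in\mathcal C_V$ means in addition that $\delta_{\mu\mu\mu}V(t,x,\mu;y,z,w)$, $\partial_x\delta_\mu V$, $\partial_x^2\delta_\mu V$, $\partial_t\delta_\mu V$, $\partial_y\delta_{\mu\mu}V$,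 $\partial_x\delta_{\mu\mu}V$, $\partial_y^2\delta_{\mu\mu}V$, $\partial_{xy}\delta_{\mu\mu}V$, $\partial_y\delta_{\mu\mu\mu}V$, $\partial_{yz}\delta_{\mu\mu\mu}V$ exist and are jointly continuous, that $|V|\le C(1+|x|^2+\langle|y|\rangle_\mu^2)$, $|V_x|\le C(1+|x|+\langle|y|\rangle_\mu)$, $|\partial_t\delta_\mu V|\le C(1+|x|^2+|y|^2+\langle|y|\rangle_\mu^2)$, $|\partial_x\delta_\mu V|\le C(1+|x|+|y|+\langle|y|\rangle_\mu)$, $|\partial_y\delta_{\mu\mu}V|\le C(1+|x|+|y|+|z|+\langle|y|\rangle_\mu)$, $|\delta_{\mu\mu\mu}V|\le C(1+|x|^2+|y|^2+|z|^2+|w|^2+\langle|y|\rangle_\mu^2)$, $|\partial_y\delta_{\mu\mu\mu}V|\le C(1+|x|+|y|+|z|+|w|+\langle|y|\rangle_\mu)$, and that $|V_{xx}|,|\partial_x^2\delta_\mu V|,|\partial_y^2\delta_{\mu\mu}V|,|\partial_{xy}\delta_{\mu\mu}V|,|\partial_{yz}\delta_{\mu\mu\mu}V|\le C$. **Assumption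 2.** $\delta_\mu$ and $\delta_{\mu\mu}$ of $f^*,L^*,g$ exist and are jointly continuous, with $|\delta_\mu f^*|\le C(1+|x|+|y|+\langle|y|\rangle_\mu)$, $|\delta_{\mu\mu}f^*|\le C(1+|x|+|y|+|z|+\langle|y|\rangle_\mu)$, $|\delta_\mu L^*|,|\delta_\mu g|\le C(1+|x|^2+|y|^2+\langle|y|\rangle_\mu^2)$, $|\delta_{\mu\mu}L^*|,|\delta_{\mu\mu}g|\le C(1+|x|^2+|y|^2+|z|^2+\langle|y|\rangle_\mu^2)$. **Assumption 3.** $M:[0,T]\times\mathcal P_2\to\mathbb R$ is such that $M,\partial_tM,\delta_\mu M,\delta_{\mu\mu}M,\partial_y\delta_\mu M,\partial_y^2\delta_\mu M,\partial_{yz}\delta_{\mu\mu}M$ exist and are jointly continuous, $|\delta_\mu M|\le C(1+|y|^2+\langle|y|^2\rangle_\mu)$, $|\delta_{\mu\mu}M|\le C(1+|y|^2+|z|^2+\langle|y|^2\rangle_\mu)$, $|\partial_y\delta_\mu M|\le C(1+|y|+\langle|y|\rangle_\mu)$, $|\partial_y^2\delta_\mu M|,|\partial_{yz}\delta_{\mu\mu}M|\le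 C$, and $M(T,\mu)=0$, $$0=\partial_tM+\mathcal A_tM(t,\cdot)+\langle\mu^{\otimes2}(dydz),\partial_y\delta_\mu V(t,z,\mu;y)[\delta_\mu f^*(t,y,\mu;z)-\delta_\mu f^*(t,y,\mu;y)]\rangle+\tfrac12\langle\mu^{\otimes2}(dydw),\mathrm{Tr}\{[\partial_{yz}\delta_{\mu\mu}V(t,w,\mu;y,z)]|_{z=y}\Sigma\}\rangle .$$ **Theorem.** Under Assumptions 1–3 let $\overline U(t,\mu)=\langle\mu(dy),V(t,y,\mu)\rangle$ and $$U(t,x,\mu)=V(t,x,\mu)+M(t,\mu)+\langle\mu(dy),\delta_\mu V(t,y,\mu;x)-\delta_\mu V(t,y,\mu;y)\rangle .$$ Then $U$ is a classical solution of the instrumental-value-function master equation: $U$ is regular, the derivatives of $\overline U$ below exist, all integrals below converge, and for all $(t,x,\mu)\in[0,T]\times\mathbb R^n\times\mathcal P_2$ $$\begin{aligned}0={}&\partial_tU+\mathcal L_tU+L^*(t,x,\mu)+\langle\mu(dy),\delta_\mu L^*(t,y,\mu;x)-\delta_\mu L^*(t,y,\mu;y)\rangle\\&+\langle\mu(dy),\partial_y\delta_\mu\overline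 U(t,\mu;y)[\delta_\mu f^*(t,y,\mu;x)-\delta_\mu f^*(t,y,\mu;y)]\rangle+\tfrac12\langle\mu(dy),\mathrm{Tr}\{[\partial_{yz}\delta_{\mu\mu}\overline U(t,\mu;y,z)]|_{z=y}\Sigma\}\rangle,\end{aligned}$$ $$U(T,x,\mu)=g(x,\mu)+\langle\mu(dy),\delta_\mu g(y,\mu;x)-\delta_\mu g(y,\mu;y)\rangle .$$ -/

import Mathlib

open MeasureTheory Set Filter Topology

noncomputable section

namespace SocialMFC

/-! ### The Wasserstein space of order two -/

/-- The Euclidean space `ℝⁿ`. -/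
abbrev Eu (n : ℕ) : Type := EuclideanSpace ℝ (Fin n)

/-- Borel probability measures on `ℝⁿ` with finite second moment. -/
structure P2 (n : ℕ) where
  meas : Measure (Eu n)
  prob : IsProbabilityMeasure meas
  moment : Integrable (fun y => ‖y‖ ^ 2) meas

namespace P2

variable {n : ℕ}

/-- The first absolute moment `⟨|y|⟩_μ`. -/
def m1 (μ : P2 n) : ℝ := ∫ y, ‖y‖ ∂μ.meas

/-- The second moment `⟨|y|²⟩_μ`. -/
def m2 (μ : P2 n) : ℝ := ∫ y, ‖y‖ ^ 2 ∂μ.meas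

/-- The squared Wasserstein distance of order two: the infimum over all couplings. -/
def W2sq (μ ν : P2 n) : ENNReal :=
  ⨅ (π : Measure (Eu n × Eu n)) (_ : π.map Prod.fst = μ.meas ∧ π.map Prod.snd = ν.meas),
    ∫⁻ p, edist p.1 p.2 ^ 2 ∂π

/-- The Wasserstein distance of order two. -/
def W2 (μ ν : P2 n) : ℝ := Real.sqrt (W2sq μ ν).toReal

/-- The topology of the distance `W2`. -/
instance : TopologicalSpace (P2 n) where
  IsOpen s := ∀ μ ∈ s, ∃ ε > 0, ∀ ν, W2 μ ν < ε → ν ∈ s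
  isOpen_univ := fun _ _ => ⟨1, one_pos, fun _ _ => mem_univ _⟩
  isOpen_inter := by
    intro s t hs ht μ hμ
    obtain ⟨a, ha, hsa⟩ := hs μ hμ.1
    obtain ⟨b, hb, htb⟩ := ht μ hμ.2
    exact ⟨min a b, lt_min ha hb, fun ν hν =>
      ⟨hsa ν (lt_of_lt_of_le hν (min_le_left _ _)), htb ν (lt_of_lt_of_le hν (min_le_right _ _))⟩⟩
  isOpen_sUnion := by
    intro S hS μ hμ
    obtain ⟨s, hs, hμs⟩ := hμ
    obtain ⟨a, ha, hsa⟩ := hS s hs μ hμs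
    exact ⟨a, ha, fun ν hν => ⟨s, hs, hsa ν hν⟩⟩

/-- A real number clamped to `[0,1]`. -/
def clamp (s : ℝ) : ℝ := max 0 (min s 1)

lemma clamp_nonneg (s : ℝ) : 0 ≤ clamp s := le_max_left _ _

lemma clamp_le_one (s : ℝ) : clamp s ≤ 1 := max_le zero_le_one (min_le_right _ _)

/-- The mixture `(1 - s) μ + s ν` for `s ∈ [0,1]` (other values of `s` are clamped). -/
def mix (μ ν : P2 n) (s : ℝ) : P2 n where
  meas := ENNReal.ofReal (1 - clamp s) • μ.meas + ENNReal.ofReal (clamp s) • ν.meas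
  prob := by
    have := μ.prob
    have := ν.prob
    constructor
    simp only [Measure.coe_add, Measure.coe_smul, Pi.add_apply, Pi.smul_apply, measure_univ,
      smul_eq_mul, mul_one]
    rw [← ENNReal.ofReal_add (by linarith [clamp_le_one s]) (clamp_nonneg s)]
    simp
  moment :=
    (μ.moment.smul_measure ENNReal.ofReal_ne_top).add_measure
      (ν.moment.smul_measure ENNReal.ofReal_ne_top)

end P2

/-! ### Differentiation with respect to the measure -/

section MeasureDerivative

variable {n : ℕ}

/-- `h = δ_μ ψ(μ; ·)`: the function `h` is integrable against every element of `P2 n`, has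
mean zero under `μ`, and gives the one-sided derivative at `s = 0` of
`s ↦ ψ ((1 - s) μ + s ν)` as `⟨ν - μ, h⟩` for every `ν`. Such an `h` is unique. -/
def HasMDeriv (ψ : P2 n → ℝ) (μ : P2 n) (h : Eu n → ℝ) : Prop :=
  (∀ ν : P2 n, Integrable h ν.meas) ∧ ∫ y, h y ∂μ.meas = 0 ∧
    ∀ ν : P2 n, HasDerivWithinAt (fun s : ℝ => ψ (P2.mix μ ν s))
      ((∫ y, h y ∂ν.meas) - ∫ y, h y ∂μ.meas) (Ici 0) 0

open Classical in
/-- `δ_μ ψ(μ; y)` (zero if the derivative does not exist). -/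
def mderiv (ψ : P2 n → ℝ) (μ : P2 n) (y : Eu n) : ℝ :=
  if H : ∃ h, HasMDeriv ψ μ h then H.choose y else 0

/-- `δ_{μμ} ψ(μ; y, z)`, the last variable arising from the last differentiation. -/
def mderiv2 (ψ : P2 n → ℝ) (μ : P2 n) (y z : Eu n) : ℝ :=
  mderiv (fun ν => mderiv ψ ν y) μ z

/-- `δ_{μμμ} ψ(μ; y, z, w)`. -/
def mderiv3 (ψ : P2 n → ℝ) (μ : P2 n) (y z w : Eu n) : ℝ :=
  mderiv (fun ν => mderiv2 ψ ν y z) μ w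

/-- `δ_μ ψ` exists everywhere. -/
def MDiff (ψ : P2 n → ℝ) : Prop := ∀ μ, ∃ h, HasMDeriv ψ μ h

/-- `δ_μ ψ` and `δ_{μμ} ψ` exist everywhere. -/
def MDiff2 (ψ : P2 n → ℝ) : Prop := MDiff ψ ∧ ∀ y, MDiff (fun ν => mderiv ψ ν y)

/-- `δ_μ ψ`, `δ_{μμ} ψ` and `δ_{μμμ} ψ` exist everywhere. -/
def MDiff3 (ψ : P2 n → ℝ) : Prop := MDiff2 ψ ∧ ∀ y z, MDiff (fun ν => mderiv2 ψ ν y z)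

/-- `δ_μ F(μ; y)` of a vector valued function, componentwise. -/
def mderivVec (F : P2 n → Eu n) (μ : P2 n) (y : Eu n) : Eu n :=
  WithLp.toLp 2 (fun i => mderiv (fun ν => F ν i) μ y)

/-- `δ_{μμ} F(μ; y, z)` of a vector valued function, componentwise. -/
def mderivVec2 (F : P2 n → Eu n) (μ : P2 n) (y z : Eu n) : Eu n :=
  WithLp.toLp 2 (fun i => mderiv2 (fun ν => F ν i) μ y z)

end MeasureDerivative

/-! ### Partial derivatives in the space variables -/

section SpaceDerivative

variable {n : ℕ}

/-- The `i`-th standard basis vector. -/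
def bas (i : Fin n) : Eu n := EuclideanSpace.single i 1

/-- The partial derivative `∂_{x_i} ψ(x)`. -/
def pd (i : Fin n) (ψ : Eu n → ℝ) (x : Eu n) : ℝ := lineDeriv ℝ ψ x (bas i)

/-- All first partial derivatives exist everywhere. -/
def PDiff (ψ : Eu n → ℝ) : Prop := ∀ x i, LineDifferentiableAt ℝ ψ x (bas i)

/-- All first and second partial derivatives exist everywhere. -/
def PDiff2 (ψ : Eu n → ℝ) : Prop := PDiff ψ ∧ ∀ j, PDiff (pd j ψ)

/-- The gradient `∂_x ψ(x)`. -/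
def grad (ψ : Eu n → ℝ) (x : Eu n) : Eu n := WithLp.toLp 2 (fun i => pd i ψ x)

/-- The Hessian matrix `∂_x² ψ(x)`, with entries `∂_{x_i} (∂_{x_j} ψ)`. -/
def hess (ψ : Eu n → ℝ) (x : Eu n) : Matrix (Fin n) (Fin n) ℝ :=
  Matrix.of fun i j => pd i (pd j ψ) x

/-- The matrix `∂_{xy} ψ(x, y)`, with entries `∂_{x_i} (∂_{y_j} ψ)`. -/
def mixed (ψ : Eu n → Eu n → ℝ) (x y : Eu n) : Matrix (Fin n) (Fin n) ℝ :=
  Matrix.of fun i j => pd i (fun x' => pd j (ψ x') y) x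

/-- The partial derivatives `∂_{y_j} ψ` and `∂_{x_i} (∂_{y_j} ψ)` exist everywhere. -/
def MixedDiff (ψ : Eu n → Eu n → ℝ) : Prop :=
  (∀ x, PDiff (ψ x)) ∧ ∀ y j, PDiff (fun x => pd j (ψ x) y)

/-- The Frobenius norm of a matrix. -/
def frob (A : Matrix (Fin n) (Fin n) ℝ) : ℝ := Real.sqrt (∑ i, ∑ j, A i j ^ 2)

end SpaceDerivative

/-- The function `G(t, a)` is jointly continuous for `t ∈ [0,T]` and all `a`. -/
def JointCont {α β : Type*} [TopologicalSpace α] [TopologicalSpace β] (T : ℝ)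
    (G : ℝ → α → β) : Prop :=
  ContinuousOn (fun q : ℝ × α => G q.1 q.2) (Icc 0 T ×ˢ univ)

/-- The time derivative `∂_t ψ(t)` on `[0,T]` (one-sided at the end points). -/
def dt (T : ℝ) (ψ : ℝ → ℝ) (t : ℝ) : ℝ := derivWithin ψ (Icc 0 T) t

/-- `∂_t ψ` exists on `[0,T]`. -/
def TDiff (T : ℝ) (ψ : ℝ → ℝ) : Prop := DifferentiableOn ℝ ψ (Icc 0 T)

/-! ### The model -/

/-- The data of the model: horizon `T`, control set `ctrl ⊆ ℝᵐ`, drift `f(x, u, μ)`, running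
cost `L(x, u, μ)`, terminal cost `g(x, μ)`, and the constant noise coefficients. -/
structure Model (n m p q : ℕ) where
  T : ℝ
  ctrl : Set (Eu m)
  f : Eu n → Eu m → P2 n → Eu n
  L : Eu n → Eu m → P2 n → ℝ
  g : Eu n → P2 n → ℝ
  σ : Matrix (Fin n) (Fin p) ℝ
  σ₀ : Matrix (Fin n) (Fin q) ℝ

namespace Model

variable {n m p q : ℕ} (P : Model n m p q)

/-- `Σ = σ σᵀ`. -/
def S : Matrix (Fin n) (Fin n) ℝ := P.σ * P.σ.transpose

/-- `Σ₀ = σ₀ σ₀ᵀ`. -/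
def S₀ : Matrix (Fin n) (Fin n) ℝ := P.σ₀ * P.σ₀.transpose

/-- The standing assumptions on the data. -/
structure Standing : Prop where
  T_pos : 0 < P.T
  ctrl_closed : IsClosed P.ctrl
  ctrl_nonempty : P.ctrl.Nonempty
  f_cont : ContinuousOn (fun a : Eu n × Eu m × P2 n => P.f a.1 a.2.1 a.2.2)
    (univ ×ˢ P.ctrl ×ˢ univ)
  f_lip : ∃ K : ℝ, ∀ x y, ∀ u ∈ P.ctrl, ∀ μ ν,
    ‖P.f x u μ - P.f y u ν‖ ≤ K * (‖x - y‖ + P2.W2 μ ν)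
  f_growth : ∃ C : ℝ, ∀ x, ∀ u ∈ P.ctrl, ∀ μ, ‖P.f x u μ‖ ≤ C * (1 + ‖x‖ + ‖u‖ + μ.m1)
  L_cont : ContinuousOn (fun a : Eu n × Eu m × P2 n => P.L a.1 a.2.1 a.2.2)
    (univ ×ˢ P.ctrl ×ˢ univ)
  L_nonneg : ∀ x, ∀ u ∈ P.ctrl, ∀ μ, 0 ≤ P.L x u μ
  L_growth : ∃ C : ℝ, ∀ x, ∀ u ∈ P.ctrl, ∀ μ,
    P.L x u μ ≤ C * (1 + ‖x‖ ^ 2 + ‖u‖ ^ 2 + μ.m1 ^ 2)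
  g_cont : Continuous (fun a : Eu n × P2 n => P.g a.1 a.2)
  g_nonneg : ∀ x μ, 0 ≤ P.g x μ
  g_growth : ∃ C : ℝ, ∀ x μ, P.g x μ ≤ C * (1 + ‖x‖ ^ 2 + μ.m1 ^ 2)

/-- The closed-loop drift `f*(t, x, μ) = f(x, φ(t, x, μ), μ)`. -/
def fstar (φ : ℝ → Eu n → P2 n → Eu m) (t : ℝ) (x : Eu n) (μ : P2 n) : Eu n :=
  P.f x (φ t x μ) μ

/-- The closed-loop running cost `L*(t, x, μ) = L(x, φ(t, x, μ), μ)`. -/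
def Lstar (φ : ℝ → Eu n → P2 n → Eu m) (t : ℝ) (x : Eu n) (μ : P2 n) : ℝ :=
  P.L x (φ t x μ) μ

/-- The part of the generator that acts on the measure variable, with drift `b`:
`⟨μ(dy), ∂_y δ_μ ψ(μ;y) b(y)⟩ + ½ ⟨μ(dy), Tr[∂_y² δ_μ ψ(μ;y) (Σ+Σ₀)]⟩
  + ½ ⟨μ^{⊗2}(dydz), Tr[∂_{yz} δ_{μμ} ψ(μ;y,z) Σ₀]⟩`. -/
def popGen (b : Eu n → Eu n) (ψ : P2 n → ℝ) (μ : P2 n) : ℝ :=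
  (∫ y, inner ℝ (grad (mderiv ψ μ) y) (b y) ∂μ.meas)
  + 1 / 2 * (∫ y, (hess (mderiv ψ μ) y * (P.S + P.S₀)).trace ∂μ.meas)
  + 1 / 2 * (∫ a : Eu n × Eu n, (mixed (mderiv2 ψ μ) a.1 a.2 * P.S₀).trace
      ∂(μ.meas.prod μ.meas))

/-- The generator of the pair (state, population), with drift `b`, at `(x, μ)`:
`F_x b(x) + ½ Tr[F_xx (Σ+Σ₀)]`, plus the measure part, plus
`⟨μ(dy), Tr[∂_{xy} δ_μ F(x,μ;y) Σ₀]⟩`. -/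
def gen (b : Eu n → Eu n) (F : Eu n → P2 n → ℝ) (x : Eu n) (μ : P2 n) : ℝ :=
  inner ℝ (grad (fun x' => F x' μ) x) (b x)
  + 1 / 2 * (hess (fun x' => F x' μ) x * (P.S + P.S₀)).trace
  + P.popGen b (F x) μ
  + ∫ y, (mixed (fun x' => mderiv (F x') μ) x y * P.S₀).trace ∂μ.meas

/-- The function `Φ(t, x, u, μ, V(·))` that is minimized over `u`. -/
def hamiltonian (V : ℝ → Eu n → P2 n → ℝ) (t : ℝ) (x : Eu n) (u : Eu m) (μ : P2 n) : ℝ :=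
  inner ℝ (grad (fun x' => V t x' μ) x) (P.f x u μ) + P.L x u μ
  + ∫ y, inner ℝ (grad (mderiv (V t y) μ) x) (P.f x u μ) ∂μ.meas

end Model

/-! ### Regularity classes -/

section Regularity

variable {n : ℕ}

/-- The derivatives that occur in a master equation for `F(t, x, μ)`, namely
`∂_t F`, `F_x`, `F_xx`, `δ_μ F`, `δ_{μμ} F`, `∂_y δ_μ F`, `∂_y² δ_μ F`, `∂_{xy} δ_μ F` and
`∂_{yz} δ_{μμ} F`, exist on `[0,T] × ℝⁿ × P2`, and they and `F` are jointly continuous. -/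
structure MasterRegular (T : ℝ) (F : ℝ → Eu n → P2 n → ℝ) : Prop where
  tdiff : ∀ x μ, TDiff T (fun t => F t x μ)
  xdiff : ∀ t ∈ Icc 0 T, ∀ μ, PDiff2 (fun x => F t x μ)
  mdiff : ∀ t ∈ Icc 0 T, ∀ x, MDiff2 (F t x)
  ydiff : ∀ t ∈ Icc 0 T, ∀ x μ, PDiff2 (mderiv (F t x) μ)
  xydiff : ∀ t ∈ Icc 0 T, ∀ μ, MixedDiff (fun x => mderiv (F t x) μ)
  yzdiff : ∀ t ∈ Icc 0 T, ∀ x μ, MixedDiff (mderiv2 (F t x) μ)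
  cont : JointCont T (fun t (a : Eu n × P2 n) => F t a.1 a.2)
  cont_t : JointCont T (fun t (a : Eu n × P2 n) => dt T (fun s => F s a.1 a.2) t)
  cont_x : JointCont T (fun t (a : Eu n × P2 n) => grad (fun x => F t x a.2) a.1)
  cont_xx : JointCont T (fun t (a : Eu n × P2 n) => hess (fun x => F t x a.2) a.1)
  cont_m : JointCont T (fun t (a : Eu n × P2 n × Eu n) => mderiv (F t a.1) a.2.1 a.2.2)
  cont_mm : JointCont T (fun t (a : Eu n × P2 n × Eu n × Eu n) =>
    mderiv2 (F t a.1) a.2.1 a.2.2.1 a.2.2.2)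
  cont_y_m : JointCont T (fun t (a : Eu n × P2 n × Eu n) =>
    grad (mderiv (F t a.1) a.2.1) a.2.2)
  cont_yy_m : JointCont T (fun t (a : Eu n × P2 n × Eu n) =>
    hess (mderiv (F t a.1) a.2.1) a.2.2)
  cont_xy_m : JointCont T (fun t (a : Eu n × P2 n × Eu n) =>
    mixed (fun x => mderiv (F t x) a.2.1) a.1 a.2.2)
  cont_yz_mm : JointCont T (fun t (a : Eu n × P2 n × Eu n × Eu n) =>
    mixed (mderiv2 (F t a.1) a.2.1) a.2.2.1 a.2.2.2)

/-- The growth conditions that belong to the notion of a solution of the master equation of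
the value function. -/
def MasterGrowth (T : ℝ) (V : ℝ → Eu n → P2 n → ℝ) : Prop :=
  ∃ C : ℝ, ∀ t ∈ Icc 0 T, ∀ (x : Eu n) (μ : P2 n) (y z : Eu n),
    |mderiv (V t x) μ y| ≤ C * (1 + ‖x‖ ^ 2 + ‖y‖ ^ 2 + μ.m1 ^ 2) ∧
    |mderiv2 (V t x) μ y z| ≤ C * (1 + ‖x‖ ^ 2 + ‖y‖ ^ 2 + ‖z‖ ^ 2 + μ.m1 ^ 2) ∧
    ‖grad (mderiv (V t x) μ) y‖ ≤ C * (1 + ‖x‖ + ‖y‖ + μ.m1) ∧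
    frob (hess (mderiv (V t x) μ) y) ≤ C ∧
    frob (mixed (fun x' => mderiv (V t x') μ) x y) ≤ C ∧
    frob (mixed (mderiv2 (V t x) μ) y z) ≤ C

/-- The class `𝒞_V`. -/
structure ClassV (T : ℝ) (V : ℝ → Eu n → P2 n → ℝ) : Prop where
  regular : MasterRegular T V
  mdiff3 : ∀ t ∈ Icc 0 T, ∀ x, MDiff3 (V t x)
  x_m : ∀ t ∈ Icc 0 T, ∀ μ y, PDiff2 (fun x => mderiv (V t x) μ y)
  t_m : ∀ x μ y, TDiff T (fun t => mderiv (V t x) μ y)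
  y_mm : ∀ t ∈ Icc 0 T, ∀ x μ z, PDiff2 (fun y => mderiv2 (V t x) μ y z)
  x_mm : ∀ t ∈ Icc 0 T, ∀ μ y z, PDiff (fun x => mderiv2 (V t x) μ y z)
  xy_mm : ∀ t ∈ Icc 0 T, ∀ μ z, MixedDiff (fun x y => mderiv2 (V t x) μ y z)
  y_mmm : ∀ t ∈ Icc 0 T, ∀ x μ z w, PDiff (fun y => mderiv3 (V t x) μ y z w)
  yz_mmm : ∀ t ∈ Icc 0 T, ∀ x μ w, MixedDiff (fun y z => mderiv3 (V t x) μ y z w)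
  cont_mmm : JointCont T (fun t (a : Eu n × P2 n × Eu n × Eu n × Eu n) =>
    mderiv3 (V t a.1) a.2.1 a.2.2.1 a.2.2.2.1 a.2.2.2.2)
  cont_x_m : JointCont T (fun t (a : Eu n × P2 n × Eu n) =>
    grad (fun x => mderiv (V t x) a.2.1 a.2.2) a.1)
  cont_xx_m : JointCont T (fun t (a : Eu n × P2 n × Eu n) =>
    hess (fun x => mderiv (V t x) a.2.1 a.2.2) a.1)
  cont_t_m : JointCont T (fun t (a : Eu n × P2 n × Eu n) =>
    dt T (fun s => mderiv (V s a.1) a.2.1 a.2.2) t)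
  cont_y_mm : JointCont T (fun t (a : Eu n × P2 n × Eu n × Eu n) =>
    grad (fun y => mderiv2 (V t a.1) a.2.1 y a.2.2.2) a.2.2.1)
  cont_x_mm : JointCont T (fun t (a : Eu n × P2 n × Eu n × Eu n) =>
    grad (fun x => mderiv2 (V t x) a.2.1 a.2.2.1 a.2.2.2) a.1)
  cont_yy_mm : JointCont T (fun t (a : Eu n × P2 n × Eu n × Eu n) =>
    hess (fun y => mderiv2 (V t a.1) a.2.1 y a.2.2.2) a.2.2.1)
  cont_xy_mm : JointCont T (fun t (a : Eu n × P2 n × Eu n × Eu n) =>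
    mixed (fun x y => mderiv2 (V t x) a.2.1 y a.2.2.2) a.1 a.2.2.1)
  cont_y_mmm : JointCont T (fun t (a : Eu n × P2 n × Eu n × Eu n × Eu n) =>
    grad (fun y => mderiv3 (V t a.1) a.2.1 y a.2.2.2.1 a.2.2.2.2) a.2.2.1)
  cont_yz_mmm : JointCont T (fun t (a : Eu n × P2 n × Eu n × Eu n × Eu n) =>
    mixed (fun y z => mderiv3 (V t a.1) a.2.1 y z a.2.2.2.2) a.2.2.1 a.2.2.2.1)
  growth : MasterGrowth T V
  growth' : ∃ C : ℝ, ∀ t ∈ Icc 0 T, ∀ (x : Eu n) (μ : P2 n) (y z w : Eu n),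
    |V t x μ| ≤ C * (1 + ‖x‖ ^ 2 + μ.m1 ^ 2) ∧
    ‖grad (fun x' => V t x' μ) x‖ ≤ C * (1 + ‖x‖ + μ.m1) ∧
    frob (hess (fun x' => V t x' μ) x) ≤ C ∧
    |dt T (fun s => mderiv (V s x) μ y) t| ≤ C * (1 + ‖x‖ ^ 2 + ‖y‖ ^ 2 + μ.m1 ^ 2) ∧
    ‖grad (fun x' => mderiv (V t x') μ y) x‖ ≤ C * (1 + ‖x‖ + ‖y‖ + μ.m1) ∧
    frob (hess (fun x' => mderiv (V t x') μ y) x) ≤ C ∧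
    ‖grad (fun y' => mderiv2 (V t x) μ y' z) y‖ ≤ C * (1 + ‖x‖ + ‖y‖ + ‖z‖ + μ.m1) ∧
    frob (hess (fun y' => mderiv2 (V t x) μ y' z) y) ≤ C ∧
    frob (mixed (fun x' y' => mderiv2 (V t x') μ y' z) x y) ≤ C ∧
    |mderiv3 (V t x) μ y z w| ≤
      C * (1 + ‖x‖ ^ 2 + ‖y‖ ^ 2 + ‖z‖ ^ 2 + ‖w‖ ^ 2 + μ.m1 ^ 2) ∧
    ‖grad (fun y' => mderiv3 (V t x) μ y' z w) y‖ ≤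
      C * (1 + ‖x‖ + ‖y‖ + ‖z‖ + ‖w‖ + μ.m1) ∧
    frob (mixed (fun y' z' => mderiv3 (V t x) μ y' z' w) y z) ≤ C

/-- The class `𝒞_M`. -/
structure ClassM (T : ℝ) (M : ℝ → P2 n → ℝ) : Prop where
  tdiff : ∀ μ, TDiff T (fun t => M t μ)
  mdiff : ∀ t ∈ Icc 0 T, MDiff2 (M t)
  ydiff : ∀ t ∈ Icc 0 T, ∀ μ, PDiff2 (mderiv (M t) μ)
  yzdiff : ∀ t ∈ Icc 0 T, ∀ μ, MixedDiff (mderiv2 (M t) μ)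
  cont : JointCont T M
  cont_t : JointCont T (fun t (μ : P2 n) => dt T (fun s => M s μ) t)
  cont_m : JointCont T (fun t (a : P2 n × Eu n) => mderiv (M t) a.1 a.2)
  cont_mm : JointCont T (fun t (a : P2 n × Eu n × Eu n) => mderiv2 (M t) a.1 a.2.1 a.2.2)
  cont_y_m : JointCont T (fun t (a : P2 n × Eu n) => grad (mderiv (M t) a.1) a.2)
  cont_yy_m : JointCont T (fun t (a : P2 n × Eu n) => hess (mderiv (M t) a.1) a.2)
  cont_yz_mm : JointCont T (fun t (a : P2 n × Eu n × Eu n) =>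
    mixed (mderiv2 (M t) a.1) a.2.1 a.2.2)
  growth : ∃ C : ℝ, ∀ t ∈ Icc 0 T, ∀ (μ : P2 n) (y z : Eu n),
    |mderiv (M t) μ y| ≤ C * (1 + ‖y‖ ^ 2 + μ.m2) ∧
    |mderiv2 (M t) μ y z| ≤ C * (1 + ‖y‖ ^ 2 + ‖z‖ ^ 2 + μ.m2) ∧
    ‖grad (mderiv (M t) μ) y‖ ≤ C * (1 + ‖y‖ + μ.m1) ∧
    frob (hess (mderiv (M t) μ) y) ≤ C ∧
    frob (mixed (mderiv2 (M t) μ) y z) ≤ C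

end Regularity

/-! ### The master equations -/

/-- `Ū(t, μ) = ⟨μ(dy), V(t, y, μ)⟩`. -/
def Ubar {n : ℕ} (V : ℝ → Eu n → P2 n → ℝ) (t : ℝ) (μ : P2 n) : ℝ :=
  ∫ y, V t y μ ∂μ.meas

/-- `U(t, x, μ) = V(t, x, μ) + M(t, μ) + ⟨μ(dy), δ_μ V(t, y, μ; x) - δ_μ V(t, y, μ; y)⟩`. -/
def IVF {n : ℕ} (V : ℝ → Eu n → P2 n → ℝ) (M : ℝ → P2 n → ℝ) (t : ℝ) (x : Eu n)
    (μ : P2 n) : ℝ :=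
  V t x μ + M t μ + ∫ y, (mderiv (V t y) μ x - mderiv (V t y) μ y) ∂μ.meas

namespace Model

variable {n m p q : ℕ} (P : Model n m p q)

/-- The pair `(V, φ)` solves the master equation of the value function. -/
structure IsMasterSolution (V : ℝ → Eu n → P2 n → ℝ) (φ : ℝ → Eu n → P2 n → Eu m) : Prop where
  regular : MasterRegular P.T V
  φ_mem : ∀ t ∈ Icc 0 P.T, ∀ x μ, φ t x μ ∈ P.ctrl
  φ_cont : JointCont P.T (fun t (a : Eu n × P2 n) => φ t a.1 a.2)
  φ_growth : ∃ C : ℝ, ∀ t ∈ Icc 0 P.T, ∀ x μ, ‖φ t x μ‖ ≤ C * (1 + ‖x‖ + μ.m1)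
  growth : MasterGrowth P.T V
  minimizes : ∀ t ∈ Icc 0 P.T, ∀ x μ, ∀ u ∈ P.ctrl,
    P.hamiltonian V t x (φ t x μ) μ ≤ P.hamiltonian V t x u μ
  equation : ∀ t ∈ Icc 0 P.T, ∀ x μ,
    - dt P.T (fun s => V s x μ) t =
      P.gen (fun y => P.fstar φ t y μ) (V t) x μ + P.Lstar φ t x μ
  terminal : ∀ x μ, V P.T x μ = P.g x μ

/-- The derivatives `δ_μ` and `δ_{μμ}` of the closed-loop coefficients `f*`, `L*` and of `g`
exist, are jointly continuous, and satisfy the growth conditions. -/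
structure CoeffRegular (φ : ℝ → Eu n → P2 n → Eu m) : Prop where
  f_mdiff : ∀ t ∈ Icc 0 P.T, ∀ x i, MDiff2 (fun μ => P.fstar φ t x μ i)
  L_mdiff : ∀ t ∈ Icc 0 P.T, ∀ x, MDiff2 (P.Lstar φ t x)
  g_mdiff : ∀ x, MDiff2 (P.g x)
  f_cont_m : JointCont P.T (fun t (a : Eu n × P2 n × Eu n) =>
    mderivVec (P.fstar φ t a.1) a.2.1 a.2.2)
  f_cont_mm : JointCont P.T (fun t (a : Eu n × P2 n × Eu n × Eu n) =>
    mderivVec2 (P.fstar φ t a.1) a.2.1 a.2.2.1 a.2.2.2)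
  L_cont_m : JointCont P.T (fun t (a : Eu n × P2 n × Eu n) =>
    mderiv (P.Lstar φ t a.1) a.2.1 a.2.2)
  L_cont_mm : JointCont P.T (fun t (a : Eu n × P2 n × Eu n × Eu n) =>
    mderiv2 (P.Lstar φ t a.1) a.2.1 a.2.2.1 a.2.2.2)
  g_cont_m : Continuous (fun a : Eu n × P2 n × Eu n => mderiv (P.g a.1) a.2.1 a.2.2)
  g_cont_mm : Continuous (fun a : Eu n × P2 n × Eu n × Eu n =>
    mderiv2 (P.g a.1) a.2.1 a.2.2.1 a.2.2.2)
  growth : ∃ C : ℝ, ∀ t ∈ Icc 0 P.T, ∀ (x : Eu n) (μ : P2 n) (y z : Eu n),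
    ‖mderivVec (P.fstar φ t x) μ y‖ ≤ C * (1 + ‖x‖ + ‖y‖ + μ.m1) ∧
    ‖mderivVec2 (P.fstar φ t x) μ y z‖ ≤ C * (1 + ‖x‖ + ‖y‖ + ‖z‖ + μ.m1) ∧
    |mderiv (P.Lstar φ t x) μ y| ≤ C * (1 + ‖x‖ ^ 2 + ‖y‖ ^ 2 + μ.m1 ^ 2) ∧
    |mderiv2 (P.Lstar φ t x) μ y z| ≤ C * (1 + ‖x‖ ^ 2 + ‖y‖ ^ 2 + ‖z‖ ^ 2 + μ.m1 ^ 2) ∧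
    |mderiv (P.g x) μ y| ≤ C * (1 + ‖x‖ ^ 2 + ‖y‖ ^ 2 + μ.m1 ^ 2) ∧
    |mderiv2 (P.g x) μ y z| ≤ C * (1 + ‖x‖ ^ 2 + ‖y‖ ^ 2 + ‖z‖ ^ 2 + μ.m1 ^ 2)

/-- `M` belongs to `𝒞_M` and solves the equation of the adjustment term, with `M(T, ·) = 0`. -/
structure IsAdjustment (V : ℝ → Eu n → P2 n → ℝ) (φ : ℝ → Eu n → P2 n → Eu m)
    (M : ℝ → P2 n → ℝ) : Prop where
  mem : ClassM P.T M
  equation : ∀ t ∈ Icc 0 P.T, ∀ μ,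
    0 = dt P.T (fun s => M s μ) t
      + P.popGen (fun y => P.fstar φ t y μ) (M t) μ
      + (∫ a : Eu n × Eu n, inner ℝ (grad (mderiv (V t a.2) μ) a.1)
          (mderivVec (P.fstar φ t a.1) μ a.2 - mderivVec (P.fstar φ t a.1) μ a.1)
          ∂(μ.meas.prod μ.meas))
      + 1 / 2 * (∫ a : Eu n × Eu n, (mixed (mderiv2 (V t a.2) μ) a.1 a.1 * P.S).trace
          ∂(μ.meas.prod μ.meas))
  terminal : ∀ μ, M P.T μ = 0

/-- `U` solves, in the classical sense, the master equation of the instrumental value function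
(with `Ū` built from `V`): all derivatives in the equation exist, those of `U` are jointly
continuous, all integrals in the equation converge, and the equation and the terminal condition
hold pointwise. -/
structure IsIVFSolution (V : ℝ → Eu n → P2 n → ℝ) (φ : ℝ → Eu n → P2 n → Eu m)
    (U : ℝ → Eu n → P2 n → ℝ) : Prop where
  regular : MasterRegular P.T U
  ubar_mdiff : ∀ t ∈ Icc 0 P.T, MDiff2 (Ubar V t)
  ubar_ydiff : ∀ t ∈ Icc 0 P.T, ∀ μ, PDiff (mderiv (Ubar V t) μ)
  ubar_yzdiff : ∀ t ∈ Icc 0 P.T, ∀ μ, MixedDiff (mderiv2 (Ubar V t) μ)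
  int_y : ∀ t ∈ Icc 0 P.T, ∀ x μ, Integrable (fun y =>
    inner ℝ (grad (mderiv (U t x) μ) y) (P.fstar φ t y μ)) μ.meas
  int_yy : ∀ t ∈ Icc 0 P.T, ∀ x μ, Integrable (fun y =>
    (hess (mderiv (U t x) μ) y * (P.S + P.S₀)).trace) μ.meas
  int_xy : ∀ t ∈ Icc 0 P.T, ∀ x μ, Integrable (fun y =>
    (mixed (fun x' => mderiv (U t x') μ) x y * P.S₀).trace) μ.meas
  int_yz : ∀ t ∈ Icc 0 P.T, ∀ x μ, Integrable (fun a : Eu n × Eu n =>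
    (mixed (mderiv2 (U t x) μ) a.1 a.2 * P.S₀).trace) (μ.meas.prod μ.meas)
  int_L : ∀ t ∈ Icc 0 P.T, ∀ x μ, Integrable (fun y =>
    mderiv (P.Lstar φ t y) μ x - mderiv (P.Lstar φ t y) μ y) μ.meas
  int_f : ∀ t ∈ Icc 0 P.T, ∀ x μ, Integrable (fun y =>
    inner ℝ (grad (mderiv (Ubar V t) μ) y)
      (mderivVec (P.fstar φ t y) μ x - mderivVec (P.fstar φ t y) μ y)) μ.meas
  int_ubar : ∀ t ∈ Icc 0 P.T, ∀ μ, Integrable (fun y =>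
    (mixed (mderiv2 (Ubar V t) μ) y y * P.S).trace) μ.meas
  int_terminal : ∀ x μ, Integrable (fun y =>
    mderiv (P.g y) μ x - mderiv (P.g y) μ y) μ.meas
  equation : ∀ t ∈ Icc 0 P.T, ∀ x μ,
    0 = dt P.T (fun s => U s x μ) t
      + P.gen (fun y => P.fstar φ t y μ) (U t) x μ
      + P.Lstar φ t x μ
      + (∫ y, (mderiv (P.Lstar φ t y) μ x - mderiv (P.Lstar φ t y) μ y) ∂μ.meas)
      + (∫ y, inner ℝ (grad (mderiv (Ubar V t) μ) y)
          (mderivVec (P.fstar φ t y) μ x - mderivVec (P.fstar φ t y) μ y) ∂μ.meas)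
      + 1 / 2 * (∫ y, (mixed (mderiv2 (Ubar V t) μ) y y * P.S).trace ∂μ.meas)
  terminal : ∀ x μ, U P.T x μ =
    P.g x μ + ∫ y, (mderiv (P.g y) μ x - mderiv (P.g y) μ y) ∂μ.meas

end Model

end SocialMFC

end

/-! Along the fixed feedback `φ` the equation of `V` is an identity `∂_t V + 𝓛_t V + L* = 0` in the
state and the measure, so it can be differentiated in `μ`. Averaging the differentiated identity
over the state against `μ`, once with the new variable held at `x` and once with it equal to the
averaged state, gives equations for `W(t,x,μ) = ⟨μ(dy), δ_μ V(t,y,μ;x)⟩` and `D(t,μ) = ⟨μ(dy), δ_μ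
V(t,y,μ;y)⟩`. Since `U = V + M + W - D`, the claim is the sum of the equations of `V`, `M` and `W`
minus that of `D`.

For `W` the averages reassemble into `𝓛_t W`. The only drift term left over is `⟨μ(dz), ∂_z δ_μ Ū(z)
δ_μ f*(z;x)⟩`, because `∂_z δ_μ Ū(z) = V_x(z) + ⟨μ(dy), ∂_z δ_μ V(y;z)⟩`. State and population
exchange roles here, so the common noise terms match only after symmetrization in the two indices,
which is all that the symmetric matrix `Σ₀` sees (`VJet.equation_exch`).

For `D` there are two discrepancies. The Hessian of `y ↦ δ_μ V(y;y)` contains `∂_{xy} δ_μ V` and its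
transpose; their weight is `½(Σ+Σ₀)` in `𝓛_t D` but `½Σ₀` in the averaged identity, so `½Σ` remains
(`VJet.equation_diag`). The drift term contains `δ_μ f*(z;y)` where the claim has `δ_μ f*(z;z)`. The
equation of `M` supplies this drift difference, and also `½ Tr[∂_{yz} δ_{μμ} V Σ]` on the diagonal,
which together with the leftover cross terms is the trace of `∂_{yz} δ_{μμ} Ū`
(`VJet.integral_ubar_drift`, `VJet.integral_ubar_noise`).

The analysis behind this rests on four facts. Integrals of continuous functions of at most quadratic
growth are continuous in the Wasserstein distance (`P2.continuous_integral`). The measure derivative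
commutes with real derivatives (`hasMDeriv_deriv`), by Peano's form of the symmetry of mixed
partials along segments of measures. An integral against `μ` has an explicit measure derivative
(`MD.integral`). Finally `δ_{μμ}` is symmetric up to first-order terms caused by the normalization
`⟨μ, h⟩ = 0` (`MD.symm`); this carries the assumed bounds, which concern only some slots of `δ_{μμ}
V` and `δ_{μμμ} V`, to the slots in which `W`, `D` and `Ū` are differentiated. -/

set_option linter.unusedSectionVars false

noncomputable section

/-! ### The Wasserstein distance as a pseudometric. -/

namespace SocialMFC
variable {n : ℕ}

namespace P2

instance (μ : P2 n) : IsProbabilityMeasure μ.meas := μ.prob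

/-- Couplings of two elements of `P2`. -/
def IsCoupling (μ ν : P2 n) (π : Measure (Eu n × Eu n)) : Prop :=
  π.map Prod.fst = μ.meas ∧ π.map Prod.snd = ν.meas

/-- The quadratic transport cost of a coupling. -/
def cost (π : Measure (Eu n × Eu n)) : ENNReal := ∫⁻ p, edist p.1 p.2 ^ 2 ∂π

lemma W2sq_le_cost {μ ν : P2 n} {π : Measure (Eu n × Eu n)} (h : IsCoupling μ ν π) :
    W2sq μ ν ≤ cost π :=
  iInf₂_le π h

lemma IsCoupling.isProbabilityMeasure {μ ν : P2 n} {π : Measure (Eu n × Eu n)}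
    (h : IsCoupling μ ν π) : IsProbabilityMeasure π := by
  constructor
  have := congrArg (fun m => m univ) h.1
  simpa [Measure.map_apply measurable_fst MeasurableSet.univ] using this

lemma isCoupling_prod (μ ν : P2 n) : IsCoupling μ ν (μ.meas.prod ν.meas) := by
  constructor <;> simp

lemma measurable_edist_sq : Measurable (fun p : Eu n × Eu n => edist p.1 p.2 ^ 2) := by
  fun_prop

lemma lintegral_enorm_sq_lt_top (μ : P2 n) : ∫⁻ y, ‖y‖ₑ ^ 2 ∂μ.meas < ⊤ := by
  have h := μ.moment.2
  have e : (fun y : Eu n => ‖‖y‖ ^ 2‖ₑ) = fun y => ‖y‖ₑ ^ 2 := by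
    ext y; simp
  simpa only [HasFiniteIntegral, e] using h

lemma edist_sq_le (x y : Eu n) : edist x y ^ 2 ≤ 2 * (‖x‖ₑ ^ 2 + ‖y‖ₑ ^ 2) := by
  have h1 : edist x y = ENNReal.ofReal (dist x y) := edist_dist x y
  have h2 : ‖x‖ₑ = ENNReal.ofReal ‖x‖ := (ofReal_norm x).symm
  have h3 : ‖y‖ₑ = ENNReal.ofReal ‖y‖ := (ofReal_norm y).symm
  rw [h1, h2, h3, ← ENNReal.ofReal_pow dist_nonneg, ← ENNReal.ofReal_pow (norm_nonneg _),
    ← ENNReal.ofReal_pow (norm_nonneg _), ← ENNReal.ofReal_add (by positivity) (by positivity)]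
  refine le_of_le_of_eq (ENNReal.ofReal_le_ofReal (q := 2 * (‖x‖ ^ 2 + ‖y‖ ^ 2)) ?_) ?_
  swap
  · rw [ENNReal.ofReal_mul (by norm_num)]
    simp
  have := dist_le_norm_add_norm x y
  nlinarith [sq_nonneg (‖x‖ - ‖y‖), dist_nonneg (x := x) (y := y), norm_nonneg x, norm_nonneg y]

lemma cost_lt_top {μ ν : P2 n} {π : Measure (Eu n × Eu n)} (h : IsCoupling μ ν π) :
    cost π < ⊤ := by
  have h1 : ∫⁻ p, ‖p.1‖ₑ ^ 2 ∂π < ⊤ := by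
    have := lintegral_enorm_sq_lt_top μ
    rwa [← h.1, lintegral_map (by fun_prop) measurable_fst] at this
  have h2 : ∫⁻ p, ‖p.2‖ₑ ^ 2 ∂π < ⊤ := by
    have := lintegral_enorm_sq_lt_top ν
    rwa [← h.2, lintegral_map (by fun_prop) measurable_snd] at this
  calc cost π ≤ ∫⁻ p, 2 * (‖p.1‖ₑ ^ 2 + ‖p.2‖ₑ ^ 2) ∂π :=
        lintegral_mono fun p => edist_sq_le p.1 p.2
    _ = 2 * (∫⁻ p, ‖p.1‖ₑ ^ 2 ∂π + ∫⁻ p, ‖p.2‖ₑ ^ 2 ∂π) := by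
        rw [lintegral_const_mul _ (by fun_prop), lintegral_add_left (by fun_prop)]
    _ < ⊤ := ENNReal.mul_lt_top (by norm_num) (ENNReal.add_lt_top.2 ⟨h1, h2⟩)

/-- The product coupling has finite cost because second moments are finite. Without this, `toReal`
in `W2` would turn an infinite cost into distance zero. -/
lemma W2sq_ne_top (μ ν : P2 n) : W2sq μ ν ≠ ⊤ :=
  ((W2sq_le_cost (isCoupling_prod μ ν)).trans_lt (cost_lt_top (isCoupling_prod μ ν))).ne

lemma W2_nonneg (μ ν : P2 n) : 0 ≤ W2 μ ν := Real.sqrt_nonneg _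

lemma W2_le_of_coupling {μ ν : P2 n} {π : Measure (Eu n × Eu n)} (h : IsCoupling μ ν π)
    {a : ℝ} (ha : 0 ≤ a) (hc : cost π ≤ ENNReal.ofReal (a ^ 2)) : W2 μ ν ≤ a := by
  refine Real.sqrt_le_iff.2 ⟨ha, ?_⟩
  exact ENNReal.toReal_le_of_le_ofReal (by positivity) ((W2sq_le_cost h).trans hc)

/-- Almost optimal couplings come directly from the infimum and suffice throughout, so the existence
of an optimal coupling is never needed. -/
lemma exists_coupling_of_W2_lt {μ ν : P2 n} {a : ℝ} (h : W2 μ ν < a) :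
    ∃ π, IsCoupling μ ν π ∧ cost π < ENNReal.ofReal (a ^ 2) := by
  have ha : 0 < a := (W2_nonneg _ _).trans_lt h
  have h1 : (W2sq μ ν).toReal < a ^ 2 := by
    rwa [W2, Real.sqrt_lt' ha] at h
  have h2 : W2sq μ ν < ENNReal.ofReal (a ^ 2) :=
    (ENNReal.lt_ofReal_iff_toReal_lt (W2sq_ne_top _ _)).2 h1
  obtain ⟨π, hπ⟩ := iInf_lt_iff.1 h2
  obtain ⟨hc, hl⟩ := iInf_lt_iff.1 hπ
  exact ⟨π, hc, hl⟩

lemma isCoupling_diag (μ : P2 n) : IsCoupling μ μ (μ.meas.map fun y => (y, y)) := by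
  constructor
  · rw [Measure.map_map measurable_fst (by fun_prop)]
    exact Measure.map_id
  · rw [Measure.map_map measurable_snd (by fun_prop)]
    exact Measure.map_id

lemma cost_diag (m : Measure (Eu n)) : cost (m.map fun y => (y, y)) = 0 := by
  rw [cost, lintegral_map measurable_edist_sq (by fun_prop)]
  simp

lemma W2_self (μ : P2 n) : W2 μ μ = 0 :=
  le_antisymm (W2_le_of_coupling (isCoupling_diag μ) le_rfl (by simp [cost_diag])) (W2_nonneg _ _)

lemma IsCoupling.swap {μ ν : P2 n} {π : Measure (Eu n × Eu n)} (h : IsCoupling μ ν π) :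
    IsCoupling ν μ (π.map Prod.swap) := by
  constructor
  · rw [Measure.map_map measurable_fst measurable_swap]; exact h.2
  · rw [Measure.map_map measurable_snd measurable_swap]; exact h.1

lemma cost_swap (π : Measure (Eu n × Eu n)) : cost (π.map Prod.swap) = cost π := by
  rw [cost, lintegral_map measurable_edist_sq measurable_swap]
  simp [cost, edist_comm]

lemma W2_comm (μ ν : P2 n) : W2 μ ν = W2 ν μ := by
  have key : ∀ μ ν : P2 n, W2 μ ν ≤ W2 ν μ := by
    intro μ ν
    refine le_of_forall_gt_imp_ge_of_dense fun a ha => ?_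
    obtain ⟨π, hc, hl⟩ := exists_coupling_of_W2_lt ha
    exact W2_le_of_coupling hc.swap ((W2_nonneg _ _).trans ha.le) (by rw [cost_swap]; exact hl.le)
  exact le_antisymm (key _ _) (key _ _)

/-- Gluing: `π₂` is disintegrated over its first marginal, and its conditional law is attached to
the second coordinate of `π₁`. This is consistent because both marginals are `ν`. -/
lemma exists_glue {μ ν ρ : P2 n} {π₁ π₂ : Measure (Eu n × Eu n)} (h₁ : IsCoupling μ ν π₁)
    (h₂ : IsCoupling ν ρ π₂) : ∃ γ : Measure ((Eu n × Eu n) × Eu n),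
      γ.map Prod.fst = π₁ ∧ γ.map (fun p => (p.1.2, p.2)) = π₂ := by
  have := h₁.isProbabilityMeasure
  have := h₂.isProbabilityMeasure
  let κ := π₂.condKernel
  refine ⟨π₁.compProd (κ.comap Prod.snd measurable_snd), ?_, ?_⟩
  · exact Measure.fst_compProd _ _
  · have e : π₂ = (π₁.map Prod.snd).compProd κ := by
      rw [h₁.2, ← h₂.1]
      exact (π₂.disintegrate κ).symm
    conv_rhs => rw [e]
    have hf : Measurable (fun p : (Eu n × Eu n) × Eu n => (p.1.2, p.2)) := by fun_prop
    have : IsFiniteMeasure (π₁.map Prod.snd) := by rw [h₁.2]; infer_instance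
    refine Measure.ext_of_lintegral _ fun f hf' => ?_
    rw [lintegral_map hf' hf,
      Measure.lintegral_compProd (f := fun p : (Eu n × Eu n) × Eu n => f (p.1.2, p.2))
        (hf'.comp hf),
      Measure.lintegral_compProd hf', lintegral_map hf'.lintegral_kernel_prod_right' measurable_snd]
    rfl

/-- Minkowski's inequality in `L²` of the glued measure. A slack of `ε / 2` on each coupling
replaces optimality. -/
lemma W2_triangle (μ ν ρ : P2 n) : W2 μ ρ ≤ W2 μ ν + W2 ν ρ := by
  refine le_of_forall_pos_le_add fun ε hε => ?_
  obtain ⟨π₁, h₁, l₁⟩ := exists_coupling_of_W2_lt (lt_add_of_pos_right (W2 μ ν) (half_pos hε))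
  obtain ⟨π₂, h₂, l₂⟩ := exists_coupling_of_W2_lt (lt_add_of_pos_right (W2 ν ρ) (half_pos hε))
  obtain ⟨γ, g₁, g₂⟩ := exists_glue h₁ h₂
  have hm : Measurable (fun p : (Eu n × Eu n) × Eu n => (p.1.1, p.2)) := by fun_prop
  have hm' : Measurable (fun p : (Eu n × Eu n) × Eu n => (p.1.2, p.2)) := by fun_prop
  have hc : IsCoupling μ ρ (γ.map fun p => (p.1.1, p.2)) := by
    constructor
    · rw [Measure.map_map measurable_fst hm, ← h₁.1, ← g₁,
        Measure.map_map measurable_fst measurable_fst]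
      rfl
    · rw [Measure.map_map measurable_snd hm, ← h₂.2, ← g₂, Measure.map_map measurable_snd hm']
      rfl
  set a := W2 μ ν + ε / 2
  set b := W2 ν ρ + ε / 2
  have ha : 0 ≤ a := add_nonneg (W2_nonneg _ _) (half_pos hε).le
  have hb : 0 ≤ b := add_nonneg (W2_nonneg _ _) (half_pos hε).le
  have key : cost (γ.map fun p => (p.1.1, p.2)) ≤ ENNReal.ofReal ((a + b) ^ 2) := by
    rw [cost, lintegral_map measurable_edist_sq hm]
    have c₁ : (∫⁻ p, edist p.1.1 p.1.2 ^ (2 : ℝ) ∂γ) ^ (1 / (2 : ℝ)) ≤ ENNReal.ofReal a := by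
      have : ∫⁻ p, edist p.1.1 p.1.2 ^ (2 : ℝ) ∂γ = cost π₁ := by
        rw [cost, ← g₁, lintegral_map measurable_edist_sq measurable_fst]
        simp
      rw [this]
      refine (ENNReal.rpow_le_rpow l₁.le (by norm_num)).trans (le_of_eq ?_)
      rw [ENNReal.ofReal_pow ha, ← ENNReal.rpow_natCast, ← ENNReal.rpow_mul]
      norm_num
    have c₂ : (∫⁻ p, edist p.1.2 p.2 ^ (2 : ℝ) ∂γ) ^ (1 / (2 : ℝ)) ≤ ENNReal.ofReal b := by
      have : ∫⁻ p, edist p.1.2 p.2 ^ (2 : ℝ) ∂γ = cost π₂ := by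
        rw [cost, ← g₂, lintegral_map measurable_edist_sq hm']
        simp
      rw [this]
      refine (ENNReal.rpow_le_rpow l₂.le (by norm_num)).trans (le_of_eq ?_)
      rw [ENNReal.ofReal_pow hb, ← ENNReal.rpow_natCast, ← ENNReal.rpow_mul]
      norm_num
    have c₃ : (∫⁻ p, (edist p.1.1 p.1.2 + edist p.1.2 p.2) ^ (2 : ℝ) ∂γ) ^ (1 / (2 : ℝ)) ≤
        ENNReal.ofReal (a + b) := by
      refine (ENNReal.lintegral_Lp_add_le (f := fun p : (Eu n × Eu n) × Eu n => edist p.1.1 p.1.2)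
        (g := fun p => edist p.1.2 p.2) (by fun_prop) (by fun_prop) (by norm_num)).trans ?_
      rw [ENNReal.ofReal_add ha hb]
      exact add_le_add c₁ c₂
    have c₄ := ENNReal.rpow_le_rpow c₃ (z := 2) (by norm_num)
    rw [← ENNReal.rpow_mul] at c₄
    norm_num at c₄
    rw [ENNReal.ofReal_pow (add_nonneg ha hb)]
    refine le_trans (lintegral_mono fun p => ?_) c₄
    exact pow_le_pow_left₀ (zero_le) (edist_triangle _ _ _) 2
  have := W2_le_of_coupling hc (add_nonneg ha hb) key
  simp only [a, b] at this
  linarith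

/-- The Wasserstein distance makes `P2` a pseudometric space with the given topology. -/
instance : PseudoMetricSpace (P2 n) :=
  PseudoMetricSpace.ofDistTopology W2 W2_self W2_comm W2_triangle fun _ => Iff.rfl

lemma dist_def (μ ν : P2 n) : dist μ ν = W2 μ ν := rfl

end P2
end SocialMFC

/-! ### Continuity of integrals with quadratic growth, and mixtures of measures. -/

namespace SocialMFC
variable {n : ℕ}

namespace P2

lemma integrable_one_add_sq (ν : P2 n) : Integrable (fun y : Eu n => 1 + ‖y‖ ^ 2) ν.meas :=
  (integrable_const 1).add ν.moment

lemma integrable_of_abs_le {G : Eu n → ℝ} (hG : Continuous G) {K : ℝ}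
    (hb : ∀ y, |G y| ≤ K * (1 + ‖y‖ ^ 2)) (ν : P2 n) : Integrable G ν.meas :=
  (ν.integrable_one_add_sq.const_mul K).mono' hG.aestronglyMeasurable (ae_of_all _ hb)

lemma integrable_dist_sq {μ ν : P2 n} {π : Measure (Eu n × Eu n)} (h : IsCoupling μ ν π) :
    Integrable (fun p => ‖p.2 - p.1‖ ^ 2) π := by
  refine ⟨by fun_prop, ?_⟩
  have e : (fun p : Eu n × Eu n => ‖‖p.2 - p.1‖ ^ 2‖ₑ) = fun p => edist p.1 p.2 ^ 2 := by
    ext p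
    rw [edist_comm, edist_eq_enorm_sub]
    simp
  simpa only [HasFiniteIntegral, e, cost] using cost_lt_top h

lemma integral_dist_sq_le {π : Measure (Eu n × Eu n)} {a : ℝ}
    (h : cost π ≤ ENNReal.ofReal (a ^ 2)) : ∫ p, ‖p.2 - p.1‖ ^ 2 ∂π ≤ a ^ 2 := by
  have e : (fun p : Eu n × Eu n => ENNReal.ofReal (‖p.2 - p.1‖ ^ 2)) =
      fun p => edist p.1 p.2 ^ 2 := by
    ext p
    rw [edist_comm, edist_eq_enorm_sub, ENNReal.ofReal_pow (norm_nonneg _), ofReal_norm]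
  rw [integral_eq_lintegral_of_nonneg_ae (ae_of_all _ fun p => by positivity) (by fun_prop), e]
  exact ENNReal.toReal_le_of_le_ofReal (by positivity) h

lemma exists_tail_lt (μ : P2 n) (C : ℝ) {ε : ℝ} (hε : 0 < ε) :
    ∃ R : ℝ, 0 < R ∧
      ∫ y, {y : Eu n | R < ‖y‖}.indicator (fun y => C * (2 + 3 * ‖y‖ ^ 2)) y ∂μ.meas < ε := by
  have hi : Integrable (fun y : Eu n => C * (2 + 3 * ‖y‖ ^ 2)) μ.meas :=
    ((integrable_const 2).add (μ.moment.const_mul 3)).const_mul C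
  have hs : ∀ R : ℝ, MeasurableSet {y : Eu n | R < ‖y‖} := fun R =>
    (isOpen_lt continuous_const continuous_norm).measurableSet
  have : Tendsto (fun k : ℕ => ∫ y, {y : Eu n | (k : ℝ) < ‖y‖}.indicator
      (fun y => C * (2 + 3 * ‖y‖ ^ 2)) y ∂μ.meas) atTop (𝓝 (∫ _, (0 : ℝ) ∂μ.meas)) := by
    refine tendsto_integral_of_dominated_convergence (fun y => |C * (2 + 3 * ‖y‖ ^ 2)|)
      (fun k => (hi.indicator (hs k)).aestronglyMeasurable) hi.abs ?_ ?_
    · intro k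
      refine ae_of_all _ fun y => ?_
      exact norm_indicator_le_norm_self (fun y : Eu n => C * (2 + 3 * ‖y‖ ^ 2)) y
    · refine ae_of_all _ fun y => ?_
      refine tendsto_const_nhds.congr' ?_
      filter_upwards [eventually_ge_atTop ⌈‖y‖⌉₊] with k hk
      have : ‖y‖ ≤ k := Nat.ceil_le.1 hk
      simp [indicator, not_lt.2 this]
  rw [integral_zero] at this
  obtain ⟨k, hk, hk0⟩ := ((this.eventually (gt_mem_nhds hε)).and (eventually_gt_atTop 0)).exists
  exact ⟨k, by exact_mod_cast hk0, hk⟩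

/-- The tube lemma around the compact ball in the variable `(y, (x, y' - y))`. As `X` is only a
topological space, uniform continuity is not at hand. -/
lemma exists_uniform_close {X : Type*} [TopologicalSpace X] {G : X → Eu n → ℝ}
    (hG : Continuous (fun p : X × Eu n => G p.1 p.2)) (x₀ : X) (R : ℝ) {ε : ℝ} (hε : 0 < ε) :
    ∃ δ : ℝ, 0 < δ ∧ ∀ᶠ x in 𝓝 x₀, ∀ y : Eu n, ‖y‖ ≤ R → ∀ y', ‖y' - y‖ < δ →
      |G x y' - G x₀ y| < ε := by
  let N : Set (Eu n × (X × Eu n)) := {a | |G a.2.1 (a.1 + a.2.2) - G x₀ a.1| < ε}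
  have hN : IsOpen N := by
    refine isOpen_lt ?_ continuous_const
    have h1 : Continuous fun a : Eu n × (X × Eu n) => G a.2.1 (a.1 + a.2.2) :=
      hG.comp (f := fun a : Eu n × (X × Eu n) => (a.2.1, a.1 + a.2.2)) (by fun_prop)
    have h2 : Continuous fun a : Eu n × (X × Eu n) => G x₀ a.1 :=
      hG.comp (f := fun a : Eu n × (X × Eu n) => (x₀, a.1)) (by fun_prop)
    exact (h1.sub h2).abs
  obtain ⟨u, v, hu, hv, hsu, hsv, huv⟩ := generalized_tube_lemma
    (isCompact_closedBall (0 : Eu n) R) (isCompact_singleton (x := (x₀, (0 : Eu n)))) hN (by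
      rintro ⟨y, a⟩ ⟨_, ha⟩
      obtain rfl : a = (x₀, 0) := ha
      simpa [N] using hε)
  have hv' : v ∈ 𝓝 (x₀, (0 : Eu n)) := hv.mem_nhds (hsv rfl)
  rw [nhds_prod_eq] at hv'
  obtain ⟨a, ha, b, hb, hab⟩ := mem_prod_iff.1 hv'
  obtain ⟨δ, hδ, hδb⟩ := Metric.mem_nhds_iff.1 hb
  refine ⟨δ, hδ, ?_⟩
  filter_upwards [ha] with x hx y hy y' hy'
  have : (y, (x, y' - y)) ∈ N :=
    huv ⟨hsu (by simpa using hy), hab ⟨hx, hδb (by simpa using hy')⟩⟩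
  simpa [N] using this

/-- Under an almost optimal coupling of `m x` and `m x₀`, the difference `|G x y' - G x₀ y|` is at
most `ε / 3`, plus a tail in `y`, plus a multiple of `‖y' - y‖²`. The tail has small integral, and
the last term integrates to a multiple of the squared distance. This is the source of every joint
continuity statement about integrals below. -/
lemma continuous_integral {X : Type*} [TopologicalSpace X] {m : X → P2 n} (hm : Continuous m)
    {G : X → Eu n → ℝ} (hG : Continuous (fun p : X × Eu n => G p.1 p.2)) {K : X → ℝ}
    (hK : Continuous K) (hb : ∀ x y, |G x y| ≤ K x * (1 + ‖y‖ ^ 2)) :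
    Continuous fun x => ∫ y, G x y ∂(m x).meas := by
  rw [continuous_iff_continuousAt]
  intro x₀
  rw [ContinuousAt, Metric.tendsto_nhds]
  intro ε hε
  set C := |K x₀| + 1 with hC
  have hCpos : 0 < C := by positivity
  have hKC : ∀ᶠ x in 𝓝 x₀, K x < C :=
    hK.continuousAt.eventually (gt_mem_nhds ((le_abs_self _).trans_lt (lt_add_one _)))
  have hGc : ∀ x, Continuous (G x) := fun x =>
    hG.comp (f := fun y => (x, y)) (by fun_prop)
  obtain ⟨R, hR, htail⟩ := exists_tail_lt (m x₀) C (show 0 < ε / 3 by positivity)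
  obtain ⟨δ, hδ, hclose⟩ := exists_uniform_close hG x₀ R (show 0 < ε / 3 by positivity)
  set T : Eu n → ℝ := {y : Eu n | R < ‖y‖}.indicator (fun y => C * (2 + 3 * ‖y‖ ^ 2)) with hT
  -- The first summand covers `‖y‖ ≤ R` with `‖y' - y‖ ≥ δ`, where `1 ≤ ‖y' - y‖² / δ²`; the summand
  -- `2` pays for `‖y'‖² ≤ 2‖y‖² + 2‖y' - y‖²`.
  set B := C * ((2 + 3 * R ^ 2) / δ ^ 2 + 2) with hB
  have hBpos : 0 < B := by positivity
  have hTi : Integrable T (m x₀).meas :=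
    (((integrable_const 2).add ((m x₀).moment.const_mul 3)).const_mul C).indicator
      (isOpen_lt continuous_const continuous_norm).measurableSet
  set η := Real.sqrt (ε / (3 * B)) with hη
  have hη0 : 0 < η := Real.sqrt_pos.2 (by positivity)
  have hη2 : B * η ^ 2 = ε / 3 := by
    rw [hη, Real.sq_sqrt (by positivity)]
    field_simp
  have hmx : ∀ᶠ x in 𝓝 x₀, dist (m x) (m x₀) < η :=
    Metric.tendsto_nhds.1 hm.continuousAt η hη0
  filter_upwards [hKC, hclose, hmx] with x hx1 hx2 hx3
  rw [dist_comm, dist_def] at hx3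
  obtain ⟨π, hπ, hcost⟩ := exists_coupling_of_W2_lt hx3
  have := hπ.isProbabilityMeasure
  have hbx : ∀ y, |G x y| ≤ C * (1 + ‖y‖ ^ 2) := fun y =>
    (hb x y).trans (by gcongr)
  have hbx₀ : ∀ y, |G x₀ y| ≤ C * (1 + ‖y‖ ^ 2) := fun y =>
    (hb x₀ y).trans (mul_le_mul_of_nonneg_right (by linarith [le_abs_self (K x₀)]) (by positivity))
  have hpt : ∀ p : Eu n × Eu n,
      |G x p.2 - G x₀ p.1| ≤ ε / 3 + T p.1 + B * ‖p.2 - p.1‖ ^ 2 := by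
    rintro ⟨y, y'⟩
    have hsum : |G x y' - G x₀ y| ≤ C * (2 + 3 * ‖y‖ ^ 2) + 2 * C * ‖y' - y‖ ^ 2 := by
      have h1 := abs_sub (G x y') (G x₀ y)
      have h2 := hbx y'
      have h3 := hbx₀ y
      have h4 : ‖y'‖ ≤ ‖y‖ + ‖y' - y‖ := by
        have := norm_add_le y (y' - y)
        simpa using this
      have h5 : ‖y'‖ ^ 2 ≤ 2 * ‖y‖ ^ 2 + 2 * ‖y' - y‖ ^ 2 := by
        nlinarith [norm_nonneg y', sq_nonneg (‖y‖ - ‖y' - y‖)]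
      nlinarith
    have hB2 : 2 * C * ‖y' - y‖ ^ 2 ≤ B * ‖y' - y‖ ^ 2 := by
      apply mul_le_mul_of_nonneg_right _ (by positivity)
      have : 0 ≤ C * ((2 + 3 * R ^ 2) / δ ^ 2) := by positivity
      rw [hB]; linarith
    by_cases hyR : ‖y‖ ≤ R
    · have hTy : T y = 0 := by simp [hT, not_lt.2 hyR]
      simp only [hTy, add_zero]
      by_cases hyδ : ‖y' - y‖ < δ
      · have := (hx2 y hyR y' hyδ).le
        have : 0 ≤ B * ‖y' - y‖ ^ 2 := by positivity
        linarith
      · have h6 : 1 ≤ ‖y' - y‖ ^ 2 / δ ^ 2 := by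
          rw [one_le_div (by positivity)]
          exact pow_le_pow_left₀ hδ.le (not_lt.1 hyδ) 2
        have h7 : C * (2 + 3 * ‖y‖ ^ 2) ≤ C * (2 + 3 * R ^ 2) := by gcongr
        have h8 : C * (2 + 3 * R ^ 2) * 1 ≤ C * (2 + 3 * R ^ 2) * (‖y' - y‖ ^ 2 / δ ^ 2) :=
          mul_le_mul_of_nonneg_left h6 (by positivity)
        have h9 : B * ‖y' - y‖ ^ 2 =
            C * (2 + 3 * R ^ 2) * (‖y' - y‖ ^ 2 / δ ^ 2) + 2 * C * ‖y' - y‖ ^ 2 := by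
          rw [hB]; ring
        rw [h9]
        linarith
    · have hTy : T y = C * (2 + 3 * ‖y‖ ^ 2) := by
        simp [hT, not_le.1 hyR]
      simp only [hTy]
      linarith
  have hi1 : Integrable (fun p : Eu n × Eu n => G x p.2) π := by
    have := integrable_of_abs_le (hGc x) hbx (m x)
    rw [← hπ.2] at this
    exact this.comp_measurable measurable_snd
  have hi2 : Integrable (fun p : Eu n × Eu n => G x₀ p.1) π := by
    have := integrable_of_abs_le (hGc x₀) hbx₀ (m x₀)
    rw [← hπ.1] at this
    exact this.comp_measurable measurable_fst
  have hi3 : Integrable (fun p : Eu n × Eu n => T p.1) π := by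
    rw [← hπ.1] at hTi
    exact hTi.comp_measurable measurable_fst
  have hi4 := (integrable_dist_sq hπ).const_mul B
  have e1 : ∫ y, G x y ∂(m x).meas = ∫ p, G x p.2 ∂π := by
    rw [← hπ.2, integral_map (by fun_prop) (hGc x).aestronglyMeasurable]
  have e2 : ∫ y, G x₀ y ∂(m x₀).meas = ∫ p, G x₀ p.1 ∂π := by
    rw [← hπ.1, integral_map (by fun_prop) (hGc x₀).aestronglyMeasurable]
  have e3 : ∫ p, T p.1 ∂π = ∫ y, T y ∂(m x₀).meas := by
    have := hTi.aestronglyMeasurable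
    rw [← hπ.1] at this ⊢
    rw [integral_map (by fun_prop) this]
  rw [Real.dist_eq, e1, e2, ← integral_sub hi1 hi2]
  have hle := integral_dist_sq_le hcost.le
  calc |∫ p, (G x p.2 - G x₀ p.1) ∂π| ≤ ∫ p, |G x p.2 - G x₀ p.1| ∂π :=
        abs_integral_le_integral_abs
    _ ≤ ∫ p, (ε / 3 + T p.1 + B * ‖p.2 - p.1‖ ^ 2) ∂π :=
        integral_mono (hi1.sub hi2).abs (((integrable_const _).add hi3).add hi4) hpt
    _ = ε / 3 + ∫ y, T y ∂(m x₀).meas + B * ∫ p, ‖p.2 - p.1‖ ^ 2 ∂π := by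
        rw [integral_add (f := fun p : Eu n × Eu n => ε / 3 + T p.1)
          ((integrable_const _).add hi3) hi4, integral_add (integrable_const _) hi3,
          integral_const_mul, e3]
        simp
    _ < ε := by nlinarith

lemma continuous_m2 : Continuous (m2 : P2 n → ℝ) :=
  continuous_integral (X := P2 n) continuous_id (G := fun _ y => ‖y‖ ^ 2) (by fun_prop)
    (K := fun _ => 1) continuous_const (fun _ y => by
      rw [abs_of_nonneg (by positivity)]; linarith)

lemma continuous_m1 : Continuous (m1 : P2 n → ℝ) :=
  continuous_integral (X := P2 n) continuous_id (G := fun _ y => ‖y‖) (by fun_prop)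
    (K := fun _ => 1) continuous_const (fun _ y => by
      rw [abs_of_nonneg (by positivity)]; nlinarith [sq_nonneg (‖y‖ - 1)])

lemma m1_nonneg (μ : P2 n) : 0 ≤ μ.m1 := integral_nonneg fun _ => norm_nonneg _

lemma m2_nonneg (μ : P2 n) : 0 ≤ μ.m2 := integral_nonneg fun _ => by positivity

/-- The Dirac mass at a point. -/
def dirac (y : Eu n) : P2 n where
  meas := Measure.dirac y
  prob := inferInstance
  moment := integrable_dirac (by simp)

@[simp] lemma integral_dirac_meas (y : Eu n) (h : Eu n → ℝ) :
    ∫ z, h z ∂(dirac y).meas = h y := integral_dirac _ _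

@[ext] lemma ext' {μ ν : P2 n} (h : μ.meas = ν.meas) : μ = ν := by
  cases μ; cases ν; cases h; rfl

lemma clamp_of_mem {s : ℝ} (hs : s ∈ Icc (0 : ℝ) 1) : clamp s = s := by
  rw [clamp, min_eq_left hs.2, max_eq_right hs.1]

lemma continuous_clamp : Continuous clamp := by unfold clamp; fun_prop

lemma clamp_mem (s : ℝ) : clamp s ∈ Icc (0 : ℝ) 1 := ⟨clamp_nonneg s, clamp_le_one s⟩

lemma mix_clamp (μ ν : P2 n) (s : ℝ) : mix μ ν (clamp s) = mix μ ν s := by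
  ext1
  simp only [mix, clamp_of_mem (clamp_mem s)]

@[simp] lemma mix_zero (μ ν : P2 n) : mix μ ν 0 = μ := by
  ext1
  simp [mix, clamp]

lemma integral_mix {μ ν : P2 n} {s : ℝ} (hs : s ∈ Icc (0 : ℝ) 1) {h : Eu n → ℝ}
    (hμ : Integrable h μ.meas) (hν : Integrable h ν.meas) :
    ∫ y, h y ∂(mix μ ν s).meas = (1 - s) * ∫ y, h y ∂μ.meas + s * ∫ y, h y ∂ν.meas := by
  simp only [mix, clamp_of_mem hs]
  rw [integral_add_measure (hμ.smul_measure ENNReal.ofReal_ne_top)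
    (hν.smul_measure ENNReal.ofReal_ne_top), integral_smul_measure, integral_smul_measure,
    ENNReal.toReal_ofReal (by linarith [hs.2]), ENNReal.toReal_ofReal hs.1]
  rfl

/-- Moving a point of a segment towards an end point stays on the segment. This and `mix_mix_left`
reduce derivatives at an interior parameter to the defining derivatives at parameter zero. -/
lemma mix_mix_right {μ ν : P2 n} {r s : ℝ} (hr : r ∈ Icc (0 : ℝ) 1) (hs : s ∈ Icc (0 : ℝ) 1) :
    mix (mix μ ν r) ν s = mix μ ν (r + (1 - r) * s) := by
  have h1 : r + (1 - r) * s ∈ Icc (0 : ℝ) 1 := by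
    constructor <;> nlinarith [hr.1, hr.2, hs.1, hs.2, mul_nonneg (sub_nonneg.2 hr.2) hs.1,
      mul_nonneg (sub_nonneg.2 hr.2) (sub_nonneg.2 hs.2)]
  ext1
  simp only [mix, clamp_of_mem hr, clamp_of_mem hs, clamp_of_mem h1]
  rw [smul_add, smul_smul, smul_smul, add_assoc, ← add_smul,
    ← ENNReal.ofReal_mul (by linarith [hs.2]), ← ENNReal.ofReal_mul (by linarith [hs.2]),
    ← ENNReal.ofReal_add (mul_nonneg (by linarith [hs.2]) hr.1) hs.1]
  congr 3 <;> ring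

lemma mix_mix_left {μ ν : P2 n} {r s : ℝ} (hr : r ∈ Icc (0 : ℝ) 1) (hs : s ∈ Icc (0 : ℝ) 1) :
    mix (mix μ ν r) μ s = mix μ ν (r - r * s) := by
  have h1 : r - r * s ∈ Icc (0 : ℝ) 1 := by
    constructor <;> nlinarith [hr.1, hr.2, hs.1, hs.2, mul_nonneg hr.1 hs.1,
      mul_nonneg hr.1 (sub_nonneg.2 hs.2)]
  ext1
  simp only [mix, clamp_of_mem hr, clamp_of_mem hs, clamp_of_mem h1]
  rw [smul_add, smul_smul, smul_smul, add_right_comm, ← add_smul,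
    ← ENNReal.ofReal_mul (by linarith [hs.2]), ← ENNReal.ofReal_mul (by linarith [hs.2]),
    ← ENNReal.ofReal_add (mul_nonneg (by linarith [hs.2]) (by linarith [hr.2])) hs.1]
  congr 3 <;> ring

/-- Mixing with `ρ` is an affine map, so it carries segments to segments with the same
parametrization. -/
lemma mix_mix_swap {μ ν ρ : P2 n} {r s : ℝ} (hr : r ∈ Icc (0 : ℝ) 1) (hs : s ∈ Icc (0 : ℝ) 1) :
    mix (mix μ ν r) ρ s = mix (mix μ ρ s) (mix ν ρ s) r := by
  ext1
  simp only [mix, clamp_of_mem hr, clamp_of_mem hs]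
  have hr' : 0 ≤ 1 - r := by linarith [hr.2]
  have hs' : 0 ≤ 1 - s := by linarith [hs.2]
  have e : ENNReal.ofReal s =
      ENNReal.ofReal (1 - r) * ENNReal.ofReal s + ENNReal.ofReal r * ENNReal.ofReal s := by
    rw [← add_mul, ← ENNReal.ofReal_add hr' hr.1]
    simp
  conv_lhs => rw [e]
  simp only [smul_add, smul_smul, add_smul, mul_comm (ENNReal.ofReal (1 - s))]
  abel

/-- The combination `c₁ diag(μ) + c₂ diag(ν) + c₃ μ ⊗ ν` of measures on the product space. -/
def mixCoupling (μ ν : P2 n) (c₁ c₂ c₃ : ENNReal) : Measure (Eu n × Eu n) :=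
  c₁ • μ.meas.map (fun y => (y, y)) + c₂ • ν.meas.map (fun y => (y, y)) +
    c₃ • μ.meas.prod ν.meas

/-- The common part of the two mixtures stays in place, and only the mass `r - s` is transported
from `μ` to `ν`, along the product coupling. Hence the segment is Hölder continuous of order one
half. -/
lemma W2_mix_le (μ ν : P2 n) {s r : ℝ} (hs : 0 ≤ s) (hsr : s ≤ r) (hr : r ≤ 1) :
    W2 (mix μ ν s) (mix μ ν r) ≤ Real.sqrt ((r - s) * (cost (μ.meas.prod ν.meas)).toReal) := by
  have hs1 : s ∈ Icc (0 : ℝ) 1 := ⟨hs, hsr.trans hr⟩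
  have hr1 : r ∈ Icc (0 : ℝ) 1 := ⟨hs.trans hsr, hr⟩
  have hc : IsCoupling (mix μ ν s) (mix μ ν r)
      (mixCoupling μ ν (ENNReal.ofReal (1 - r)) (ENNReal.ofReal s) (ENNReal.ofReal (r - s))) := by
    constructor
    · rw [mixCoupling, Measure.map_add _ _ measurable_fst, Measure.map_add _ _ measurable_fst,
        Measure.map_smul, Measure.map_smul, Measure.map_smul, (isCoupling_diag μ).1,
        (isCoupling_diag ν).1, (isCoupling_prod μ ν).1, add_right_comm, ← add_smul,
        ← ENNReal.ofReal_add (by linarith) (by linarith)]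
      simp [mix, clamp_of_mem hs1]
    · rw [mixCoupling, Measure.map_add _ _ measurable_snd, Measure.map_add _ _ measurable_snd,
        Measure.map_smul, Measure.map_smul, Measure.map_smul, (isCoupling_diag μ).2,
        (isCoupling_diag ν).2, (isCoupling_prod μ ν).2, add_assoc, ← add_smul,
        ← ENNReal.ofReal_add (by linarith) (by linarith)]
      simp [mix, clamp_of_mem hr1]
  refine W2_le_of_coupling hc (Real.sqrt_nonneg _) ?_
  have hfin := (cost_lt_top (isCoupling_prod μ ν)).ne
  rw [Real.sq_sqrt (mul_nonneg (by linarith) ENNReal.toReal_nonneg),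
    ENNReal.ofReal_mul (by linarith), ENNReal.ofReal_toReal hfin]
  have h0 := cost_diag μ.meas
  have h0' := cost_diag ν.meas
  simp only [cost] at h0 h0'
  simp only [cost, mixCoupling, lintegral_add_measure, lintegral_smul_measure, h0, h0']
  simp

lemma W2_mix_mix_le (μ μ' ν : P2 n) (s : ℝ) : W2 (mix μ ν s) (mix μ' ν s) ≤ W2 μ μ' := by
  refine le_of_forall_gt_imp_ge_of_dense fun a ha => ?_
  obtain ⟨π, hc, hl⟩ := exists_coupling_of_W2_lt ha
  have hc' : IsCoupling (mix μ ν s) (mix μ' ν s) (ENNReal.ofReal (1 - clamp s) • π +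
      ENNReal.ofReal (clamp s) • ν.meas.map (fun y => (y, y))) := by
    constructor
    · rw [Measure.map_add _ _ measurable_fst, Measure.map_smul, Measure.map_smul, hc.1,
        (isCoupling_diag ν).1]
      rfl
    · rw [Measure.map_add _ _ measurable_snd, Measure.map_smul, Measure.map_smul, hc.2,
        (isCoupling_diag ν).2]
      rfl
  refine W2_le_of_coupling hc' ((W2_nonneg _ _).trans ha.le) ?_
  have h0 := cost_diag ν.meas
  simp only [cost] at h0 hl
  simp only [cost, lintegral_add_measure, lintegral_smul_measure, h0]
  simp only [smul_eq_mul, mul_zero, add_zero]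
  refine le_trans (mul_le_of_le_one_left (zero_le) ?_) hl.le
  exact ENNReal.ofReal_le_one.2 (by linarith [clamp_nonneg s])

lemma dist_mix_le (μ μ' ν : P2 n) (s r : ℝ) : dist (mix μ ν s) (mix μ' ν r) ≤
    Real.sqrt (|clamp r - clamp s| * (cost (μ'.meas.prod ν.meas)).toReal) + dist μ μ' := by
  have h : dist (mix μ' ν s) (mix μ' ν r) ≤
      Real.sqrt (|clamp r - clamp s| * (cost (μ'.meas.prod ν.meas)).toReal) := by
    rw [← mix_clamp μ' ν s, ← mix_clamp μ' ν r]
    rcases le_total (clamp s) (clamp r) with h | h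
    · rw [abs_of_nonneg (sub_nonneg.2 h)]
      exact W2_mix_le μ' ν (clamp_nonneg _) h (clamp_le_one _)
    · rw [abs_of_nonpos (sub_nonpos.2 h), dist_comm, neg_sub]
      exact W2_mix_le μ' ν (clamp_nonneg _) h (clamp_le_one _)
  have h' : dist (mix μ ν s) (mix μ' ν s) ≤ dist μ μ' := W2_mix_mix_le μ μ' ν s
  linarith [dist_triangle (mix μ ν s) (mix μ' ν s) (mix μ' ν r)]

lemma continuous_mix (ν : P2 n) : Continuous (fun p : P2 n × ℝ => mix p.1 ν p.2) := by
  rw [continuous_iff_continuousAt]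
  rintro ⟨μ₀, s₀⟩
  rw [ContinuousAt, tendsto_iff_dist_tendsto_zero]
  refine squeeze_zero (fun _ => dist_nonneg) (fun p => dist_mix_le p.1 μ₀ ν p.2 s₀) ?_
  have hc : Continuous (fun p : P2 n × ℝ =>
      Real.sqrt (|clamp s₀ - clamp p.2| * (cost (μ₀.meas.prod ν.meas)).toReal) + dist p.1 μ₀) := by
    have := continuous_clamp
    fun_prop
  simpa using hc.tendsto (μ₀, s₀)

end P2
end SocialMFC

namespace SocialMFC
variable {n : ℕ}

/-! ### Differentiation of functions of one or two real variables -/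

/-- Differentiation under the integral sign within a convex set. -/
lemma hasDerivWithinAt_integral {α : Type*} [MeasurableSpace α] {m : Measure α} {S : Set ℝ}
    (hS : Convex ℝ S) {F F' : ℝ → α → ℝ} {s₀ : ℝ} (hs₀ : s₀ ∈ S)
    (hFi : ∀ s ∈ S, Integrable (F s) m)
    (hF' : ∀ s ∈ S, ∀ y, HasDerivWithinAt (fun u => F u y) (F' s y) S s)
    {bound : α → ℝ} (hb : Integrable bound m) (hle : ∀ s ∈ S, ∀ y, |F' s y| ≤ bound y) :
    HasDerivWithinAt (fun s => ∫ y, F s y ∂m) (∫ y, F' s₀ y ∂m) S s₀ := by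
  rw [hasDerivWithinAt_iff_tendsto_slope]
  have hmem : ∀ᶠ s in 𝓝[S \ {s₀}] s₀, s ∈ S \ {s₀} := self_mem_nhdsWithin
  have e : ∀ᶠ s in 𝓝[S \ {s₀}] s₀, (∫ y, slope (fun u => F u y) s₀ s ∂m) =
      slope (fun s => ∫ y, F s y ∂m) s₀ s := by
    filter_upwards [hmem] with s hs
    simp only [slope_def_field]
    rw [integral_div, integral_sub (hFi s hs.1) (hFi s₀ hs₀)]
  refine Tendsto.congr' e ?_
  refine tendsto_integral_filter_of_dominated_convergence bound ?_ ?_ hb ?_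
  · filter_upwards [hmem] with s hs
    simp only [slope_def_field]
    exact (((hFi s hs.1).sub (hFi s₀ hs₀)).div_const _).aestronglyMeasurable
  · filter_upwards [hmem] with s hs
    refine ae_of_all _ fun y => ?_
    -- The mean value inequality on the convex set `S` bounds every difference quotient by `bound`,
    -- so dominated convergence applies.
    have := hS.norm_image_sub_le_of_norm_hasDerivWithin_le (f := fun u => F u y)
      (fun u hu => hF' u hu y) (fun u hu => hle u hu y) hs₀ hs.1
    rw [slope_def_field, norm_div, div_le_iff₀ (norm_pos_iff.2 (sub_ne_zero.2 hs.2))]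
    exact this
  · refine ae_of_all _ fun y => ?_
    exact hasDerivWithinAt_iff_tendsto_slope.1 (hF' s₀ hs₀ y)

/-- The symmetry of mixed partial derivatives, in the form of Peano: if `p = ∂₁ g` and
`q = ∂₂ ∂₁ g` exist, `q` is continuous at a point, and `r = ∂₂ g` exists, then `∂₁ r = q` there. -/
lemma hasDerivWithinAt_swap {A B : Set ℝ} (hA : Convex ℝ A) (hB : Convex ℝ B)
    {g p q : ℝ → ℝ → ℝ} {r : ℝ → ℝ} {a₀ b₀ : ℝ} (ha₀ : a₀ ∈ A) (hb₀ : b₀ ∈ B)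
    [hne : (𝓝[B \ {b₀}] b₀).NeBot]
    (hg : ∀ a ∈ A, ∀ b ∈ B, HasDerivWithinAt (fun u => g u b) (p a b) A a)
    (hp : ∀ a ∈ A, ∀ b ∈ B, HasDerivWithinAt (fun u => p a u) (q a b) B b)
    (hq : ContinuousWithinAt (fun c : ℝ × ℝ => q c.1 c.2) (A ×ˢ B) (a₀, b₀))
    (hr : ∀ a ∈ A, HasDerivWithinAt (fun u => g a u) (r a) B b₀) :
    HasDerivWithinAt r (q a₀ b₀) A a₀ := by
  rw [hasDerivWithinAt_iff_isLittleO, Asymptotics.isLittleO_iff]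
  intro ε hε
  rw [Metric.continuousWithinAt_iff] at hq
  obtain ⟨δ, hδ, hq⟩ := hq ε hε
  have hq' : ∀ a ∈ A ∩ Metric.ball a₀ δ, ∀ b ∈ B ∩ Metric.ball b₀ δ,
      ‖q a b - q a₀ b₀‖ ≤ ε := fun a ha b hb =>
    (hq (x := (a, b)) ⟨ha.1, hb.1⟩ (by
      rw [Prod.dist_eq]; exact max_lt ha.2 hb.2)).le
  have hcB : Convex ℝ (B ∩ Metric.ball b₀ δ) := hB.inter (convex_ball _ _)
  have hcA : Convex ℝ (A ∩ Metric.ball a₀ δ) := hA.inter (convex_ball _ _)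
  have ha₀' : a₀ ∈ A ∩ Metric.ball a₀ δ := ⟨ha₀, Metric.mem_ball_self hδ⟩
  have hb₀' : b₀ ∈ B ∩ Metric.ball b₀ δ := ⟨hb₀, Metric.mem_ball_self hδ⟩
  -- Mean value inequality in `b` for `p`, followed by one in `a` for `g`. Together they control the
  -- second difference of `g` without any derivative of `r`.
  have h1 : ∀ a ∈ A ∩ Metric.ball a₀ δ, ∀ b ∈ B ∩ Metric.ball b₀ δ,
      ‖p a b - p a b₀ - (b - b₀) * q a₀ b₀‖ ≤ ε * ‖b - b₀‖ := by
    intro a ha b hb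
    have := hcB.norm_image_sub_le_of_norm_hasDerivWithin_le (f := fun u => p a u - u * q a₀ b₀)
      (f' := fun u => q a u - 1 * q a₀ b₀) (C := ε) (fun u hu =>
        (((hp a ha.1 u hu.1).mono inter_subset_left).sub
          ((hasDerivWithinAt_id _ _).mul_const _)))
      (fun u hu => by simpa using hq' a ha u hu) hb₀' hb
    refine le_of_eq_of_le (congrArg _ ?_) this
    ring
  have h2 : ∀ a ∈ A ∩ Metric.ball a₀ δ, ∀ b ∈ B ∩ Metric.ball b₀ δ,
      ‖(g a b - g a₀ b - b * ((a - a₀) * q a₀ b₀)) -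
        (g a b₀ - g a₀ b₀ - b₀ * ((a - a₀) * q a₀ b₀))‖ ≤ ε * ‖b - b₀‖ * ‖a - a₀‖ := by
    intro a ha b hb
    have := hcA.norm_image_sub_le_of_norm_hasDerivWithin_le
      (f := fun u => g u b - g u b₀ - u * ((b - b₀) * q a₀ b₀))
      (f' := fun u => p u b - p u b₀ - 1 * ((b - b₀) * q a₀ b₀)) (C := ε * ‖b - b₀‖) (fun u hu =>
        ((((hg u hu.1 b hb.1).mono inter_subset_left).sub
          ((hg u hu.1 b₀ hb₀).mono inter_subset_left)).sub
          ((hasDerivWithinAt_id _ _).mul_const _)))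
      (fun u hu => by simpa using h1 u hu b hb) ha₀' ha
    refine le_of_eq_of_le (congrArg _ ?_) this
    ring
  have hev : ∀ᶠ a in 𝓝[A] a₀, a ∈ A ∩ Metric.ball a₀ δ :=
    inter_mem self_mem_nhdsWithin (mem_nhdsWithin_of_mem_nhds (Metric.ball_mem_nhds _ hδ))
  filter_upwards [hev] with a ha
  have hd : HasDerivWithinAt (fun b => g a b - g a₀ b - b * ((a - a₀) * q a₀ b₀))
      (r a - r a₀ - 1 * ((a - a₀) * q a₀ b₀)) B b₀ :=
    ((hr a ha.1).sub (hr a₀ ha₀)).sub ((hasDerivWithinAt_id _ _).mul_const _)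
  rw [one_mul] at hd
  -- Division by `b - b₀` and the limit `b → b₀` turn the second difference into the increment of
  -- `r`. The limit carries information because `b₀` is an accumulation point of `B`.
  have ht := (hasDerivWithinAt_iff_tendsto_slope.1 hd).norm
  refine le_of_tendsto ht ?_
  have hev' : ∀ᶠ b in 𝓝[B \ {b₀}] b₀, b ∈ Metric.ball b₀ δ :=
    mem_nhdsWithin_of_mem_nhds (Metric.ball_mem_nhds _ hδ)
  filter_upwards [self_mem_nhdsWithin, hev'] with b hb hb'
  rw [slope_def_field, norm_div, div_le_iff₀ (norm_pos_iff.2 (sub_ne_zero.2 hb.2))]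
  refine (h2 a ha b ⟨hb.1, hb'⟩).trans (le_of_eq ?_)
  ring

/-! ### The measure derivative along segments -/

/-- As `h` has mean zero under `μ`, the derivative in the direction of the Dirac mass at `y` is the
value `h y`. -/
lemma HasMDeriv.unique {ψ : P2 n → ℝ} {μ : P2 n} {h h' : Eu n → ℝ} (H : HasMDeriv ψ μ h)
    (H' : HasMDeriv ψ μ h') : h = h' := by
  ext y
  have := (uniqueDiffOn_Ici (0 : ℝ) 0 self_mem_Ici).eq_deriv _
    (H.2.2 (P2.dirac y)) (H'.2.2 (P2.dirac y))
  simpa [H.2.1, H'.2.1] using this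

lemma HasMDeriv.mderiv_eq {ψ : P2 n → ℝ} {μ : P2 n} {h : Eu n → ℝ} (H : HasMDeriv ψ μ h) :
    mderiv ψ μ = h := by
  have H0 : ∃ h, HasMDeriv ψ μ h := ⟨h, H⟩
  have e : mderiv ψ μ = H0.choose := by
    ext y
    simp only [mderiv, dif_pos H0]
  rw [e]
  exact H0.choose_spec.unique H

lemma hasMDeriv_mderiv {ψ : P2 n → ℝ} {μ : P2 n} (H : ∃ h, HasMDeriv ψ μ h) :
    HasMDeriv ψ μ (mderiv ψ μ) := by
  obtain ⟨h, hh⟩ := H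
  rwa [hh.mderiv_eq]

lemma hasMDeriv_of_segment {ψ : P2 n → ℝ} {μ : P2 n} {h : Eu n → ℝ}
    (hi : ∀ ν : P2 n, Integrable h ν.meas) (h0 : ∫ y, h y ∂μ.meas = 0)
    (H : ∀ ν : P2 n, HasDerivWithinAt (fun s : ℝ => ψ (P2.mix μ ν s))
      ((∫ y, h y ∂ν.meas) - ∫ y, h y ∂μ.meas) (Icc 0 1) 0) : HasMDeriv ψ μ h :=
  ⟨hi, h0, fun ν => (H ν).mono_of_mem_nhdsWithin (Icc_mem_nhdsGE one_pos)⟩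

/-- The definition gives one-sided derivatives at the start of a segment only. At an interior point
the right derivative comes from moving towards `ν` and the left one from moving towards `μ`. They
agree because the mean of `h` under the mixture is the mixture of its means. -/
lemma hasDerivWithinAt_mix {ψ : P2 n → ℝ} {D : P2 n → Eu n → ℝ} (H : ∀ μ, HasMDeriv ψ μ (D μ))
    (μ ν : P2 n) {s : ℝ} (hs : s ∈ Icc (0 : ℝ) 1) :
    HasDerivWithinAt (fun s => ψ (P2.mix μ ν s))
      (∫ y, D (P2.mix μ ν s) y ∂ν.meas - ∫ y, D (P2.mix μ ν s) y ∂μ.meas) (Icc 0 1) s := by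
  set h := D (P2.mix μ ν s)
  have hh : HasMDeriv ψ (P2.mix μ ν s) h := H _
  have e0 : ∫ y, h y ∂(P2.mix μ ν s).meas =
      (1 - s) * ∫ y, h y ∂μ.meas + s * ∫ y, h y ∂ν.meas :=
    P2.integral_mix hs (hh.1 _) (hh.1 _)
  have hR : HasDerivWithinAt (fun s => ψ (P2.mix μ ν s))
      (∫ y, h y ∂ν.meas - ∫ y, h y ∂μ.meas) (Icc s 1) s := by
    rcases eq_or_lt_of_le hs.2 with rfl | h1
    -- At `s = 1` the set `Icc s 1` is a single point, so any value is a derivative there.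
    · simp [hasDerivWithinAt_iff_tendsto_slope]
    have hpos : 0 < 1 - s := by linarith
    have hσ : HasDerivWithinAt (fun u : ℝ => (u - s) / (1 - s)) (1 / (1 - s)) (Icc s 1) s :=
      ((hasDerivWithinAt_id _ _).sub_const _).div_const _
    have hmap : MapsTo (fun u : ℝ => (u - s) / (1 - s)) (Icc s 1) (Ici 0) := fun u hu =>
      div_nonneg (by linarith [hu.1]) hpos.le
    have hc := HasDerivWithinAt.comp_of_eq s (hh.2.2 ν) hσ hmap (by simp)
    have hv : (∫ y, h y ∂ν.meas - ∫ y, h y ∂(P2.mix μ ν s).meas) * (1 / (1 - s)) =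
        ∫ y, h y ∂ν.meas - ∫ y, h y ∂μ.meas := by
      rw [e0]; field_simp; ring
    rw [hv] at hc
    refine hc.congr (fun u hu => ?_) (by simp)
    have hu' : (u - s) / (1 - s) ∈ Icc (0 : ℝ) 1 :=
      ⟨hmap hu, (div_le_one hpos).2 (by linarith [hu.2])⟩
    simp only [Function.comp]
    rw [P2.mix_mix_right hs hu']
    congr 2
    field_simp
    ring
  have hL : HasDerivWithinAt (fun s => ψ (P2.mix μ ν s))
      (∫ y, h y ∂ν.meas - ∫ y, h y ∂μ.meas) (Icc 0 s) s := by
    rcases eq_or_lt_of_le hs.1 with h1 | h1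
    · rw [← h1]
      simp [hasDerivWithinAt_iff_tendsto_slope]
    have hσ : HasDerivWithinAt (fun u : ℝ => (s - u) / s) (-1 / s) (Icc 0 s) s :=
      ((hasDerivWithinAt_id _ _).const_sub _).div_const _
    have hmap : MapsTo (fun u : ℝ => (s - u) / s) (Icc 0 s) (Ici 0) := fun u hu =>
      div_nonneg (by linarith [hu.2]) h1.le
    have hc := HasDerivWithinAt.comp_of_eq s (hh.2.2 μ) hσ hmap (by simp)
    have hv : (∫ y, h y ∂μ.meas - ∫ y, h y ∂(P2.mix μ ν s).meas) * (-1 / s) =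
        ∫ y, h y ∂ν.meas - ∫ y, h y ∂μ.meas := by
      rw [e0]; field_simp; ring
    rw [hv] at hc
    refine hc.congr (fun u hu => ?_) (by simp)
    have hu' : (s - u) / s ∈ Icc (0 : ℝ) 1 :=
      ⟨hmap hu, (div_le_one h1).2 (by linarith [hu.1])⟩
    simp only [Function.comp]
    rw [P2.mix_mix_left hs hu']
    congr 2
    field_simp
    ring
  have := hL.union hR
  rwa [Icc_union_Icc_eq_Icc hs.1 hs.2] at this

lemma HasMDeriv.const (c : ℝ) (μ : P2 n) : HasMDeriv (fun _ => c) μ (fun _ => 0) :=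
  ⟨fun _ => integrable_zero _ _ _, by simp, fun ν => by simpa using hasDerivWithinAt_const _ _ _⟩

lemma HasMDeriv.add {ψ χ : P2 n → ℝ} {μ : P2 n} {h k : Eu n → ℝ} (H : HasMDeriv ψ μ h)
    (K : HasMDeriv χ μ k) : HasMDeriv (fun μ => ψ μ + χ μ) μ (fun y => h y + k y) := by
  refine ⟨fun ν => (H.1 ν).add (K.1 ν), ?_, fun ν => ?_⟩
  · rw [integral_add (H.1 μ) (K.1 μ), H.2.1, K.2.1, add_zero]
  · rw [integral_add (H.1 ν) (K.1 ν), integral_add (H.1 μ) (K.1 μ)]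
    exact ((H.2.2 ν).add (K.2.2 ν)).congr_deriv (by ring)

lemma HasMDeriv.const_mul {ψ : P2 n → ℝ} {μ : P2 n} {h : Eu n → ℝ} (H : HasMDeriv ψ μ h)
    (c : ℝ) : HasMDeriv (fun μ => c * ψ μ) μ (fun y => c * h y) := by
  refine ⟨fun ν => (H.1 ν).const_mul c, ?_, fun ν => ?_⟩
  · rw [integral_const_mul, H.2.1, mul_zero]
  · rw [integral_const_mul, integral_const_mul]
    exact ((H.2.2 ν).const_mul c).congr_deriv (by ring)

lemma HasMDeriv.sub {ψ χ : P2 n → ℝ} {μ : P2 n} {h k : Eu n → ℝ} (H : HasMDeriv ψ μ h)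
    (K : HasMDeriv χ μ k) : HasMDeriv (fun μ => ψ μ - χ μ) μ (fun y => h y - k y) := by
  have := H.add (K.const_mul (-1))
  simpa [sub_eq_add_neg] using this

lemma HasMDeriv.sum {ι : Type*} (s : Finset ι) {ψ : ι → P2 n → ℝ} {μ : P2 n}
    {h : ι → Eu n → ℝ} (H : ∀ i ∈ s, HasMDeriv (ψ i) μ (h i)) :
    HasMDeriv (fun μ => ∑ i ∈ s, ψ i μ) μ (fun y => ∑ i ∈ s, h i y) := by
  classical
  induction s using Finset.induction_on with
  | empty => simpa using HasMDeriv.const 0 μ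
  | insert a s ha ih =>
    simp only [Finset.sum_insert ha]
    exact (H a (by simp)).add (ih fun i hi => H i (by simp [hi]))

lemma HasMDeriv.mul {ψ χ : P2 n → ℝ} {μ : P2 n} {h k : Eu n → ℝ} (H : HasMDeriv ψ μ h)
    (K : HasMDeriv χ μ k) :
    HasMDeriv (fun μ => ψ μ * χ μ) μ (fun y => h y * χ μ + ψ μ * k y) := by
  have i1 : ∀ ν : P2 n, Integrable (fun y => h y * χ μ) ν.meas := fun ν => (H.1 ν).mul_const _
  have i2 : ∀ ν : P2 n, Integrable (fun y => ψ μ * k y) ν.meas := fun ν => (K.1 ν).const_mul _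
  refine ⟨fun ν => (i1 ν).add (i2 ν), ?_, fun ν => ?_⟩
  · rw [integral_add (i1 μ) (i2 μ), integral_mul_const, integral_const_mul, H.2.1, K.2.1]
    simp
  · rw [integral_add (i1 ν) (i2 ν), integral_add (i1 μ) (i2 μ), integral_mul_const,
      integral_const_mul, integral_mul_const, integral_const_mul]
    refine ((H.2.2 ν).mul (K.2.2 ν)).congr_deriv ?_
    simp only [P2.mix_zero]
    ring

lemma continuousOn_integral {X : Type*} [TopologicalSpace X] {S : Set X} {ν : P2 n}
    {G : X → Eu n → ℝ} (hG : ContinuousOn (fun p : X × Eu n => G p.1 p.2) (S ×ˢ univ)) {K : ℝ}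
    (hb : ∀ x ∈ S, ∀ y, |G x y| ≤ K * (1 + ‖y‖ ^ 2)) :
    ContinuousOn (fun x => ∫ y, G x y ∂ν.meas) S := by
  rw [continuousOn_iff_continuous_domRestrict] at hG ⊢
  refine P2.continuous_integral (X := S) (m := fun _ => ν) continuous_const
    (G := fun x y => G x y) ?_ (K := fun _ => K) continuous_const (fun x y => hb x x.2 y)
  exact hG.comp (f := fun p : S × Eu n => (⟨(p.1, p.2), p.1.2, mem_univ _⟩ : ↥(S ×ˢ univ)))
    (by fun_prop)

/-- The measure derivative commutes with the derivative with respect to a real parameter. -/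
lemma hasMDeriv_deriv {B : Set ℝ} (hB : Convex ℝ B) {F R : ℝ → P2 n → ℝ}
    {F' Q : ℝ → P2 n → Eu n → ℝ} (hF : ∀ b ∈ B, ∀ μ, HasMDeriv (F b) μ (F' b μ))
    {b₀ : ℝ} (hb₀ : b₀ ∈ B) [hne : (𝓝[B \ {b₀}] b₀).NeBot]
    (hR : ∀ μ, HasDerivWithinAt (fun b => F b μ) (R b₀ μ) B b₀)
    (hQ : ∀ b ∈ B, ∀ μ y, HasDerivWithinAt (fun b => F' b μ y) (Q b μ y) B b)
    (hc : ContinuousOn (fun p : ℝ × P2 n × Eu n => Q p.1 p.2.1 p.2.2) (B ×ˢ univ))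
    {K : P2 n → ℝ} (hK : Continuous K)
    (hb : ∀ b ∈ B, ∀ μ y, |Q b μ y| ≤ K μ * (1 + ‖y‖ ^ 2)) (μ : P2 n) :
    HasMDeriv (R b₀) μ (Q b₀ μ) := by
  have hQc : ∀ b ∈ B, ∀ μ, Continuous (Q b μ) := fun b hbB μ => by
    refine continuousOn_univ.1 (hc.comp (f := fun y => (b, μ, y)) (by fun_prop) ?_)
    intro y _
    exact ⟨hbB, mem_univ _⟩
  have hint : ∀ (m : P2 n), ∀ b ∈ B, HasDerivWithinAt (fun b => ∫ y, F' b μ y ∂m.meas)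
      (∫ y, Q b μ y ∂m.meas) B b := fun m b hbB =>
    hasDerivWithinAt_integral hB hbB (fun b hb => (hF b hb μ).1 m)
      (fun b hb y => hQ b hb μ y) (m.integrable_one_add_sq.const_mul (K μ))
      (fun b hb' y => hb b hb' μ y)
  refine hasMDeriv_of_segment (fun ν => P2.integrable_of_abs_le (hQc b₀ hb₀ μ)
    (fun y => hb b₀ hb₀ μ y) ν) ?_ fun ν => ?_
  -- The mean of `F' b μ` under `μ` vanishes for all `b`, hence so does its derivative, which is the
  -- mean of `Q b₀ μ`.
  · have h1 := hint μ b₀ hb₀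
    have h2 : HasDerivWithinAt (fun b => ∫ y, F' b μ y ∂μ.meas) 0 B b₀ :=
      (hasDerivWithinAt_const b₀ B (0 : ℝ)).congr (fun b hbB => (hF b hbB μ).2.1)
        (hF b₀ hb₀ μ).2.1
    have h3 := hasDerivWithinAt_iff_tendsto_slope.1 h1
    have h4 := hasDerivWithinAt_iff_tendsto_slope.1 h2
    exact tendsto_nhds_unique h3 h4
  -- A bound of `K` along the compact segment gives one majorant for all parameters, as the
  -- continuity of the integrals of `Q` requires.
  · obtain ⟨C, hC⟩ : ∃ C, ∀ s ∈ Icc (0 : ℝ) 1, K (P2.mix μ ν s) ≤ C := by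
      have hcK : Continuous fun s => K (P2.mix μ ν s) :=
        hK.comp ((P2.continuous_mix ν).comp (f := fun s => (μ, s)) (by fun_prop))
      obtain ⟨C, hC⟩ := isCompact_Icc.bddAbove_image hcK.continuousOn
      exact ⟨C, fun s hs => hC (mem_image_of_mem _ hs)⟩
    have hcm : Continuous fun s => P2.mix μ ν s :=
      (P2.continuous_mix ν).comp (f := fun s => (μ, s)) (by fun_prop)
    have hpd : ∀ (m : P2 n), ∀ s ∈ Icc (0 : ℝ) 1, ∀ b ∈ B, HasDerivWithinAt
        (fun b => ∫ y, F' b (P2.mix μ ν s) y ∂m.meas)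
        (∫ y, Q b (P2.mix μ ν s) y ∂m.meas) B b := fun m s hs b hbB =>
      hasDerivWithinAt_integral hB hbB (fun b hb => (hF b hb _).1 m)
        (fun b hb y => hQ b hb _ y) (m.integrable_one_add_sq.const_mul (K (P2.mix μ ν s)))
        (fun b hb' y => hb b hb' _ y)
    have hcont : ∀ (m : P2 n), ContinuousOn
        (fun c : ℝ × ℝ => ∫ y, Q c.2 (P2.mix μ ν c.1) y ∂m.meas) (Icc 0 1 ×ˢ B) := fun m => by
      refine continuousOn_integral (K := C) ?_ ?_
      · refine hc.comp (f := fun p : (ℝ × ℝ) × Eu n => (p.1.2, P2.mix μ ν p.1.1, p.2))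
          (by fun_prop) ?_
        rintro ⟨c, y⟩ ⟨h, -⟩
        exact ⟨h.2, mem_univ _⟩
      · rintro ⟨s, b⟩ ⟨hs, hbB⟩ y
        exact (hb b hbB _ y).trans (mul_le_mul_of_nonneg_right (hC s hs) (by positivity))
    -- Along the segment from `μ` to `ν` the claim becomes the interchange of `∂_s` and `∂_b` for `F
    -- b (P2.mix μ ν s)`.
    have := hasDerivWithinAt_swap (A := Icc (0 : ℝ) 1) (B := B) (convex_Icc _ _) hB
      (g := fun s b => F b (P2.mix μ ν s))
      (p := fun s b => ∫ y, F' b (P2.mix μ ν s) y ∂ν.meas - ∫ y, F' b (P2.mix μ ν s) y ∂μ.meas)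
      (q := fun s b => ∫ y, Q b (P2.mix μ ν s) y ∂ν.meas - ∫ y, Q b (P2.mix μ ν s) y ∂μ.meas)
      (r := fun s => R b₀ (P2.mix μ ν s)) (a₀ := 0) (b₀ := b₀) (by simp) hb₀
      (fun s hs b hbB => hasDerivWithinAt_mix (hF b hbB) μ ν hs)
      (fun s hs b hbB => (hpd ν s hs b hbB).sub (hpd μ s hs b hbB))
      (((hcont ν).sub (hcont μ)) (0, b₀) ⟨by simp, hb₀⟩) (fun s _ => hR _)
    simpa using this

end SocialMFC

namespace SocialMFC
variable {n : ℕ}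

/-! ### A calculus of functions of a parameter and a measure -/

section Calculus

variable {X Y : Type*} [NormedAddCommGroup X] [NormedSpace ℝ X] [NormedAddCommGroup Y]
  [NormedSpace ℝ Y]

/-- `F` is jointly continuous and grows at most like the `k`-th power of the norm of the
parameter, with a constant that depends continuously on the measure. -/
def Gr (k : ℕ) (F : X → P2 n → ℝ) : Prop :=
  Continuous (fun a : X × P2 n => F a.1 a.2) ∧
    ∃ K : P2 n → ℝ, Continuous K ∧ ∀ x μ, |F x μ| ≤ K μ * (1 + ‖x‖) ^ k

/-- `G` is the derivative of `F` in the direction `v` of the parameter. -/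
def HasPD (v : X) (F G : X → P2 n → ℝ) : Prop :=
  ∀ x μ, HasLineDerivAt ℝ (fun x => F x μ) (G x μ) x v

/-- `F'` is the derivative of `F` with respect to the measure. -/
def MD (F : X → P2 n → ℝ) (F' : X × Eu n → P2 n → ℝ) : Prop :=
  ∀ x μ, HasMDeriv (F x) μ (fun z => F' (x, z) μ)

/-- A continuous linear map, unbundled. -/
structure Lin (A : X → Y) : Prop where
  map : ∀ x v (t : ℝ), A (x + t • v) = A x + t • A v
  cont : Continuous A

lemma Lin.exists_bound {A : X → Y} (hA : Lin A) : ∃ c : ℝ, 0 ≤ c ∧ ∀ x, ‖A x‖ ≤ c * (1 + ‖x‖) := by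
  have h0 : A 0 = 0 := by simpa using hA.map 0 0 1
  let L : X →L[ℝ] Y :=
    { toFun := A
      map_add' := fun x v => by simpa using hA.map x v 1
      map_smul' := fun t v => by simpa [h0] using hA.map 0 v t
      cont := hA.cont }
  exact ⟨‖L‖, norm_nonneg _, fun x => (L.le_opNorm x).trans
    (mul_le_mul_of_nonneg_left (by linarith) (norm_nonneg _))⟩

lemma Gr.nonneg_of_bound {k : ℕ} {F : X → P2 n → ℝ} {K : P2 n → ℝ}
    (h : ∀ x μ, |F x μ| ≤ K μ * (1 + ‖x‖) ^ k) (μ : P2 n) : 0 ≤ K μ := by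
  have := (abs_nonneg _).trans (h 0 μ)
  simpa using this

lemma Gr.mono {j k : ℕ} {F : X → P2 n → ℝ} (h : Gr j F) (hjk : j ≤ k) : Gr k F := by
  obtain ⟨hc, K, hK, hb⟩ := h
  exact ⟨hc, K, hK, fun x μ => (hb x μ).trans (mul_le_mul_of_nonneg_left
    (pow_le_pow_right₀ (by linarith [norm_nonneg x]) hjk) (Gr.nonneg_of_bound hb μ))⟩

lemma Gr.const (c : ℝ) : Gr 0 (fun (_ : X) (_ : P2 n) => c) :=
  ⟨continuous_const, fun _ => |c|, continuous_const, fun x μ => by simp⟩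

lemma Gr.add {k : ℕ} {F G : X → P2 n → ℝ} (hF : Gr k F) (hG : Gr k G) :
    Gr k (fun x μ => F x μ + G x μ) := by
  obtain ⟨hc, K, hK, hb⟩ := hF
  obtain ⟨hc', K', hK', hb'⟩ := hG
  refine ⟨hc.add hc', fun μ => K μ + K' μ, hK.add hK', fun x μ => ?_⟩
  rw [add_mul]
  exact (abs_add_le _ _).trans (add_le_add (hb x μ) (hb' x μ))

lemma Gr.mul {j k : ℕ} {F G : X → P2 n → ℝ} (hF : Gr j F) (hG : Gr k G) :
    Gr (j + k) (fun x μ => F x μ * G x μ) := by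
  obtain ⟨hc, K, hK, hb⟩ := hF
  obtain ⟨hc', K', hK', hb'⟩ := hG
  refine ⟨hc.mul hc', fun μ => K μ * K' μ, hK.mul hK', fun x μ => ?_⟩
  rw [abs_mul, pow_add, mul_mul_mul_comm]
  exact mul_le_mul (hb x μ) (hb' x μ) (abs_nonneg _) ((abs_nonneg _).trans (hb x μ))

lemma Gr.const_mul {k : ℕ} {F : X → P2 n → ℝ} (hF : Gr k F) (c : ℝ) :
    Gr k (fun x μ => c * F x μ) := by
  simpa using (Gr.const (X := X) (n := n) c).mul hF

lemma Gr.neg {k : ℕ} {F : X → P2 n → ℝ} (hF : Gr k F) : Gr k (fun x μ => -F x μ) := by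
  simpa using hF.const_mul (-1)

lemma Gr.sub {k : ℕ} {F G : X → P2 n → ℝ} (hF : Gr k F) (hG : Gr k G) :
    Gr k (fun x μ => F x μ - G x μ) := by
  simpa [sub_eq_add_neg] using hF.add hG.neg

lemma Gr.sum {ι : Type*} {k : ℕ} (s : Finset ι) {F : ι → X → P2 n → ℝ} (hF : ∀ i, Gr k (F i)) :
    Gr k (fun x μ => ∑ i ∈ s, F i x μ) := by
  classical
  induction s using Finset.induction_on with
  | empty => simpa using (Gr.const (X := X) (n := n) 0).mono (Nat.zero_le k)
  | insert a s ha ih =>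
    simp only [Finset.sum_insert ha]
    exact (hF a).add ih

lemma Gr.comp_of_bound {k : ℕ} {F : Y → P2 n → ℝ} (hF : Gr k F) {A : X → Y} (hA : Continuous A)
    {c : ℝ} (hc : ∀ x, ‖A x‖ ≤ c * (1 + ‖x‖)) : Gr k (fun x μ => F (A x) μ) := by
  obtain ⟨hcF, K, hK, hb⟩ := hF
  have hK0 : ∀ μ, 0 ≤ K μ := fun μ => by
    have := (abs_nonneg _).trans (hb 0 μ)
    simpa using this
  refine ⟨hcF.comp (f := fun a : X × P2 n => (A a.1, a.2)) (by fun_prop),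
    fun μ => K μ * (1 + c) ^ k, hK.mul continuous_const, fun x μ => ?_⟩
  refine (hb _ μ).trans ?_
  rw [mul_assoc, ← mul_pow]
  refine mul_le_mul_of_nonneg_left (pow_le_pow_left₀ (by positivity) ?_ k) (hK0 μ)
  linarith [hc x, norm_nonneg x]

lemma Gr.comp {k : ℕ} {F : Y → P2 n → ℝ} (hF : Gr k F) {A : X → Y} (hA : Lin A) :
    Gr k (fun x μ => F (A x) μ) := by
  obtain ⟨c, -, hc⟩ := hA.exists_bound
  exact hF.comp_of_bound hA.cont hc

lemma one_add_norm_prod_le (x : X) (y : Y) : 1 + ‖(x, y)‖ ≤ (1 + ‖x‖) * (1 + ‖y‖) := by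
  have : ‖(x, y)‖ ≤ ‖x‖ + ‖y‖ := by
    rw [Prod.norm_def]
    exact max_le (by linarith [norm_nonneg y]) (by linarith [norm_nonneg x])
  nlinarith [mul_nonneg (norm_nonneg x) (norm_nonneg y)]

lemma one_add_norm_pow_le {k : ℕ} (hk : k ≤ 2) (y : Y) : (1 + ‖y‖) ^ k ≤ 2 * (1 + ‖y‖ ^ 2) := by
  refine (pow_le_pow_right₀ (by linarith [norm_nonneg y]) hk).trans ?_
  nlinarith [sq_nonneg (‖y‖ - 1)]

/-- The bound splits into a factor depending on `x` and `μ` and the function `1 + ‖y‖²`, which every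
element of `P2` integrates. This is where degree at most two is essential. -/
lemma Gr.abs_prod_le {k : ℕ} (hk : k ≤ 2) {F : X × Y → P2 n → ℝ} {K : P2 n → ℝ}
    (hb : ∀ x μ, |F x μ| ≤ K μ * (1 + ‖x‖) ^ k) (x : X) (y : Y) (μ : P2 n) :
    |F (x, y) μ| ≤ K μ * (1 + ‖x‖) ^ k * 2 * (1 + ‖y‖ ^ 2) := by
  have hK := Gr.nonneg_of_bound hb μ
  calc |F (x, y) μ| ≤ K μ * (1 + ‖(x, y)‖) ^ k := hb _ μ
    _ ≤ K μ * ((1 + ‖x‖) * (1 + ‖y‖)) ^ k := by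
        gcongr
        exact one_add_norm_prod_le x y
    _ = K μ * (1 + ‖x‖) ^ k * (1 + ‖y‖) ^ k := by rw [mul_pow]; ring
    _ ≤ K μ * (1 + ‖x‖) ^ k * (2 * (1 + ‖y‖ ^ 2)) := by
        gcongr
        exact one_add_norm_pow_le hk y
    _ = _ := by ring

lemma Gr.slice_continuous {k : ℕ} {F : X × Y → P2 n → ℝ} (hF : Gr k F) (x : X) (μ : P2 n) :
    Continuous (fun y => F (x, y) μ) :=
  hF.1.comp (f := fun y => ((x, y), μ)) (by fun_prop)

lemma Gr.integrable {k : ℕ} {F : X × Eu n → P2 n → ℝ} (hF : Gr k F) (hk : k ≤ 2) (x : X)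
    (μ ν : P2 n) : Integrable (fun y => F (x, y) μ) ν.meas := by
  obtain ⟨K, -, hb⟩ := hF.2
  exact P2.integrable_of_abs_le (hF.slice_continuous x μ) (fun y => Gr.abs_prod_le hk hb x y μ) ν

lemma Gr.integrable_prod {k : ℕ} {F : (X × Eu n) × Eu n → P2 n → ℝ} (hF : Gr k F) (hk : k ≤ 2)
    (x : X) (μ ν ν' : P2 n) :
    Integrable (fun p : Eu n × Eu n => F ((x, p.1), p.2) μ) (ν.meas.prod ν'.meas) := by
  obtain ⟨K, -, hb⟩ := hF.2
  have hK := Gr.nonneg_of_bound hb μ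
  have hc : Continuous (fun p : Eu n × Eu n => F ((x, p.1), p.2) μ) :=
    hF.1.comp (f := fun p : Eu n × Eu n => (((x, p.1), p.2), μ)) (by fun_prop)
  have hi := (ν.integrable_one_add_sq.mul_prod ν'.integrable_one_add_sq).const_mul
    (K μ * (1 + ‖x‖) ^ k * 2 * 2)
  refine hi.mono' hc.aestronglyMeasurable (ae_of_all _ fun p => ?_)
  calc |F ((x, p.1), p.2) μ| ≤ K μ * (1 + ‖(x, p.1)‖) ^ k * 2 * (1 + ‖p.2‖ ^ 2) :=
        Gr.abs_prod_le hk hb (x, p.1) p.2 μ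
    _ ≤ K μ * ((1 + ‖x‖) ^ k * (2 * (1 + ‖p.1‖ ^ 2))) * 2 * (1 + ‖p.2‖ ^ 2) := by
        gcongr
        calc (1 + ‖(x, p.1)‖) ^ k ≤ ((1 + ‖x‖) * (1 + ‖p.1‖)) ^ k := by
              gcongr
              exact one_add_norm_prod_le x p.1
          _ ≤ _ := by
              rw [mul_pow]
              gcongr
              exact one_add_norm_pow_le hk p.1
    _ = _ := by ring

/-- The integrating measure is a general continuous function of `μ`, since both `μ` itself and a
fixed measure are needed below. -/
lemma Gr.integral_comp {k : ℕ} {F : X × Eu n → P2 n → ℝ} (hF : Gr k F) (hk : k ≤ 2)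
    {m : P2 n → P2 n} (hm : Continuous m) :
    Gr k (fun x μ => ∫ y, F (x, y) μ ∂(m μ).meas) := by
  obtain ⟨hc, K, hK, hb⟩ := hF
  refine ⟨?_, fun μ => K μ * 2 * (1 + (m μ).m2),
    (hK.mul continuous_const).mul (continuous_const.add (P2.continuous_m2.comp hm)), fun x μ => ?_⟩
  · refine P2.continuous_integral (X := X × P2 n) (m := fun a => m a.2) (by fun_prop)
      (G := fun a y => F (a.1, y) a.2) ?_ (K := fun a => K a.2 * (1 + ‖a.1‖) ^ k * 2)
      (by fun_prop) (fun a y => Gr.abs_prod_le hk hb a.1 y a.2)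
    exact hc.comp (f := fun p : (X × P2 n) × Eu n => ((p.1.1, p.2), p.1.2)) (by fun_prop)
  · have hi := (m μ).integrable_one_add_sq.const_mul (K μ * (1 + ‖x‖) ^ k * 2)
    have h1 := norm_integral_le_of_norm_le hi (f := fun y => F (x, y) μ)
      (ae_of_all _ fun y => Gr.abs_prod_le hk hb x y μ)
    refine h1.trans (le_of_eq ?_)
    rw [integral_const_mul, integral_add (integrable_const _) (m μ).moment]
    simp only [P2.m2, integral_const, probReal_univ, smul_eq_mul]
    ring

lemma Gr.integral {k : ℕ} {F : X × Eu n → P2 n → ℝ} (hF : Gr k F) (hk : k ≤ 2) :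
    Gr k (fun x μ => ∫ y, F (x, y) μ ∂μ.meas) :=
  hF.integral_comp hk continuous_id

/-- The supremum of `K` over the compact segment depends continuously on its starting point, so it
again serves as a growth constant. -/
lemma Gr.comp_mix {k : ℕ} {F : X → P2 n → ℝ} (hF : Gr k F) (ν : P2 n) :
    Gr k (fun (a : ℝ × X) μ => F a.2 (P2.mix μ ν a.1)) := by
  obtain ⟨hc, K, hK, hb⟩ := hF
  have hK0 := Gr.nonneg_of_bound hb
  have hm := P2.continuous_mix ν
  have hKc : Continuous (fun p : P2 n × ℝ => K (P2.mix p.1 ν p.2)) := hK.comp hm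
  refine ⟨hc.comp (f := fun a : (ℝ × X) × P2 n => (a.1.2, P2.mix a.2 ν a.1.1))
      (Continuous.prodMk (by fun_prop)
        (hm.comp (f := fun a : (ℝ × X) × P2 n => (a.2, a.1.1)) (by fun_prop))),
    fun μ => sSup ((fun s => K (P2.mix μ ν s)) '' Icc 0 1),
    isCompact_Icc.continuous_sSup hKc, fun a μ => ?_⟩
  have h1 : K (P2.mix μ ν a.1) ≤ sSup ((fun s => K (P2.mix μ ν s)) '' Icc 0 1) := by
    rw [← P2.mix_clamp]
    refine le_csSup (isCompact_Icc.bddAbove_image ?_) (mem_image_of_mem _ (P2.clamp_mem _))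
    exact (hKc.comp (f := fun s => (μ, s)) (by fun_prop)).continuousOn
  refine (hb a.2 _).trans ?_
  have h2 : ‖a.2‖ ≤ ‖a‖ := norm_snd_le a
  have h3 := hK0 (P2.mix μ ν a.1)
  have h4 := h3.trans h1
  exact mul_le_mul h1 (pow_le_pow_left₀ (by positivity) (by linarith) k) (by positivity) h4

/-! Directional derivatives. -/

lemma HasPD.hasDerivAt {v : X} {F G : X → P2 n → ℝ} (h : HasPD v F G) (x : X) (μ : P2 n) (s : ℝ) :
    HasDerivAt (fun t : ℝ => F (x + t • v) μ) (G (x + s • v) μ) s := by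
  have h1 : HasDerivAt (fun t : ℝ => F (x + s • v + t • v) μ) (G (x + s • v) μ) (s - s) := by
    rw [sub_self]; exact h _ μ
  have h2 := h1.comp_sub_const s s
  refine h2.congr_of_eventuallyEq (Eventually.of_forall fun t => ?_)
  simp only
  congr 1
  module

lemma HasPD.add {v : X} {F F' G G' : X → P2 n → ℝ} (h : HasPD v F F') (h' : HasPD v G G') :
    HasPD v (fun x μ => F x μ + G x μ) (fun x μ => F' x μ + G' x μ) :=
  fun x μ => HasDerivAt.add (h x μ) (h' x μ)

lemma HasPD.sub {v : X} {F F' G G' : X → P2 n → ℝ} (h : HasPD v F F') (h' : HasPD v G G') :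
    HasPD v (fun x μ => F x μ - G x μ) (fun x μ => F' x μ - G' x μ) :=
  fun x μ => HasDerivAt.sub (h x μ) (h' x μ)

lemma HasPD.comp {F G : Y → P2 n → ℝ} {A : X → Y} (hA : Lin A) {v : X} (h : HasPD (A v) F G) :
    HasPD v (fun x μ => F (A x) μ) (fun x μ => G (A x) μ) := by
  intro x μ
  have := h (A x) μ
  simp only [HasLineDerivAt] at this ⊢
  simpa only [hA.map] using this

lemma HasPD.zero_dir (F : X → P2 n → ℝ) : HasPD 0 F (fun _ _ => 0) := by
  intro x μ
  simp only [HasLineDerivAt, smul_zero, add_zero]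
  exact hasDerivAt_const _ _

lemma HasPD.of_const {v : X} {F : Y → P2 n → ℝ} {A : X → Y} (hA : Lin A) (hv : A v = 0) :
    HasPD v (fun x μ => F (A x) μ) (fun _ _ => 0) :=
  HasPD.comp (G := fun _ _ => 0) hA (by rw [hv]; exact HasPD.zero_dir F)

lemma HasPD.integral {v : X} {F G : X × Eu n → P2 n → ℝ} (h : HasPD (v, 0) F G) (hF : Gr 2 F)
    (hG : Gr 2 G) :
    HasPD v (fun x μ => ∫ y, F (x, y) μ ∂μ.meas) (fun x μ => ∫ y, G (x, y) μ ∂μ.meas) := by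
  intro x μ
  obtain ⟨K, -, hb⟩ := hG.2
  have hK := Gr.nonneg_of_bound hb μ
  have e : ∀ (s : ℝ) (y : Eu n), (x, y) + s • (v, (0 : Eu n)) = (x + s • v, y) := fun s y => by
    simp
  -- For `s ∈ [-1, 1]` the points `x + s • v` have norm at most `‖x‖ + ‖v‖`, so one integrable
  -- majorant serves all of them.
  have key := hasDerivWithinAt_integral (m := μ.meas) (convex_Icc (-1 : ℝ) 1)
    (F := fun s y => F (x + s • v, y) μ) (F' := fun s y => G (x + s • v, y) μ) (s₀ := 0) (by simp)
    (fun s _ => hF.integrable le_rfl _ μ μ) (fun s _ y => by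
      have := h.hasDerivAt (x, y) μ s
      simp only [e] at this
      exact this.hasDerivWithinAt)
    (bound := fun y => K μ * (1 + (‖x‖ + ‖v‖)) ^ 2 * 2 * (1 + ‖y‖ ^ 2))
    (μ.integrable_one_add_sq.const_mul _) (fun s hs y => by
      refine (Gr.abs_prod_le le_rfl hb (x + s • v) y μ).trans ?_
      have h1 : ‖x + s • v‖ ≤ ‖x‖ + ‖v‖ := by
        refine (norm_add_le _ _).trans (add_le_add le_rfl ?_)
        rw [norm_smul]
        exact mul_le_of_le_one_left (norm_nonneg _) (abs_le.2 hs)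
      gcongr)
  have := key.hasDerivAt (Icc_mem_nhds (by norm_num) (by norm_num))
  simpa [HasLineDerivAt] using this

/-- Additivity of the directional derivative in the direction. -/
lemma HasPD.add_dir {u v : X} {F Fu Fv : X → P2 n → ℝ} (hu : HasPD u F Fu) (hv : HasPD v F Fv)
    (hc : Continuous (fun a : X × P2 n => Fv a.1 a.2)) :
    HasPD (u + v) F (fun x μ => Fu x μ + Fv x μ) := by
  intro x μ
  -- Only directional derivatives are available, so additivity is not automatic: the increment from
  -- `x + t • u` to `x + t • (u + v)` is controlled by the mean value inequality and the continuity
  -- of `Fv`.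
  have h1 : HasDerivAt (fun t : ℝ => F (x + t • (u + v)) μ - F (x + t • u) μ) (Fv x μ) 0 := by
    rw [hasDerivAt_iff_isLittleO, Asymptotics.isLittleO_iff]
    intro ε hε
    have hcx : Continuous (fun p : ℝ × ℝ => Fv (x + p.1 • u + p.2 • v) μ) :=
      hc.comp (f := fun p : ℝ × ℝ => (x + p.1 • u + p.2 • v, μ)) (by fun_prop)
    have hcx0 := Metric.continuous_iff.1 hcx (0, 0) ε hε
    obtain ⟨δ, hδ, hδ'⟩ := hcx0
    filter_upwards [Metric.ball_mem_nhds (0 : ℝ) hδ] with t ht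
    have hb : ∀ s ∈ Metric.ball (0 : ℝ) δ, ‖Fv (x + t • u + s • v) μ - 1 * Fv x μ‖ ≤ ε := by
      intro s hs
      have := hδ' (t, s) (by rw [Prod.dist_eq]; exact max_lt ht hs)
      rw [one_mul]
      simpa [Real.dist_eq] using this.le
    have := (convex_ball (0 : ℝ) δ).norm_image_sub_le_of_norm_hasDerivWithin_le
      (f := fun s => F (x + t • u + s • v) μ - s * Fv x μ)
      (f' := fun s => Fv (x + t • u + s • v) μ - 1 * Fv x μ) (C := ε)
      (fun s _ => ((hv.hasDerivAt (x + t • u) μ s).sub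
        ((hasDerivAt_id s).mul_const _)).hasDerivWithinAt) hb (Metric.mem_ball_self hδ) ht
    simp only [zero_smul, add_zero, zero_mul, sub_zero, smul_add, sub_self, smul_eq_mul] at this ⊢
    refine le_of_eq_of_le (congrArg _ ?_) this
    rw [add_assoc]
    ring
  have h2 : HasDerivAt (fun t : ℝ => F (x + t • u) μ) (Fu x μ) 0 := hu x μ
  have h3 := h2.add h1
  refine h3.congr_of_eventuallyEq (Eventually.of_forall fun t => ?_)
  simp

/-- The symmetry of mixed directional derivatives. -/
lemma HasPD.swap {u v : X} {F Fu Fv Fuv : X → P2 n → ℝ} (hu : HasPD u F Fu) (huv : HasPD v Fu Fuv)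
    (hv : HasPD v F Fv) (hc : Continuous (fun a : X × P2 n => Fuv a.1 a.2)) :
    HasPD u Fv Fuv := by
  intro x μ
  have hcx : Continuous (fun p : ℝ × ℝ => Fuv (x + p.1 • u + p.2 • v) μ) :=
    hc.comp (f := fun p : ℝ × ℝ => (x + p.1 • u + p.2 • v, μ)) (by fun_prop)
  have : (𝓝[univ \ {(0 : ℝ)}] 0).NeBot := by
    rw [← compl_eq_univ_sdiff]; infer_instance
  have := hasDerivWithinAt_swap (A := univ) (B := univ) convex_univ convex_univ
    (g := fun a b => F (x + a • u + b • v) μ) (p := fun a b => Fu (x + a • u + b • v) μ)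
    (q := fun a b => Fuv (x + a • u + b • v) μ) (r := fun a => Fv (x + a • u) μ)
    (a₀ := 0) (b₀ := 0) trivial trivial
    (fun a _ b _ => by
      have := hu.hasDerivAt (x + b • v) μ a
      simp only [add_right_comm x (b • v)] at this
      exact this.hasDerivWithinAt)
    (fun a _ b _ => (huv.hasDerivAt (x + a • u) μ b).hasDerivWithinAt)
    hcx.continuousWithinAt
    (fun a _ => by
      have := hv.hasDerivAt (x + a • u) μ 0
      simp only [zero_smul, add_zero] at this
      exact this.hasDerivWithinAt)
  rw [hasDerivWithinAt_univ] at this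
  simpa [HasLineDerivAt] using this

/-! Measure derivatives. -/

lemma MD.add {F G : X → P2 n → ℝ} {F' G' : X × Eu n → P2 n → ℝ} (h : MD F F') (h' : MD G G') :
    MD (fun x μ => F x μ + G x μ) (fun a μ => F' a μ + G' a μ) :=
  fun x μ => (h x μ).add (h' x μ)

lemma MD.sub {F G : X → P2 n → ℝ} {F' G' : X × Eu n → P2 n → ℝ} (h : MD F F') (h' : MD G G') :
    MD (fun x μ => F x μ - G x μ) (fun a μ => F' a μ - G' a μ) :=
  fun x μ => (h x μ).sub (h' x μ)

lemma MD.const_mul {F : X → P2 n → ℝ} {F' : X × Eu n → P2 n → ℝ} (h : MD F F') (c : ℝ) :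
    MD (fun x μ => c * F x μ) (fun a μ => c * F' a μ) :=
  fun x μ => (h x μ).const_mul c

lemma MD.mul {F G : X → P2 n → ℝ} {F' G' : X × Eu n → P2 n → ℝ} (h : MD F F') (h' : MD G G') :
    MD (fun x μ => F x μ * G x μ) (fun a μ => F' a μ * G a.1 μ + F a.1 μ * G' a μ) :=
  fun x μ => (h x μ).mul (h' x μ)

lemma MD.sum {ι : Type*} (s : Finset ι) {F : ι → X → P2 n → ℝ} {F' : ι → X × Eu n → P2 n → ℝ}
    (h : ∀ i, MD (F i) (F' i)) :
    MD (fun x μ => ∑ i ∈ s, F i x μ) (fun a μ => ∑ i ∈ s, F' i a μ) :=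
  fun x μ => HasMDeriv.sum s fun i _ => h i x μ

lemma MD.comp {F : Y → P2 n → ℝ} {F' : Y × Eu n → P2 n → ℝ} (h : MD F F') (A : X → Y) :
    MD (fun x μ => F (A x) μ) (fun a μ => F' (A a.1, a.2) μ) :=
  fun x μ => h (A x) μ

lemma MD.unique {F : X → P2 n → ℝ} {F' G' : X × Eu n → P2 n → ℝ} (h : MD F F') (h' : MD F G')
    (a : X × Eu n) (μ : P2 n) : F' a μ = G' a μ :=
  congrFun ((h a.1 μ).unique (h' a.1 μ)) a.2

lemma MD.mderiv_eq {F : X → P2 n → ℝ} {F' : X × Eu n → P2 n → ℝ} (h : MD F F') (x : X)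
    (μ : P2 n) : mderiv (F x) μ = fun z => F' (x, z) μ := (h x μ).mderiv_eq

/-- The measure derivative commutes with directional derivatives. -/
lemma MD.hasPD {v : X} {F Fv : X → P2 n → ℝ} {F' Fv' : X × Eu n → P2 n → ℝ} (h : MD F F')
    (hv : HasPD v F Fv) (hv' : HasPD (v, 0) F' Fv') (hg : Gr 2 Fv') : MD Fv Fv' := by
  intro x μ
  obtain ⟨hc, K, hK, hb⟩ := hg
  have hK0 := Gr.nonneg_of_bound hb
  have e : ∀ (s : ℝ) (y : Eu n), (x, y) + s • (v, (0 : Eu n)) = (x + s • v, y) := fun s y => by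
    simp
  have hne : (𝓝[Icc (-1 : ℝ) 1 \ {0}] 0).NeBot := by
    refine mem_closure_iff_nhdsWithin_neBot.1 ?_
    have : Ioc (0 : ℝ) 1 ⊆ Icc (-1 : ℝ) 1 \ {0} := fun s hs =>
      ⟨⟨by linarith [hs.1], hs.2⟩, hs.1.ne'⟩
    refine closure_mono this ?_
    rw [closure_Ioc one_ne_zero.symm]
    simp
  have := hasMDeriv_deriv (convex_Icc (-1 : ℝ) 1) (F := fun s μ => F (x + s • v) μ)
    (F' := fun s μ y => F' (x + s • v, y) μ) (R := fun s μ => Fv (x + s • v) μ)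
    (Q := fun s μ y => Fv' (x + s • v, y) μ) (fun s _ μ => h _ μ) (b₀ := 0) (by simp)
    (fun μ => (hv.hasDerivAt x μ 0).hasDerivWithinAt)
    (fun s _ μ y => by
      have := hv'.hasDerivAt (x, y) μ s
      simp only [e] at this
      exact this.hasDerivWithinAt)
    ((hc.comp (f := fun p : ℝ × P2 n × Eu n => ((x + p.1 • v, p.2.2), p.2.1))
      (by fun_prop)).continuousOn)
    (K := fun μ => K μ * (1 + (‖x‖ + ‖v‖)) ^ 2 * 2) (by fun_prop)
    (fun s hs μ y => by
      refine (Gr.abs_prod_le le_rfl hb (x + s • v) y μ).trans ?_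
      have h1 : ‖x + s • v‖ ≤ ‖x‖ + ‖v‖ := by
        refine (norm_add_le _ _).trans (add_le_add le_rfl ?_)
        rw [norm_smul]
        exact mul_le_of_le_one_left (norm_nonneg _) (abs_le.2 hs)
      have := hK0 μ
      gcongr) μ
  simpa using this

/-- The measure derivative of an integral against the measure. -/
lemma MD.integral {F : X × Eu n → P2 n → ℝ} {F' : (X × Eu n) × Eu n → P2 n → ℝ} (h : MD F F')
    (hF : Gr 2 F) (hF' : Gr 2 F') :
    MD (fun x μ => ∫ y, F (x, y) μ ∂μ.meas)
      (fun a μ => F a μ - ∫ y, F (a.1, y) μ ∂μ.meas + ∫ y, F' ((a.1, y), a.2) μ ∂μ.meas) := by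
  intro x μ
  set A : ((X × Eu n) × Eu n) → ((X × Eu n) × Eu n) := fun a => ((a.1.1, a.2), a.1.2) with hA'
  have hA : Lin A := ⟨fun _ _ _ => rfl, by fun_prop⟩
  have i1 : ∀ ν : P2 n, Integrable (fun z => F (x, z) μ) ν.meas := fun ν =>
    hF.integrable le_rfl _ _ _
  have i3 : ∀ ν : P2 n, Integrable (fun z => F (x, z) μ - ∫ y, F (x, y) μ ∂μ.meas) ν.meas :=
    fun ν => (i1 ν).sub (integrable_const _)
  have i2 : ∀ ν : P2 n, Integrable (fun z => ∫ y, F' ((x, y), z) μ ∂μ.meas) ν.meas := fun ν =>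
    ((hF'.comp hA).integral le_rfl).integrable le_rfl x μ ν
  have hsw : ∀ ν : P2 n, ∫ z, ∫ y, F' ((x, y), z) μ ∂μ.meas ∂ν.meas =
      ∫ y, ∫ z, F' ((x, y), z) μ ∂ν.meas ∂μ.meas := fun ν =>
    (integral_integral_swap (hF'.integrable_prod le_rfl x μ μ ν)).symm
  have hI : ∀ ν : P2 n, ∫ z, (F (x, z) μ - ∫ y, F (x, y) μ ∂μ.meas +
      ∫ y, F' ((x, y), z) μ ∂μ.meas) ∂ν.meas = ∫ z, F (x, z) μ ∂ν.meas -
      ∫ y, F (x, y) μ ∂μ.meas + ∫ y, ∫ z, F' ((x, y), z) μ ∂ν.meas ∂μ.meas := fun ν => by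
    rw [integral_add (i3 ν) (i2 ν),
      integral_sub (i1 ν) (integrable_const _), hsw]
    simp
  have h0 : ∀ y, ∫ z, F' ((x, y), z) μ ∂μ.meas = 0 := fun y => (h (x, y) μ).2.1
  have hz : ∫ z, (F (x, z) μ - ∫ y, F (x, y) μ ∂μ.meas +
      ∫ y, F' ((x, y), z) μ ∂μ.meas) ∂μ.meas = 0 := by
    rw [hI μ]
    simp [h0]
  refine hasMDeriv_of_segment (fun ν => (i3 ν).add (i2 ν)) hz
    fun ν => ?_
  simp only
  rw [hz, sub_zero, hI ν]
  -- The derivative of `F (x, y)` along the segment is a difference of two integrals against the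
  -- fixed measures `ν` and `μ`; their growth constants are bounded on the segment by `C`.
  obtain ⟨K, hK, hb⟩ := (hF'.integral_comp le_rfl (m := fun _ => ν) continuous_const).2
  obtain ⟨K', hK', hb'⟩ := (hF'.integral_comp le_rfl (m := fun _ => μ) continuous_const).2
  have hmixc : Continuous fun s => P2.mix μ ν s :=
    (P2.continuous_mix ν).comp (f := fun s => (μ, s)) (by fun_prop)
  have hcK : Continuous fun s => K (P2.mix μ ν s) + K' (P2.mix μ ν s) := by fun_prop
  obtain ⟨C, hC⟩ := (isCompact_Icc (a := (0 : ℝ)) (b := 1)).bddAbove_image hcK.continuousOn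
  have hder := hasDerivWithinAt_integral (m := μ.meas) (convex_Icc (0 : ℝ) 1)
    (F := fun s y => F (x, y) (P2.mix μ ν s))
    (F' := fun s y => ∫ z, F' ((x, y), z) (P2.mix μ ν s) ∂ν.meas -
      ∫ z, F' ((x, y), z) (P2.mix μ ν s) ∂μ.meas) (s₀ := 0) (by simp)
    (fun s _ => hF.integrable le_rfl _ _ _)
    (fun s hs y => hasDerivWithinAt_mix (fun μ => h (x, y) μ) μ ν hs)
    (bound := fun y => C * (1 + ‖x‖) ^ 2 * 2 * (1 + ‖y‖ ^ 2))
    (μ.integrable_one_add_sq.const_mul _) (fun s hs y => by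
      have hCs : K (P2.mix μ ν s) + K' (P2.mix μ ν s) ≤ C := hC (mem_image_of_mem _ hs)
      have h1 := Gr.abs_prod_le le_rfl hb x y (P2.mix μ ν s)
      have h2 := Gr.abs_prod_le le_rfl hb' x y (P2.mix μ ν s)
      refine (abs_sub _ _).trans ((add_le_add h1 h2).trans ?_)
      calc _ = (K (P2.mix μ ν s) + K' (P2.mix μ ν s)) * (1 + ‖x‖) ^ 2 * 2 * (1 + ‖y‖ ^ 2) := by ring
        _ ≤ _ := by gcongr)
  have hder' : HasDerivWithinAt (fun s => ∫ y, F (x, y) (P2.mix μ ν s) ∂ν.meas)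
      (∫ y, (∫ z, F' ((x, y), z) (P2.mix μ ν 0) ∂ν.meas -
        ∫ z, F' ((x, y), z) (P2.mix μ ν 0) ∂μ.meas) ∂ν.meas) (Icc 0 1) 0 :=
    hasDerivWithinAt_integral (m := ν.meas) (convex_Icc (0 : ℝ) 1)
    (F := fun s y => F (x, y) (P2.mix μ ν s))
    (F' := fun s y => ∫ z, F' ((x, y), z) (P2.mix μ ν s) ∂ν.meas -
      ∫ z, F' ((x, y), z) (P2.mix μ ν s) ∂μ.meas) (s₀ := 0) (by simp)
    (fun s _ => hF.integrable le_rfl _ _ _)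
    (fun s hs y => hasDerivWithinAt_mix (fun μ => h (x, y) μ) μ ν hs)
    (bound := fun y => C * (1 + ‖x‖) ^ 2 * 2 * (1 + ‖y‖ ^ 2))
    (ν.integrable_one_add_sq.const_mul _) (fun s hs y => by
      have hCs : K (P2.mix μ ν s) + K' (P2.mix μ ν s) ≤ C := hC (mem_image_of_mem _ hs)
      have h1 := Gr.abs_prod_le le_rfl hb x y (P2.mix μ ν s)
      have h2 := Gr.abs_prod_le le_rfl hb' x y (P2.mix μ ν s)
      refine (abs_sub _ _).trans ((add_le_add h1 h2).trans ?_)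
      calc _ = (K (P2.mix μ ν s) + K' (P2.mix μ ν s)) * (1 + ‖x‖) ^ 2 * 2 * (1 + ‖y‖ ^ 2) := by ring
        _ ≤ _ := by gcongr)
  -- The integral against the mixture is `(1 - s) ∫ · dμ + s ∫ · dν`, and the product rule is
  -- applied at `s = 0`. The mean of `F'` under `μ` is zero there.
  have h1 := (((hasDerivWithinAt_id (0 : ℝ) (Icc 0 1)).const_sub 1).mul hder).add
    ((hasDerivWithinAt_id (0 : ℝ) (Icc 0 1)).mul hder')
  refine (h1.congr_deriv ?_).congr (fun s hs => ?_) ?_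
  · simp only [id, P2.mix_zero, h0]
    simp
    ring
  · exact P2.integral_mix hs (hF.integrable le_rfl _ _ _) (hF.integrable le_rfl _ _ _)
  · exact P2.integral_mix (by simp) (hF.integrable le_rfl _ _ _) (hF.integrable le_rfl _ _ _)

end Calculus

end SocialMFC

/-! ### Symmetry of the second derivative with respect to the measure. -/

namespace SocialMFC
variable {n : ℕ}

section Symmetry

variable {X : Type*} [NormedAddCommGroup X] [NormedSpace ℝ X]

/-- The identity `⟨μ, F'(x, ·)⟩ = 0`, differentiated in `μ`. It gives the mean of `F''` over its
first measure slot; over the last slot the mean is zero. -/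
lemma MD.integral_first {F' : X × Eu n → P2 n → ℝ}
    {F'' : (X × Eu n) × Eu n → P2 n → ℝ} (h0 : ∀ x μ, ∫ y, F' (x, y) μ ∂μ.meas = 0)
    (h' : MD F' F'') (hg : Gr 2 F') (hg' : Gr 2 F'') (x : X) (z : Eu n) (μ : P2 n) :
    ∫ y, F'' ((x, y), z) μ ∂μ.meas = -F' (x, z) μ := by
  have h1 := h'.integral hg hg'
  simp only [h0, sub_zero] at h1
  have h2 := congrFun ((h1 x μ).unique (HasMDeriv.const 0 μ)) z
  simp only at h2
  linarith

/-- The commutation rule for the second derivative with respect to the measure. -/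
lemma MD.symm {F : X → P2 n → ℝ} {F' : X × Eu n → P2 n → ℝ} {F'' : (X × Eu n) × Eu n → P2 n → ℝ}
    (h : MD F F') (h' : MD F' F'') (hg : Gr 2 F') (hg' : Gr 2 F'') (x : X) (y z : Eu n)
    (μ : P2 n) :
    F'' ((x, y), z) μ = F'' ((x, z), y) μ + F' (x, y) μ - F' (x, z) μ := by
  have h0 : ∀ x μ, ∫ y, F' (x, y) μ ∂μ.meas = 0 := fun x μ => (h x μ).2.1
  have h0' : ∀ a μ, ∫ y, F'' (a, y) μ ∂μ.meas = 0 := fun a μ => (h' a μ).2.1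
  -- The Dirac mass at `y` singles out one direction: with `b ↦ P2.mix μ' δ b`, the derivative of
  -- `F` at `b = 0` is `F' (x, y) μ'`. Differentiating this function of `(b, μ')` in both orders
  -- produces both arrangements of `F''`.
  set δ := P2.dirac y with hδ
  have hT1 : Gr 2 (fun (a : ℝ × Eu n) μ' => F' (x, a.2) (P2.mix μ' δ a.1)) := by
    refine (hg.comp_mix δ).comp_of_bound (A := fun a : ℝ × Eu n => (a.1, (x, a.2)))
      (by fun_prop) (c := 1 + ‖x‖) fun a => ?_
    have h1 := norm_fst_le a
    have h2 := norm_snd_le a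
    have h3 := mul_nonneg (norm_nonneg x) (norm_nonneg a)
    rw [Prod.norm_def, Prod.norm_def]
    refine max_le ?_ (max_le ?_ ?_) <;> simp only <;> nlinarith [norm_nonneg x, norm_nonneg a]
  have hT3 : Gr 2 (fun (a : (ℝ × Eu n) × Eu n) μ' =>
      F'' ((x, a.1.2), a.2) (P2.mix μ' δ a.1.1)) := by
    refine (hg'.comp_mix δ).comp_of_bound
      (A := fun a : (ℝ × Eu n) × Eu n => (a.1.1, ((x, a.1.2), a.2)))
      (by fun_prop) (c := 1 + ‖x‖) fun a => ?_
    have h1 := (norm_fst_le a.1).trans (norm_fst_le a)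
    have h2 := (norm_snd_le a.1).trans (norm_fst_le a)
    have h2' := norm_snd_le a
    have h3 := mul_nonneg (norm_nonneg x) (norm_nonneg a)
    rw [Prod.norm_def, Prod.norm_def, Prod.norm_def]
    refine max_le ?_ (max_le (max_le ?_ ?_) ?_) <;> simp only <;>
      nlinarith [norm_nonneg x, norm_nonneg a]
  have hT3y : Gr 2 (fun (a : ℝ × Eu n) μ' => F'' ((x, a.2), y) (P2.mix μ' δ a.1)) := by
    refine hT3.comp_of_bound (A := fun a : ℝ × Eu n => (a, y)) (by fun_prop) (c := 1 + ‖y‖)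
      fun a => ?_
    have h3 := mul_nonneg (norm_nonneg y) (norm_nonneg a)
    rw [Prod.norm_def]
    refine max_le ?_ ?_ <;> simp only <;> nlinarith [norm_nonneg y, norm_nonneg a]
  have hD := hT3y.sub (hT3.integral le_rfl)
  have hfst : Lin (fun a : ℝ × Eu n => a.1) := ⟨fun _ _ _ => rfl, by fun_prop⟩
  have hG1 := hT1.sub ((hT1.integral le_rfl).comp hfst)
  have hG2 := hD.sub ((hD.integral le_rfl).comp hfst)
  simp only at hD hG1 hG2
  obtain ⟨K, hK, hb⟩ := hD.2
  obtain ⟨K₁, hK₁, hb₁⟩ := hG1.2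
  obtain ⟨K₂, hK₂, hb₂⟩ := hG2.2
  have hne : (𝓝[Icc (0 : ℝ) 1 \ {0}] 0).NeBot := by
    refine mem_closure_iff_nhdsWithin_neBot.1 ?_
    have : Ioc (0 : ℝ) 1 ⊆ Icc (0 : ℝ) 1 \ {0} := fun s hs => ⟨⟨hs.1.le, hs.2⟩, hs.1.ne'⟩
    refine closure_mono this ?_
    rw [closure_Ioc one_ne_zero.symm]
    simp
  have hpow : ∀ b ∈ Icc (0 : ℝ) 1, (1 + ‖b‖) ^ 2 ≤ 4 := fun b hb => by
    rw [Real.norm_of_nonneg hb.1]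
    nlinarith [hb.1, hb.2]
  have hder : ∀ b ∈ Icc (0 : ℝ) 1, ∀ μ' z, HasDerivWithinAt
      (fun b => F' (x, z) (P2.mix μ' δ b)) (F'' ((x, z), y) (P2.mix μ' δ b) -
        ∫ w, F'' ((x, z), w) (P2.mix μ' δ b) ∂μ'.meas) (Icc 0 1) b := fun b hb μ' z => by
    have := hasDerivWithinAt_mix (h' (x, z)) μ' δ hb
    rwa [hδ, P2.integral_dirac_meas] at this
  -- The chain rule in `μ'` yields the factor `1 - b` and the subtraction of the mean. `Q` is the
  -- derivative of that expression in `b`, by the product rule.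
  have key := hasMDeriv_deriv (convex_Icc (0 : ℝ) 1) (F := fun b μ' => F x (P2.mix μ' δ b))
    (F' := fun b μ' z => (1 - b) * (F' (x, z) (P2.mix μ' δ b) -
      ∫ w, F' (x, w) (P2.mix μ' δ b) ∂μ'.meas))
    (R := fun _ μ' => F' (x, y) μ')
    (Q := fun b μ' z => (-1) * (F' (x, z) (P2.mix μ' δ b) -
      ∫ w, F' (x, w) (P2.mix μ' δ b) ∂μ'.meas) + (1 - b) * (F'' ((x, z), y) (P2.mix μ' δ b) -
        ∫ w, F'' ((x, z), w) (P2.mix μ' δ b) ∂μ'.meas - ∫ z', (F'' ((x, z'), y) (P2.mix μ' δ b) -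
        ∫ w, F'' ((x, z'), w) (P2.mix μ' δ b) ∂μ'.meas) ∂μ'.meas))
    (b₀ := 0) ?_ (by simp) ?_ ?_ ?_
    (K := fun μ => (K₁ μ + K₂ μ) * 4 * 2) (by fun_prop) ?_ μ
  -- At `b = 0` the means of `F'` and of `F''` over its last slot vanish. What survives is `-F' (x,
  -- z)` from the factor `1 - b`, and `F' (x, y)` from `MD.integral_first`.
  · have := congrFun (key.unique (h' (x, y) μ)) z
    simp only [P2.mix_zero, h0, h0', sub_zero] at this
    rw [MD.integral_first h0 h' hg hg'] at this
    linarith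
  -- By `mix_mix_swap`, a segment issuing from `μ'` is carried to a segment issuing from `P2.mix μ'
  -- δ b`. The two end points share the part `b δ`, which cancels and leaves `1 - b`.
  · intro b hb μ'
    have hi : ∀ ν : P2 n, Integrable (fun z => F' (x, z) (P2.mix μ' δ b)) ν.meas := fun ν =>
      hg.integrable le_rfl _ _ _
    have hi' : ∀ ν : P2 n, ∫ z, (1 - b) * (F' (x, z) (P2.mix μ' δ b) -
        ∫ w, F' (x, w) (P2.mix μ' δ b) ∂μ'.meas) ∂ν.meas =
        (1 - b) * (∫ z, F' (x, z) (P2.mix μ' δ b) ∂ν.meas -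
          ∫ w, F' (x, w) (P2.mix μ' δ b) ∂μ'.meas) := fun ν => by
      rw [integral_const_mul, integral_sub (hi ν) (integrable_const _)]
      simp
    refine hasMDeriv_of_segment (fun ν => ((hi ν).sub (integrable_const _)).const_mul _)
      (by rw [hi']; simp) fun ν => ?_
    have h1 := hasDerivWithinAt_mix (h x) (P2.mix μ' δ b) (P2.mix ν δ b) (s := 0) (by simp)
    simp only [P2.mix_zero] at h1
    rw [P2.integral_mix hb (hi _) (hi _), P2.integral_mix hb (hi _) (hi _)] at h1
    simp only [hi']
    refine (h1.congr_deriv (by ring)).congr (fun s hs => ?_) (by simp)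
    rw [P2.mix_mix_swap hs hb]
  · intro μ'
    have h1 := hasDerivWithinAt_mix (h x) μ' δ (s := 0) (by simp)
    simp only [P2.mix_zero] at h1
    rwa [h0, sub_zero, hδ, P2.integral_dirac_meas] at h1
  · intro b hb' μ' z
    have h1 := hder b hb' μ' z
    have h2 := hasDerivWithinAt_integral (m := μ'.meas) (convex_Icc (0 : ℝ) 1)
      (F := fun b z => F' (x, z) (P2.mix μ' δ b))
      (F' := fun b z => F'' ((x, z), y) (P2.mix μ' δ b) -
        ∫ w, F'' ((x, z), w) (P2.mix μ' δ b) ∂μ'.meas) hb'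
      (fun b _ => hg.integrable le_rfl _ _ _) (fun b hb z => hder b hb μ' z)
      (bound := fun z => K μ' * 4 * 2 * (1 + ‖z‖ ^ 2)) (μ'.integrable_one_add_sq.const_mul _)
      (fun b hbB z => by
        refine (Gr.abs_prod_le le_rfl hb b z μ').trans ?_
        have := hpow b hbB
        have := Gr.nonneg_of_bound hb μ'
        gcongr)
    exact ((hasDerivWithinAt_id b (Icc 0 1)).const_sub 1).mul (h1.sub h2)
  · have c1 := hG1.1.comp (f := fun p : ℝ × P2 n × Eu n => ((p.1, p.2.2), p.2.1)) (by fun_prop)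
    have c2 := hG2.1.comp (f := fun p : ℝ × P2 n × Eu n => ((p.1, p.2.2), p.2.1)) (by fun_prop)
    exact ((continuous_const.mul c1).add
      (((continuous_const.sub continuous_fst).mul c2))).continuousOn
  · intro b hbB μ' z
    have e1 := Gr.abs_prod_le le_rfl hb₁ b z μ'
    have e2 := Gr.abs_prod_le le_rfl hb₂ b z μ'
    simp only at e1 e2
    have hp := hpow b hbB
    have k1 := Gr.nonneg_of_bound hb₁ μ'
    have k2 := Gr.nonneg_of_bound hb₂ μ'
    refine (abs_add_le _ _).trans ?_
    rw [abs_mul, abs_mul, abs_neg, abs_one, one_mul,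
      abs_of_nonneg (by linarith [hbB.2] : 0 ≤ 1 - b)]
    have e3 := (mul_le_of_le_one_left (abs_nonneg _) (by linarith [hbB.1] : 1 - b ≤ 1)).trans e2
    refine (add_le_add e1 e3).trans ?_
    have : 0 ≤ 1 + ‖z‖ ^ 2 := by positivity
    calc _ = (K₁ μ' + K₂ μ') * (1 + ‖b‖) ^ 2 * 2 * (1 + ‖z‖ ^ 2) := by ring
      _ ≤ _ := by gcongr

end Symmetry
end SocialMFC

namespace SocialMFC
variable {n : ℕ}

/-- Time and state. -/
abbrev TX (n : ℕ) : Type := ℝ × Eu n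

/-! ### Regularity data of functions of time, state and measure -/

/-- The derivatives that occur in a master equation, with their growth. Here `Fxy i j` is
`∂_{x_i} ∂_{y_j} δ_μ F` and `Fyz i j` is `∂_{y_i} ∂_{z_j} δ_{μμ} F`. -/
structure Jet (F : TX n → P2 n → ℝ) where
  F1 : TX n × Eu n → P2 n → ℝ
  F2 : (TX n × Eu n) × Eu n → P2 n → ℝ
  Fx : Fin n → TX n → P2 n → ℝ
  Fxx : Fin n → Fin n → TX n → P2 n → ℝ
  Fy : Fin n → TX n × Eu n → P2 n → ℝ
  Fyy : Fin n → Fin n → TX n × Eu n → P2 n → ℝ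
  Fxy : Fin n → Fin n → TX n × Eu n → P2 n → ℝ
  Fz : Fin n → (TX n × Eu n) × Eu n → P2 n → ℝ
  Fyz : Fin n → Fin n → (TX n × Eu n) × Eu n → P2 n → ℝ
  cont : Continuous (fun a : TX n × P2 n => F a.1 a.2)
  gr1 : Gr 2 F1
  gr2 : Gr 2 F2
  grx : ∀ i, Gr 1 (Fx i)
  grxx : ∀ i j, Gr 0 (Fxx i j)
  gry : ∀ i, Gr 1 (Fy i)
  gryy : ∀ i j, Gr 0 (Fyy i j)
  grxy : ∀ i j, Gr 0 (Fxy i j)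
  gryz : ∀ i j, Gr 0 (Fyz i j)
  md1 : MD F F1
  md2 : MD F1 F2
  pdx : ∀ i, HasPD (0, bas i) F (Fx i)
  pdxx : ∀ i j, HasPD (0, bas i) (Fx j) (Fxx i j)
  pdy : ∀ i, HasPD (0, bas i) F1 (Fy i)
  pdyy : ∀ i j, HasPD (0, bas i) (Fy j) (Fyy i j)
  pdxy : ∀ i j, HasPD ((0, bas i), 0) (Fy j) (Fxy i j)
  pdz : ∀ j, HasPD (0, bas j) F2 (Fz j)
  pdyz : ∀ i j, HasPD ((0, bas i), 0) (Fz j) (Fyz i j)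

/-- The sum of two regularity data. -/
def Jet.add {F G : TX n → P2 n → ℝ} (J : Jet F) (K : Jet G) : Jet (fun x μ => F x μ + G x μ) where
  F1 := fun a μ => J.F1 a μ + K.F1 a μ
  F2 := fun a μ => J.F2 a μ + K.F2 a μ
  Fx := fun i a μ => J.Fx i a μ + K.Fx i a μ
  Fxx := fun i j a μ => J.Fxx i j a μ + K.Fxx i j a μ
  Fy := fun i a μ => J.Fy i a μ + K.Fy i a μ
  Fyy := fun i j a μ => J.Fyy i j a μ + K.Fyy i j a μ
  Fxy := fun i j a μ => J.Fxy i j a μ + K.Fxy i j a μ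
  Fz := fun i a μ => J.Fz i a μ + K.Fz i a μ
  Fyz := fun i j a μ => J.Fyz i j a μ + K.Fyz i j a μ
  cont := J.cont.add K.cont
  gr1 := J.gr1.add K.gr1
  gr2 := J.gr2.add K.gr2
  grx := fun i => (J.grx i).add (K.grx i)
  grxx := fun i j => (J.grxx i j).add (K.grxx i j)
  gry := fun i => (J.gry i).add (K.gry i)
  gryy := fun i j => (J.gryy i j).add (K.gryy i j)
  grxy := fun i j => (J.grxy i j).add (K.grxy i j)
  gryz := fun i j => (J.gryz i j).add (K.gryz i j)
  md1 := J.md1.add K.md1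
  md2 := J.md2.add K.md2
  pdx := fun i => (J.pdx i).add (K.pdx i)
  pdxx := fun i j => (J.pdxx i j).add (K.pdxx i j)
  pdy := fun i => (J.pdy i).add (K.pdy i)
  pdyy := fun i j => (J.pdyy i j).add (K.pdyy i j)
  pdxy := fun i j => (J.pdxy i j).add (K.pdxy i j)
  pdz := fun i => (J.pdz i).add (K.pdz i)
  pdyz := fun i j => (J.pdyz i j).add (K.pdyz i j)

/-- The difference of two regularity data. -/
def Jet.sub {F G : TX n → P2 n → ℝ} (J : Jet F) (K : Jet G) : Jet (fun x μ => F x μ - G x μ) where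
  F1 := fun a μ => J.F1 a μ - K.F1 a μ
  F2 := fun a μ => J.F2 a μ - K.F2 a μ
  Fx := fun i a μ => J.Fx i a μ - K.Fx i a μ
  Fxx := fun i j a μ => J.Fxx i j a μ - K.Fxx i j a μ
  Fy := fun i a μ => J.Fy i a μ - K.Fy i a μ
  Fyy := fun i j a μ => J.Fyy i j a μ - K.Fyy i j a μ
  Fxy := fun i j a μ => J.Fxy i j a μ - K.Fxy i j a μ
  Fz := fun i a μ => J.Fz i a μ - K.Fz i a μ
  Fyz := fun i j a μ => J.Fyz i j a μ - K.Fyz i j a μ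
  cont := J.cont.sub K.cont
  gr1 := J.gr1.sub K.gr1
  gr2 := J.gr2.sub K.gr2
  grx := fun i => (J.grx i).sub (K.grx i)
  grxx := fun i j => (J.grxx i j).sub (K.grxx i j)
  gry := fun i => (J.gry i).sub (K.gry i)
  gryy := fun i j => (J.gryy i j).sub (K.gryy i j)
  grxy := fun i j => (J.grxy i j).sub (K.grxy i j)
  gryz := fun i j => (J.gryz i j).sub (K.gryz i j)
  md1 := J.md1.sub K.md1
  md2 := J.md2.sub K.md2
  pdx := fun i => (J.pdx i).sub (K.pdx i)
  pdxx := fun i j => (J.pdxx i j).sub (K.pdxx i j)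
  pdy := fun i => (J.pdy i).sub (K.pdy i)
  pdyy := fun i j => (J.pdyy i j).sub (K.pdyy i j)
  pdxy := fun i j => (J.pdxy i j).sub (K.pdxy i j)
  pdz := fun i => (J.pdz i).sub (K.pdz i)
  pdyz := fun i j => (J.pdyz i j).sub (K.pdyz i j)

/-- The derivatives of an integrand `h(x, y, μ)`, `δ_μ h(x, y, μ; z)`, `δ_{μμ} h(x, y, μ; z, w)`
that are needed to integrate it over `y` against `μ`. -/
structure Pre (h : TX n × Eu n → P2 n → ℝ) where
  h1 : (TX n × Eu n) × Eu n → P2 n → ℝ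
  h2 : ((TX n × Eu n) × Eu n) × Eu n → P2 n → ℝ
  hx : Fin n → TX n × Eu n → P2 n → ℝ
  hxx : Fin n → Fin n → TX n × Eu n → P2 n → ℝ
  hy : Fin n → TX n × Eu n → P2 n → ℝ
  hyy : Fin n → Fin n → TX n × Eu n → P2 n → ℝ
  hxy : Fin n → Fin n → TX n × Eu n → P2 n → ℝ
  kz : Fin n → (TX n × Eu n) × Eu n → P2 n → ℝ
  kzz : Fin n → Fin n → (TX n × Eu n) × Eu n → P2 n → ℝ
  kxz : Fin n → Fin n → (TX n × Eu n) × Eu n → P2 n → ℝ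
  kyz : Fin n → Fin n → (TX n × Eu n) × Eu n → P2 n → ℝ
  ky : Fin n → (TX n × Eu n) × Eu n → P2 n → ℝ
  kzy : Fin n → Fin n → (TX n × Eu n) × Eu n → P2 n → ℝ
  lw : Fin n → ((TX n × Eu n) × Eu n) × Eu n → P2 n → ℝ
  lzw : Fin n → Fin n → ((TX n × Eu n) × Eu n) × Eu n → P2 n → ℝ
  gr0 : Gr 2 h
  gr1 : Gr 2 h1
  gr2 : Gr 2 h2
  grx : ∀ i, Gr 1 (hx i)
  grxx : ∀ i j, Gr 0 (hxx i j)
  gry : ∀ i, Gr 1 (hy i)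
  gryy : ∀ i j, Gr 0 (hyy i j)
  grxy : ∀ i j, Gr 0 (hxy i j)
  grkz : ∀ i, Gr 1 (kz i)
  grkzz : ∀ i j, Gr 0 (kzz i j)
  grkxz : ∀ i j, Gr 0 (kxz i j)
  grkyz : ∀ i j, Gr 0 (kyz i j)
  grkzy : ∀ i j, Gr 0 (kzy i j)
  grlw : ∀ i, Gr 1 (lw i)
  grlzw : ∀ i j, Gr 0 (lzw i j)
  md1 : MD h h1
  md2 : MD h1 h2
  pdx : ∀ i, HasPD ((0, bas i), 0) h (hx i)
  pdxx : ∀ i j, HasPD ((0, bas i), 0) (hx j) (hxx i j)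
  pdy : ∀ i, HasPD (0, bas i) h (hy i)
  pdyy : ∀ i j, HasPD (0, bas i) (hy j) (hyy i j)
  pdxy : ∀ i j, HasPD ((0, bas i), 0) (hy j) (hxy i j)
  pdkz : ∀ i, HasPD (0, bas i) h1 (kz i)
  pdkzz : ∀ i j, HasPD (0, bas i) (kz j) (kzz i j)
  pdkxz : ∀ i j, HasPD (((0, bas i), 0), 0) (kz j) (kxz i j)
  pdkyz : ∀ i j, HasPD ((0, bas i), 0) (kz j) (kyz i j)
  pdky : ∀ i, HasPD ((0, bas i), 0) h1 (ky i)
  pdkzy : ∀ i j, HasPD (0, bas i) (ky j) (kzy i j)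
  pdlw : ∀ i, HasPD (0, bas i) h2 (lw i)
  pdlzw : ∀ i j, HasPD ((0, bas i), 0) (lw j) (lzw i j)

section Arrange

/-- Exchange of the last two arguments. -/
def swapLast {X : Type*} (a : (X × Eu n) × Eu n) : (X × Eu n) × Eu n := ((a.1.1, a.2), a.1.2)

/-- The cyclic exchange `(x, z, w, y) ↦ (x, y, z, w)`. -/
def rotLast {X : Type*} (a : ((X × Eu n) × Eu n) × Eu n) : ((X × Eu n) × Eu n) × Eu n :=
  (((a.1.1.1, a.2), a.1.1.2), a.1.2)

variable {X : Type*} [NormedAddCommGroup X] [NormedSpace ℝ X]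

lemma lin_swapLast : Lin (swapLast : (X × Eu n) × Eu n → (X × Eu n) × Eu n) :=
  ⟨fun _ _ _ => rfl, by unfold swapLast; fun_prop⟩

lemma lin_rotLast : Lin (rotLast : ((X × Eu n) × Eu n) × Eu n → ((X × Eu n) × Eu n) × Eu n) :=
  ⟨fun _ _ _ => rfl, by unfold rotLast; fun_prop⟩

lemma lin_fst {X Y : Type*} [NormedAddCommGroup X] [NormedSpace ℝ X] [NormedAddCommGroup Y]
    [NormedSpace ℝ Y] : Lin (fun a : X × Y => a.1) := ⟨fun _ _ _ => rfl, by fun_prop⟩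

/-- The map `(x, z, w) ↦ (x, w)`. -/
lemma lin_skip : Lin (fun a : (X × Eu n) × Eu n => (a.1.1, a.2)) :=
  ⟨fun _ _ _ => rfl, by fun_prop⟩

end Arrange

/-! ### Derivatives of an integral against the measure variable. -/

namespace Pre

variable {h : TX n × Eu n → P2 n → ℝ}

/-- The integral `∫ h(x, y, μ) μ(dy)`. -/
abbrev int (h : TX n × Eu n → P2 n → ℝ) : TX n → P2 n → ℝ := fun x μ => ∫ y, h (x, y) μ ∂μ.meas

lemma pdy_int (p : Pre h) (i : Fin n) : HasPD (0, bas i)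
    (fun a μ => h a μ - int h a.1 μ + ∫ y, p.h1 (swapLast (a, y)) μ ∂μ.meas)
    (fun a μ => p.hy i a μ + ∫ y, p.kz i (swapLast (a, y)) μ ∂μ.meas) := by
  have h1 := ((p.pdy i).sub (HasPD.of_const (F := int h) (v := ((0 : TX n), (bas i : Eu n)))
    lin_fst rfl)).add
    (HasPD.integral (v := ((0 : TX n), (bas i : Eu n)))
      (HasPD.comp lin_swapLast (p.pdkz i)) (p.gr1.comp lin_swapLast)
      (((p.grkz i).comp lin_swapLast).mono (by norm_num)))
  simpa only [sub_zero] using h1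

/-- The regularity data of `∫ h(x, y, μ) μ(dy)`. -/
def jet (p : Pre h) : Jet (int h) where
  F1 := fun a μ => h a μ - int h a.1 μ + ∫ y, p.h1 (swapLast (a, y)) μ ∂μ.meas
  -- `F1` differentiated term by term: the first term gives `h1`, the mean gives `F1` at the new
  -- variable, and the integral of `h1` obeys `MD.integral` again. `swapLast` and `rotLast` bring
  -- the integration variable to the last place.
  F2 := fun a μ => p.h1 a μ - (h (a.1.1, a.2) μ - int h a.1.1 μ +
      ∫ y, p.h1 (swapLast ((a.1.1, a.2), y)) μ ∂μ.meas) +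
    (p.h1 (swapLast a) μ - ∫ y, p.h1 (swapLast (a.1, y)) μ ∂μ.meas +
      ∫ y, p.h2 (rotLast (a, y)) μ ∂μ.meas)
  Fx := fun i x μ => ∫ y, p.hx i (x, y) μ ∂μ.meas
  Fxx := fun i j x μ => ∫ y, p.hxx i j (x, y) μ ∂μ.meas
  Fy := fun i a μ => p.hy i a μ + ∫ y, p.kz i (swapLast (a, y)) μ ∂μ.meas
  Fyy := fun i j a μ => p.hyy i j a μ + ∫ y, p.kzz i j (swapLast (a, y)) μ ∂μ.meas
  Fxy := fun i j a μ => p.hxy i j a μ + ∫ y, p.kxz i j (swapLast (a, y)) μ ∂μ.meas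
  Fz := fun j a μ => p.kz j a μ - (p.hy j (a.1.1, a.2) μ +
      ∫ y, p.kz j (swapLast ((a.1.1, a.2), y)) μ ∂μ.meas) +
    (p.ky j (swapLast a) μ + ∫ y, p.lw j (rotLast (a, y)) μ ∂μ.meas)
  -- The subtracted part of `Fz` depends only on the state and the last variable, so it disappears
  -- under `∂_y`. The two terms in `h1` arise because either measure slot can be the one produced by
  -- differentiating the integrating measure.
  Fyz := fun i j a μ => p.kyz i j a μ + p.kzy i j (swapLast a) μ +
    ∫ y, p.lzw i j (rotLast (a, y)) μ ∂μ.meas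
  cont := (p.gr0.integral le_rfl).1
  gr1 := (p.gr0.sub ((p.gr0.integral le_rfl).comp lin_fst)).add
    ((p.gr1.comp lin_swapLast).integral le_rfl)
  gr2 := (p.gr1.sub (((p.gr0.sub ((p.gr0.integral le_rfl).comp lin_fst)).add
    ((p.gr1.comp lin_swapLast).integral le_rfl)).comp lin_skip)).add
    (((p.gr1.comp lin_swapLast).sub
      (((p.gr1.comp lin_swapLast).integral le_rfl).comp lin_fst)).add
      ((p.gr2.comp lin_rotLast).integral le_rfl))
  grx := fun i => (p.grx i).integral (by norm_num)
  grxx := fun i j => (p.grxx i j).integral (by norm_num)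
  gry := fun i => (p.gry i).add (((p.grkz i).comp lin_swapLast).integral (by norm_num))
  gryy := fun i j => (p.gryy i j).add (((p.grkzz i j).comp lin_swapLast).integral (by norm_num))
  grxy := fun i j => (p.grxy i j).add (((p.grkxz i j).comp lin_swapLast).integral (by norm_num))
  gryz := fun i j => ((p.grkyz i j).add ((p.grkzy i j).comp lin_swapLast)).add
    (((p.grlzw i j).comp lin_rotLast).integral (by norm_num))
  md1 := p.md1.integral p.gr0 p.gr1
  md2 := (p.md1.sub ((p.md1.integral p.gr0 p.gr1).comp Prod.fst)).add
    ((p.md2.comp swapLast).integral (p.gr1.comp lin_swapLast)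
      (p.gr2.comp (A := fun b : ((TX n × Eu n) × Eu n) × Eu n => (swapLast b.1, b.2))
        ⟨fun _ _ _ => rfl, by unfold swapLast; fun_prop⟩))
  pdx := fun i => (p.pdx i).integral p.gr0 ((p.grx i).mono (by norm_num))
  pdxx := fun i j => (p.pdxx i j).integral ((p.grx j).mono (by norm_num))
    ((p.grxx i j).mono (by norm_num))
  pdy := p.pdy_int
  pdyy := fun i j => (p.pdyy i j).add (HasPD.integral (v := ((0 : TX n), (bas i : Eu n)))
        (HasPD.comp lin_swapLast (p.pdkzz i j)) (((p.grkz j).comp lin_swapLast).mono (by norm_num))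
        (((p.grkzz i j).comp lin_swapLast).mono (by norm_num)))
  pdxy := fun i j => (p.pdxy i j).add (HasPD.integral (v := (((0, bas i) : TX n), (0 : Eu n)))
        (HasPD.comp lin_swapLast (p.pdkxz i j)) (((p.grkz j).comp lin_swapLast).mono (by norm_num))
        (((p.grkxz i j).comp lin_swapLast).mono (by norm_num)))
  pdz := fun j => by
    have h1 := ((p.pdkz j).sub (HasPD.comp (v := ((0 : TX n × Eu n), (bas j : Eu n)))
      lin_skip (p.pdy_int j))).add
      (((HasPD.comp (v := ((0 : TX n × Eu n), (bas j : Eu n))) lin_swapLast (p.pdky j)).sub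
        (HasPD.of_const (F := fun a μ => ∫ y, p.h1 (swapLast (a, y)) μ ∂μ.meas)
          (v := ((0 : TX n × Eu n), (bas j : Eu n))) lin_fst rfl)).add
        (HasPD.integral (v := ((0 : TX n × Eu n), (bas j : Eu n)))
          (HasPD.comp lin_rotLast (p.pdlw j)) (p.gr2.comp lin_rotLast)
          (((p.grlw j).comp lin_rotLast).mono (by norm_num))))
    simpa only [sub_zero] using h1
  pdyz := fun i j => by
    have h1 := ((p.pdkyz i j).sub (HasPD.of_const
      (F := fun a μ => p.hy j a μ + ∫ y, p.kz j (swapLast (a, y)) μ ∂μ.meas)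
      (v := (((0 : TX n), (bas i : Eu n)), (0 : Eu n))) lin_skip rfl)).add
      ((HasPD.comp (v := (((0 : TX n), (bas i : Eu n)), (0 : Eu n)))
        lin_swapLast (p.pdkzy i j)).add
        (HasPD.integral (v := (((0 : TX n), (bas i : Eu n)), (0 : Eu n)))
          (HasPD.comp lin_rotLast (p.pdlzw i j)) (((p.grlw j).comp lin_rotLast).mono (by norm_num))
          (((p.grlzw i j).comp lin_rotLast).mono (by norm_num))))
    simpa only [sub_zero, ← add_assoc] using h1

end Pre

end SocialMFC

namespace SocialMFC
variable {n : ℕ}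

lemma HasPD.unique {X : Type*} [NormedAddCommGroup X] [NormedSpace ℝ X] {v : X}
    {F G G' : X → P2 n → ℝ} (h : HasPD v F G) (h' : HasPD v F G') : G = G' := by
  funext x μ
  exact HasDerivAt.unique (h x μ) (h' x μ)

lemma HasPD.const_mul {X : Type*} [NormedAddCommGroup X] [NormedSpace ℝ X] {v : X}
    {F G : X → P2 n → ℝ} (h : HasPD v F G) (c : ℝ) :
    HasPD v (fun x μ => c * F x μ) (fun x μ => c * G x μ) :=
  fun x μ => HasDerivAt.const_mul c (h x μ)

lemma Lin.map_fst {X Y : Type*} [NormedAddCommGroup X] [NormedSpace ℝ X] [NormedAddCommGroup Y]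
    [NormedSpace ℝ Y] {A : X → Y} (hA : Lin A) : Lin (fun a : X × Eu n => (A a.1, a.2)) := by
  refine ⟨fun x v t => ?_, (hA.cont.comp continuous_fst).prodMk continuous_snd⟩
  ext1
  · exact hA.map _ _ _
  · rfl

/-- The further derivatives of a value function in the class `𝒞_V`. Here `F2xy i j` is
`∂_{x_i} ∂_{y_j} δ_{μμ} F` and `F3yz i j` is `∂_{y_i} ∂_{z_j} δ_{μμμ} F`. -/
structure VJet (F : TX n → P2 n → ℝ) extends Jet F where
  F3 : ((TX n × Eu n) × Eu n) × Eu n → P2 n → ℝ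
  F1x : Fin n → TX n × Eu n → P2 n → ℝ
  F1xx : Fin n → Fin n → TX n × Eu n → P2 n → ℝ
  F2x : Fin n → (TX n × Eu n) × Eu n → P2 n → ℝ
  F2y : Fin n → (TX n × Eu n) × Eu n → P2 n → ℝ
  F2yy : Fin n → Fin n → (TX n × Eu n) × Eu n → P2 n → ℝ
  F2xy : Fin n → Fin n → (TX n × Eu n) × Eu n → P2 n → ℝ
  F3y : Fin n → ((TX n × Eu n) × Eu n) × Eu n → P2 n → ℝ
  F3z : Fin n → ((TX n × Eu n) × Eu n) × Eu n → P2 n → ℝ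
  F3yz : Fin n → Fin n → ((TX n × Eu n) × Eu n) × Eu n → P2 n → ℝ
  gr0 : Gr 2 F
  gr3 : Gr 2 F3
  grF1x : ∀ i, Gr 1 (F1x i)
  grF1xx : ∀ i j, Gr 0 (F1xx i j)
  grF2y : ∀ i, Gr 1 (F2y i)
  grF2yy : ∀ i j, Gr 0 (F2yy i j)
  grF2xy : ∀ i j, Gr 0 (F2xy i j)
  grF3y : ∀ i, Gr 1 (F3y i)
  grF3yz : ∀ i j, Gr 0 (F3yz i j)
  md3 : MD F2 F3
  pdF1x : ∀ i, HasPD ((0, bas i), 0) F1 (F1x i)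
  pdF1xx : ∀ i j, HasPD ((0, bas i), 0) (F1x j) (F1xx i j)
  pdF2x : ∀ i, HasPD (((0, bas i), 0), 0) F2 (F2x i)
  pdF2y : ∀ i, HasPD ((0, bas i), 0) F2 (F2y i)
  pdF2yy : ∀ i j, HasPD ((0, bas i), 0) (F2y j) (F2yy i j)
  pdF2xy : ∀ i j, HasPD (((0, bas i), 0), 0) (F2y j) (F2xy i j)
  pdF3y : ∀ i, HasPD (((0, bas i), 0), 0) F3 (F3y i)
  pdF3z : ∀ i, HasPD ((0, bas i), 0) F3 (F3z i)
  pdF3yz : ∀ i j, HasPD (((0, bas i), 0), 0) (F3z j) (F3yz i j)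

/-! ### Derivatives of the value function in the remaining slots, by symmetry. -/

namespace VJet

variable {F : TX n → P2 n → ℝ} (J : VJet F)

lemma symm2 (a : (TX n × Eu n) × Eu n) (μ : P2 n) :
    J.F2 a μ = J.F2 (swapLast a) μ + J.F1 a.1 μ - J.F1 (a.1.1, a.2) μ :=
  MD.symm J.md1 J.md2 J.gr1 J.gr2 a.1.1 a.1.2 a.2 μ

/-- The symmetry rule turns the derivative in the last slot of `δ_{μμ} F` into one in the first
slot, for which growth bounds are assumed. The same device gives `Fzz` and `F2xz`. -/
lemma Fz_eq (j : Fin n) :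
    J.Fz j = fun a μ => J.F2y j (swapLast a) μ - J.Fy j (a.1.1, a.2) μ := by
  have h1 := ((HasPD.comp (v := ((0 : TX n × Eu n), (bas j : Eu n))) lin_swapLast
    (J.pdF2y j)).add (HasPD.of_const (F := J.F1) (v := ((0 : TX n × Eu n), (bas j : Eu n)))
      lin_fst rfl)).sub
    (HasPD.comp (v := ((0 : TX n × Eu n), (bas j : Eu n))) lin_skip (J.pdy j))
  have e : J.F2 = fun a μ => J.F2 (swapLast a) μ + J.F1 a.1 μ - J.F1 (a.1.1, a.2) μ := by
    funext a μ; exact J.symm2 a μ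
  rw [← e] at h1
  simpa only [add_zero] using HasPD.unique (J.pdz j) h1

lemma grFz (j : Fin n) : Gr 1 (J.Fz j) := by
  rw [J.Fz_eq]
  exact ((J.grF2y j).comp lin_swapLast).sub ((J.gry j).comp lin_skip)

/-- The derivatives are assumed in one order only; continuity of the mixed derivative gives the
other order. -/
lemma pdF1yx (i j : Fin n) : HasPD (0, bas i) (J.F1x j) (J.Fxy j i) :=
  (J.pdy i).swap (J.pdxy j i) (J.pdF1x j) (J.grxy j i).1

/-- The derivative `∂_{z_i} ∂_{z_j} δ_{μμ} F`. -/
def Fzz (i j : Fin n) : (TX n × Eu n) × Eu n → P2 n → ℝ :=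
  fun a μ => J.F2yy i j (swapLast a) μ - J.Fyy i j (a.1.1, a.2) μ

lemma pdFzz (i j : Fin n) : HasPD (0, bas i) (J.Fz j) (J.Fzz i j) := by
  rw [J.Fz_eq]
  exact (HasPD.comp (v := ((0 : TX n × Eu n), (bas i : Eu n))) lin_swapLast (J.pdF2yy i j)).sub
    (HasPD.comp (v := ((0 : TX n × Eu n), (bas i : Eu n))) lin_skip (J.pdyy i j))

lemma grFzz (i j : Fin n) : Gr 0 (J.Fzz i j) :=
  ((J.grF2yy i j).comp lin_swapLast).sub ((J.gryy i j).comp lin_skip)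

/-- The derivative `∂_{x_i} ∂_{z_j} δ_{μμ} F`. -/
def F2xz (i j : Fin n) : (TX n × Eu n) × Eu n → P2 n → ℝ :=
  fun a μ => J.F2xy i j (swapLast a) μ - J.Fxy i j (a.1.1, a.2) μ

lemma pdF2xz (i j : Fin n) : HasPD (((0, bas i), 0), 0) (J.Fz j) (J.F2xz i j) := by
  rw [J.Fz_eq]
  exact (HasPD.comp (v := ((((0, bas i) : TX n), (0 : Eu n)), (0 : Eu n))) lin_swapLast
    (J.pdF2xy i j)).sub
    (HasPD.comp (v := ((((0, bas i) : TX n), (0 : Eu n)), (0 : Eu n))) lin_skip (J.pdxy i j))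

lemma grF2xz (i j : Fin n) : Gr 0 (J.F2xz i j) :=
  ((J.grF2xy i j).comp lin_swapLast).sub ((J.grxy i j).comp lin_skip)

lemma pdF2zx (i j : Fin n) : HasPD (0, bas i) (J.F2x j) (J.F2xz j i) :=
  (J.pdz i).swap (J.pdF2xz j i) (J.pdF2x j) (J.grF2xz j i).1

lemma pdF2zy (i j : Fin n) : HasPD (0, bas i) (J.F2y j) (J.Fyz j i) :=
  (J.pdz i).swap (J.pdyz j i) (J.pdF2y j) (J.gryz j i).1

/-- `(x, y, z, w) ↦ (x, z, y, w)`. -/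
def swapMid (a : ((TX n × Eu n) × Eu n) × Eu n) : ((TX n × Eu n) × Eu n) × Eu n :=
  (swapLast a.1, a.2)

lemma lin_swapMid : Lin (swapMid (n := n)) :=
  ⟨fun _ _ _ => rfl, by unfold swapMid swapLast; fun_prop⟩

/-- `(x, y, z, w) ↦ (x, y, w)`. -/
lemma lin_ytw : Lin (fun a : ((TX n × Eu n) × Eu n) × Eu n => ((a.1.1.1, a.1.1.2), a.2)) :=
  ⟨fun _ _ _ => rfl, by fun_prop⟩

/-- `(x, y, z, w) ↦ (x, z, w)`. -/
lemma lin_ztw : Lin (fun a : ((TX n × Eu n) × Eu n) × Eu n => ((a.1.1.1, a.1.2), a.2)) :=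
  ⟨fun _ _ _ => rfl, by fun_prop⟩

/-- `(x, y, z, w) ↦ (x, z, y)`. -/
lemma lin_zty : Lin (fun a : ((TX n × Eu n) × Eu n) × Eu n => ((a.1.1.1, a.1.2), a.1.1.2)) :=
  ⟨fun _ _ _ => rfl, by fun_prop⟩

/-- The rule for `δ_{μμ}`, differentiated once more in the measure, exchanges the first two slots of
`δ_{μμμ}`. -/
lemma symm3_first (a : ((TX n × Eu n) × Eu n) × Eu n) (μ : P2 n) :
    J.F3 a μ = J.F3 (swapMid a) μ + J.F2 ((a.1.1.1, a.1.1.2), a.2) μ -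
      J.F2 ((a.1.1.1, a.1.2), a.2) μ := by
  have h1 := ((J.md3.comp swapLast).add (J.md2.comp Prod.fst)).sub
    (J.md2.comp (fun a : (TX n × Eu n) × Eu n => (a.1.1, a.2)))
  have e : J.F2 = fun a μ => J.F2 (swapLast a) μ + J.F1 a.1 μ - J.F1 (a.1.1, a.2) μ := by
    funext a μ; exact J.symm2 a μ
  simp only [← e] at h1
  exact J.md3.unique h1 a μ

/-- The general rule applied to `δ_μ F`, whose first measure slot is treated as a parameter,
exchanges the last two slots. -/
lemma symm3_last (a : ((TX n × Eu n) × Eu n) × Eu n) (μ : P2 n) :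
    J.F3 a μ = J.F3 (swapLast a) μ + J.F2 a.1 μ - J.F2 (a.1.1, a.2) μ :=
  MD.symm J.md2 J.md3 J.gr2 J.gr3 a.1.1 a.1.2 a.2 μ

/-- Both exchanges together send `(y, z, w)` to `(z, w, y)`. Derivatives in `(z, w)` thus become
derivatives in the first two slots, the only pair for which a second derivative of `δ_{μμμ} F` is
assumed. -/
lemma symm3 (a : ((TX n × Eu n) × Eu n) × Eu n) (μ : P2 n) :
    J.F3 a μ = J.F3 (swapLast (swapMid a)) μ + J.F2 (swapLast a.1) μ
      + J.F2 ((a.1.1.1, a.1.1.2), a.2) μ - 2 * J.F2 ((a.1.1.1, a.1.2), a.2) μ := by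
  rw [J.symm3_first, J.symm3_last]
  simp only [swapMid, swapLast]
  ring

lemma F3z_eq (j : Fin n) : J.F3z j = fun a μ => J.F3y j (swapMid a) μ -
    J.F2y j ((a.1.1.1, a.1.2), a.2) μ := by
  have h1 := ((HasPD.comp (v := (((0 : TX n × Eu n), (bas j : Eu n)), (0 : Eu n))) lin_swapMid
      (J.pdF3y j)).add (HasPD.of_const (F := J.F2)
        (v := (((0 : TX n × Eu n), (bas j : Eu n)), (0 : Eu n))) lin_ytw rfl)).sub
    (HasPD.comp (v := (((0 : TX n × Eu n), (bas j : Eu n)), (0 : Eu n))) lin_ztw (J.pdF2y j))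
  have e : J.F3 = fun a μ => J.F3 (swapMid a) μ + J.F2 ((a.1.1.1, a.1.1.2), a.2) μ -
      J.F2 ((a.1.1.1, a.1.2), a.2) μ := by
    funext a μ; exact J.symm3_first a μ
  rw [← e] at h1
  simpa only [add_zero] using HasPD.unique (J.pdF3z j) h1

lemma grF3z (j : Fin n) : Gr 1 (J.F3z j) := by
  rw [J.F3z_eq]
  exact ((J.grF3y j).comp lin_swapMid).sub ((J.grF2y j).comp lin_ztw)

/-- The derivative `∂_{w_j} δ_{μμμ} F`. -/
def F3w (j : Fin n) : ((TX n × Eu n) × Eu n) × Eu n → P2 n → ℝ :=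
  fun a μ => J.F3z j (swapLast (swapMid a)) μ + J.Fz j ((a.1.1.1, a.1.1.2), a.2) μ -
    2 * J.Fz j ((a.1.1.1, a.1.2), a.2) μ

/-- The derivative `∂_{z_i} ∂_{w_j} δ_{μμμ} F`. -/
def F3zw (i j : Fin n) : ((TX n × Eu n) × Eu n) × Eu n → P2 n → ℝ :=
  fun a μ => J.F3yz i j (swapLast (swapMid a)) μ - 2 * J.Fyz i j ((a.1.1.1, a.1.2), a.2) μ

lemma lin_cyc : Lin (fun a : ((TX n × Eu n) × Eu n) × Eu n => swapLast (swapMid a)) :=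
  ⟨fun _ _ _ => rfl, by unfold swapMid swapLast; fun_prop⟩

lemma pdF3w (j : Fin n) : HasPD (0, bas j) J.F3 (J.F3w j) := by
  have h1 := (((HasPD.comp (v := (((0 : (TX n × Eu n) × Eu n), (bas j : Eu n)))) lin_cyc
      (J.pdF3z j)).add (HasPD.of_const (F := J.F2)
        (v := (((0 : (TX n × Eu n) × Eu n), (bas j : Eu n)))) lin_zty rfl)).add
    (HasPD.comp (v := (((0 : (TX n × Eu n) × Eu n), (bas j : Eu n)))) lin_ytw (J.pdz j))).sub
    (HasPD.const_mul (HasPD.comp (v := (((0 : (TX n × Eu n) × Eu n), (bas j : Eu n)))) lin_ztw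
      (J.pdz j)) 2)
  have e : J.F3 = fun a μ => J.F3 (swapLast (swapMid a)) μ + J.F2 ((a.1.1.1, a.1.2), a.1.1.2) μ
      + J.F2 ((a.1.1.1, a.1.1.2), a.2) μ - 2 * J.F2 ((a.1.1.1, a.1.2), a.2) μ := by
    funext a μ; exact J.symm3 a μ
  rw [← e] at h1
  simp only [add_zero] at h1
  exact h1

lemma grF3w (j : Fin n) : Gr 1 (J.F3w j) :=
  (((J.grF3z j).comp lin_cyc).add ((J.grFz j).comp lin_ytw)).sub
    (((J.grFz j).comp lin_ztw).const_mul 2)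

lemma pdF3zw (i j : Fin n) : HasPD ((0, bas i), 0) (J.F3w j) (J.F3zw i j) := by
  have h1 := ((HasPD.comp (v := (((0 : TX n × Eu n), (bas i : Eu n)), (0 : Eu n))) lin_cyc
      (J.pdF3yz i j)).add (HasPD.of_const (F := J.Fz j)
        (v := (((0 : TX n × Eu n), (bas i : Eu n)), (0 : Eu n))) lin_ytw rfl)).sub
    (HasPD.const_mul (HasPD.comp (v := (((0 : TX n × Eu n), (bas i : Eu n)), (0 : Eu n))) lin_ztw
      (J.pdyz i j)) 2)
  simp only [add_zero] at h1
  exact h1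

lemma grF3zw (i j : Fin n) : Gr 0 (J.F3zw i j) :=
  ((J.grF3yz i j).comp lin_cyc).sub (((J.gryz i j).comp lin_ztw).const_mul 2)

/-! ### The integrands -/

/-- `((t, x), y) ↦ ((t, y), x)`. -/
def exch (a : TX n × Eu n) : TX n × Eu n := ((a.1.1, a.2), a.1.2)

/-- `((t, x), y) ↦ ((t, y), y)`. -/
def diag (a : TX n × Eu n) : TX n × Eu n := ((a.1.1, a.2), a.2)

/-- `((t, x), y) ↦ (t, y)`. -/
def proj (a : TX n × Eu n) : TX n := (a.1.1, a.2)

lemma lin_exch : Lin (exch (n := n)) := ⟨fun _ _ _ => rfl, by unfold exch; fun_prop⟩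
lemma lin_diag : Lin (diag (n := n)) := ⟨fun _ _ _ => rfl, by unfold diag; fun_prop⟩
lemma lin_proj : Lin (proj (n := n)) := ⟨fun _ _ _ => rfl, by unfold proj; fun_prop⟩

/-- The integrand `δ_μ F(t, y, μ; x)`. -/
def preW : Pre (fun a μ => J.F1 (exch a) μ) where
  -- After the exchange, the slot named `x` in `Pre` is the first measure slot of `F`, and the
  -- averaged slot `y` is its state. So `kxz` is a derivative in two measure slots, whereas `kyz`
  -- involves the state.
  h1 := fun a μ => J.F2 (exch a.1, a.2) μ
  h2 := fun a μ => J.F3 ((exch a.1.1, a.1.2), a.2) μ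
  hx := fun i a μ => J.Fy i (exch a) μ
  hxx := fun i j a μ => J.Fyy i j (exch a) μ
  hy := fun i a μ => J.F1x i (exch a) μ
  hyy := fun i j a μ => J.F1xx i j (exch a) μ
  hxy := fun i j a μ => J.Fxy j i (exch a) μ
  kz := fun i a μ => J.Fz i (exch a.1, a.2) μ
  kzz := fun i j a μ => J.Fzz i j (exch a.1, a.2) μ
  kxz := fun i j a μ => J.Fyz i j (exch a.1, a.2) μ
  kyz := fun i j a μ => J.F2xz i j (exch a.1, a.2) μ
  ky := fun i a μ => J.F2x i (exch a.1, a.2) μ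
  kzy := fun i j a μ => J.F2xz j i (exch a.1, a.2) μ
  lw := fun i a μ => J.F3w i ((exch a.1.1, a.1.2), a.2) μ
  lzw := fun i j a μ => J.F3zw i j ((exch a.1.1, a.1.2), a.2) μ
  gr0 := J.gr1.comp lin_exch
  gr1 := J.gr2.comp lin_exch.map_fst
  gr2 := J.gr3.comp lin_exch.map_fst.map_fst
  grx := fun i => (J.gry i).comp lin_exch
  grxx := fun i j => (J.gryy i j).comp lin_exch
  gry := fun i => (J.grF1x i).comp lin_exch
  gryy := fun i j => (J.grF1xx i j).comp lin_exch
  grxy := fun i j => (J.grxy j i).comp lin_exch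
  grkz := fun i => (J.grFz i).comp lin_exch.map_fst
  grkzz := fun i j => (J.grFzz i j).comp lin_exch.map_fst
  grkxz := fun i j => (J.gryz i j).comp lin_exch.map_fst
  grkyz := fun i j => (J.grF2xz i j).comp lin_exch.map_fst
  grkzy := fun i j => (J.grF2xz j i).comp lin_exch.map_fst
  grlw := fun i => (J.grF3w i).comp lin_exch.map_fst.map_fst
  grlzw := fun i j => (J.grF3zw i j).comp lin_exch.map_fst.map_fst
  md1 := J.md2.comp exch
  md2 := J.md3.comp (fun a : (TX n × Eu n) × Eu n => (exch a.1, a.2))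
  pdx := fun i => HasPD.comp lin_exch (J.pdy i)
  pdxx := fun i j => HasPD.comp lin_exch (J.pdyy i j)
  pdy := fun i => HasPD.comp lin_exch (J.pdF1x i)
  pdyy := fun i j => HasPD.comp lin_exch (J.pdF1xx i j)
  pdxy := fun i j => HasPD.comp lin_exch (J.pdF1yx i j)
  pdkz := fun i => HasPD.comp lin_exch.map_fst (J.pdz i)
  pdkzz := fun i j => HasPD.comp lin_exch.map_fst (J.pdFzz i j)
  pdkxz := fun i j => HasPD.comp lin_exch.map_fst (J.pdyz i j)
  pdkyz := fun i j => HasPD.comp lin_exch.map_fst (J.pdF2xz i j)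
  pdky := fun i => HasPD.comp lin_exch.map_fst (J.pdF2x i)
  pdkzy := fun i j => HasPD.comp lin_exch.map_fst (J.pdF2zx i j)
  pdlw := fun i => HasPD.comp lin_exch.map_fst.map_fst (J.pdF3w i)
  pdlzw := fun i j => HasPD.comp lin_exch.map_fst.map_fst (J.pdF3zw i j)

/-- The chain rule along `y ↦ (y, y)`, whose direction is the sum of the two coordinate directions;
hence `HasPD.add_dir`. -/
lemma hasPD_diag {G Gx Gy : TX n × Eu n → P2 n → ℝ} {i : Fin n}
    (hx : HasPD ((0, bas i), 0) G Gx) (hy : HasPD (0, bas i) G Gy)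
    (hc : Continuous (fun a : (TX n × Eu n) × P2 n => Gy a.1 a.2)) :
    HasPD (0, bas i) (fun a μ => G (diag a) μ) (fun a μ => Gx (diag a) μ + Gy (diag a) μ) := by
  refine HasPD.comp (G := fun a μ => Gx a μ + Gy a μ) lin_diag ?_
  have := hx.add_dir hy hc
  simpa [diag] using this

lemma hasPD_diag' {G Gx Gy : (TX n × Eu n) × Eu n → P2 n → ℝ} {i : Fin n}
    (hx : HasPD (((0, bas i), 0), 0) G Gx) (hy : HasPD ((0, bas i), 0) G Gy)
    (hc : Continuous (fun a : ((TX n × Eu n) × Eu n) × P2 n => Gy a.1 a.2)) :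
    HasPD ((0, bas i), 0) (fun a μ => G (diag a.1, a.2) μ)
      (fun a μ => Gx (diag a.1, a.2) μ + Gy (diag a.1, a.2) μ) := by
  refine HasPD.comp (G := fun a μ => Gx a μ + Gy a μ) lin_diag.map_fst ?_
  have := hx.add_dir hy hc
  simpa [diag] using this

lemma pdyy_diag (i j : Fin n) : HasPD (0, bas i)
    (fun a μ => J.F1x j (diag a) μ + J.Fy j (diag a) μ)
    (fun a μ => J.F1xx i j (diag a) μ + J.Fxy j i (diag a) μ +
      (J.Fxy i j (diag a) μ + J.Fyy i j (diag a) μ)) := by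
  have h1 := hasPD_diag (J.pdF1xx i j) (J.pdF1yx i j) (J.grxy j i).1
  have h2 := hasPD_diag (J.pdxy i j) (J.pdyy i j) (J.gryy i j).1
  exact h1.add h2

/-- The integrand `δ_μ F(t, y, μ; y)`. -/
def preD : Pre (fun a μ => J.F1 (diag a) μ) where
  h1 := fun a μ => J.F2 (diag a.1, a.2) μ
  h2 := fun a μ => J.F3 ((diag a.1.1, a.1.2), a.2) μ
  hx := fun _ _ _ => 0
  hxx := fun _ _ _ _ => 0
  hy := fun i a μ => J.F1x i (diag a) μ + J.Fy i (diag a) μ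
  -- The Hessian along the diagonal contains both cross derivatives. These are the origin of the
  -- `Σ`-term of the final equation.
  hyy := fun i j a μ => J.F1xx i j (diag a) μ + J.Fxy j i (diag a) μ +
    (J.Fxy i j (diag a) μ + J.Fyy i j (diag a) μ)
  hxy := fun _ _ _ _ => 0
  kz := fun i a μ => J.Fz i (diag a.1, a.2) μ
  kzz := fun i j a μ => J.Fzz i j (diag a.1, a.2) μ
  kxz := fun _ _ _ _ => 0
  kyz := fun i j a μ => J.F2xz i j (diag a.1, a.2) μ + J.Fyz i j (diag a.1, a.2) μ
  ky := fun i a μ => J.F2x i (diag a.1, a.2) μ + J.F2y i (diag a.1, a.2) μ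
  kzy := fun i j a μ => J.F2xz j i (diag a.1, a.2) μ + J.Fyz j i (diag a.1, a.2) μ
  lw := fun i a μ => J.F3w i ((diag a.1.1, a.1.2), a.2) μ
  lzw := fun i j a μ => J.F3zw i j ((diag a.1.1, a.1.2), a.2) μ
  gr0 := J.gr1.comp lin_diag
  gr1 := J.gr2.comp lin_diag.map_fst
  gr2 := J.gr3.comp lin_diag.map_fst.map_fst
  grx := fun _ => (Gr.const 0).mono (by norm_num)
  grxx := fun _ _ => Gr.const 0
  gry := fun i => ((J.grF1x i).comp lin_diag).add ((J.gry i).comp lin_diag)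
  gryy := fun i j => (((J.grF1xx i j).comp lin_diag).add ((J.grxy j i).comp lin_diag)).add
    (((J.grxy i j).comp lin_diag).add ((J.gryy i j).comp lin_diag))
  grxy := fun _ _ => Gr.const 0
  grkz := fun i => (J.grFz i).comp lin_diag.map_fst
  grkzz := fun i j => (J.grFzz i j).comp lin_diag.map_fst
  grkxz := fun _ _ => Gr.const 0
  grkyz := fun i j => ((J.grF2xz i j).comp lin_diag.map_fst).add
    ((J.gryz i j).comp lin_diag.map_fst)
  grkzy := fun i j => ((J.grF2xz j i).comp lin_diag.map_fst).add
    ((J.gryz j i).comp lin_diag.map_fst)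
  grlw := fun i => (J.grF3w i).comp lin_diag.map_fst.map_fst
  grlzw := fun i j => (J.grF3zw i j).comp lin_diag.map_fst.map_fst
  md1 := J.md2.comp diag
  md2 := J.md3.comp (fun a : (TX n × Eu n) × Eu n => (diag a.1, a.2))
  pdx := fun i => HasPD.of_const lin_diag rfl
  pdxx := fun i j => HasPD.of_const (F := fun _ _ => 0) lin_diag rfl
  pdy := fun i => hasPD_diag (J.pdF1x i) (J.pdy i) (J.gry i).1
  pdyy := J.pdyy_diag
  pdxy := fun i j => HasPD.of_const (F := fun a μ => J.F1x j a μ + J.Fy j a μ) lin_diag rfl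
  pdkz := fun i => HasPD.comp lin_diag.map_fst (J.pdz i)
  pdkzz := fun i j => HasPD.comp lin_diag.map_fst (J.pdFzz i j)
  pdkxz := fun i j => HasPD.of_const lin_diag.map_fst rfl
  pdkyz := fun i j => hasPD_diag' (J.pdF2xz i j) (J.pdyz i j) (J.gryz i j).1
  pdky := fun i => hasPD_diag' (J.pdF2x i) (J.pdF2y i) (J.grF2y i).1
  pdkzy := fun i j => (HasPD.comp lin_diag.map_fst (J.pdF2zx i j)).add
    (HasPD.comp lin_diag.map_fst (J.pdF2zy i j))
  pdlw := fun i => HasPD.comp lin_diag.map_fst.map_fst (J.pdF3w i)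
  pdlzw := fun i j => HasPD.comp lin_diag.map_fst.map_fst (J.pdF3zw i j)

/-- The integrand `F(t, y, μ)`. -/
def preU : Pre (fun a μ => F (proj a) μ) where
  h1 := fun a μ => J.F1 (proj a.1, a.2) μ
  h2 := fun a μ => J.F2 ((proj a.1.1, a.1.2), a.2) μ
  hx := fun _ _ _ => 0
  hxx := fun _ _ _ _ => 0
  hy := fun i a μ => J.Fx i (proj a) μ
  hyy := fun i j a μ => J.Fxx i j (proj a) μ
  hxy := fun _ _ _ _ => 0
  kz := fun i a μ => J.Fy i (proj a.1, a.2) μ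
  kzz := fun i j a μ => J.Fyy i j (proj a.1, a.2) μ
  kxz := fun _ _ _ _ => 0
  kyz := fun i j a μ => J.Fxy i j (proj a.1, a.2) μ
  ky := fun i a μ => J.F1x i (proj a.1, a.2) μ
  kzy := fun i j a μ => J.Fxy j i (proj a.1, a.2) μ
  lw := fun i a μ => J.Fz i ((proj a.1.1, a.1.2), a.2) μ
  lzw := fun i j a μ => J.Fyz i j ((proj a.1.1, a.1.2), a.2) μ
  gr0 := J.gr0.comp lin_proj
  gr1 := J.gr1.comp lin_proj.map_fst
  gr2 := J.gr2.comp lin_proj.map_fst.map_fst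
  grx := fun _ => (Gr.const 0).mono (by norm_num)
  grxx := fun _ _ => Gr.const 0
  gry := fun i => (J.grx i).comp lin_proj
  gryy := fun i j => (J.grxx i j).comp lin_proj
  grxy := fun _ _ => Gr.const 0
  grkz := fun i => (J.gry i).comp lin_proj.map_fst
  grkzz := fun i j => (J.gryy i j).comp lin_proj.map_fst
  grkxz := fun _ _ => Gr.const 0
  grkyz := fun i j => (J.grxy i j).comp lin_proj.map_fst
  grkzy := fun i j => (J.grxy j i).comp lin_proj.map_fst
  grlw := fun i => (J.grFz i).comp lin_proj.map_fst.map_fst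
  grlzw := fun i j => (J.gryz i j).comp lin_proj.map_fst.map_fst
  md1 := J.md1.comp proj
  md2 := J.md2.comp (fun a : (TX n × Eu n) × Eu n => (proj a.1, a.2))
  pdx := fun i => HasPD.of_const lin_proj rfl
  pdxx := fun i j => HasPD.of_const (F := fun _ _ => 0) lin_proj rfl
  pdy := fun i => HasPD.comp lin_proj (J.pdx i)
  pdyy := fun i j => HasPD.comp lin_proj (J.pdxx i j)
  pdxy := fun i j => HasPD.of_const lin_proj rfl
  pdkz := fun i => HasPD.comp lin_proj.map_fst (J.pdy i)
  pdkzz := fun i j => HasPD.comp lin_proj.map_fst (J.pdyy i j)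
  pdkxz := fun i j => HasPD.of_const lin_proj.map_fst rfl
  pdkyz := fun i j => HasPD.comp lin_proj.map_fst (J.pdxy i j)
  pdky := fun i => HasPD.comp lin_proj.map_fst (J.pdF1x i)
  pdkzy := fun i j => HasPD.comp lin_proj.map_fst (J.pdF1yx i j)
  pdlw := fun i => HasPD.comp lin_proj.map_fst.map_fst (J.pdz i)
  pdlzw := fun i j => HasPD.comp lin_proj.map_fst.map_fst (J.pdyz i j)

end VJet
end SocialMFC

namespace SocialMFC
variable {n : ℕ}

/-! ### Regularity data from the assumptions -/

/-- Clamping of the time to `[0,T]`. -/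
def tc (T t : ℝ) : ℝ := max 0 (min T t)

lemma tc_mem {T : ℝ} (hT : 0 ≤ T) (t : ℝ) : tc T t ∈ Icc 0 T :=
  ⟨le_max_left _ _, max_le hT (min_le_left _ _)⟩

lemma tc_of_mem {T t : ℝ} (ht : t ∈ Icc 0 T) : tc T t = t := by
  rw [tc, min_eq_right ht.2, max_eq_right ht.1]

lemma continuous_tc (T : ℝ) : Continuous (tc T) := by unfold tc; fun_prop

/-- Clamping retracts the time axis onto `[0,T]`, so continuity on the slab becomes the global
continuity demanded by `Gr`. -/
lemma JointCont.continuous {α β : Type*} [TopologicalSpace α] [TopologicalSpace β] {T : ℝ}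
    (hT : 0 ≤ T) {G : ℝ → α → β} (h : JointCont T G) :
    Continuous (fun q : ℝ × α => G (tc T q.1) q.2) := by
  have := continuous_tc T
  exact continuousOn_univ.1 (h.comp (f := fun q : ℝ × α => (tc T q.1, q.2))
    (by fun_prop) fun q _ => ⟨tc_mem hT _, mem_univ _⟩)

lemma jointCont_of_continuous {α β : Type*} [TopologicalSpace α] [TopologicalSpace β] {T : ℝ}
    {G G' : ℝ → α → β} (h : Continuous (fun q : ℝ × α => G' q.1 q.2))
    (e : ∀ t ∈ Icc 0 T, ∀ a, G t a = G' t a) : JointCont T G :=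
  h.continuousOn.congr fun q hq => e q.1 hq.1 q.2

lemma abs_le_frob (A : Matrix (Fin n) (Fin n) ℝ) (i j : Fin n) : |A i j| ≤ frob A := by
  refine Real.abs_le_sqrt ?_
  calc A i j ^ 2 ≤ ∑ j, A i j ^ 2 :=
        Finset.single_le_sum (f := fun j => A i j ^ 2) (fun _ _ => sq_nonneg _) (Finset.mem_univ j)
    _ ≤ ∑ i, ∑ j, A i j ^ 2 :=
        Finset.single_le_sum (f := fun i => ∑ j, A i j ^ 2)
          (fun _ _ => Finset.sum_nonneg fun _ _ => sq_nonneg _) (Finset.mem_univ i)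

lemma abs_pd_le (ψ : Eu n → ℝ) (x : Eu n) (i : Fin n) : |pd i ψ x| ≤ ‖grad ψ x‖ :=
  PiLp.norm_apply_le (grad ψ x) i

section Growth

variable {X : Type*} [NormedAddCommGroup X] [NormedSpace ℝ X] {F : X → P2 n → ℝ}

/-- The factor `4` allows for up to four slots, each bounded by the norm of the whole argument;
`gr_one` is the linear counterpart. -/
lemma gr_two (hc : Continuous (fun a : X × P2 n => F a.1 a.2)) {C : ℝ} {m : P2 n → ℝ}
    (hm : Continuous m) (hm0 : ∀ μ, 0 ≤ m μ) (s : X → ℝ) (hs0 : ∀ x, 0 ≤ s x)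
    (hs : ∀ x, s x ≤ 4 * ‖x‖ ^ 2) (h : ∀ x μ, |F x μ| ≤ C * (1 + s x + m μ)) : Gr 2 F := by
  refine ⟨hc, fun μ => |C| * 4 * (1 + m μ), by fun_prop, fun x μ => (h x μ).trans ?_⟩
  have h1 := hm0 μ
  have h2 := hs0 x
  calc C * (1 + s x + m μ) ≤ |C| * (1 + s x + m μ) :=
        mul_le_mul_of_nonneg_right (le_abs_self C) (by positivity)
    _ ≤ |C| * (4 * (1 + m μ) * (1 + ‖x‖) ^ 2) := by
        refine mul_le_mul_of_nonneg_left ?_ (abs_nonneg C)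
        nlinarith [hs x, norm_nonneg x, mul_nonneg h1 (norm_nonneg x),
          mul_nonneg h1 (sq_nonneg ‖x‖)]
    _ = _ := by ring

lemma gr_one (hc : Continuous (fun a : X × P2 n => F a.1 a.2)) {C : ℝ} {m : P2 n → ℝ}
    (hm : Continuous m) (hm0 : ∀ μ, 0 ≤ m μ) (s : X → ℝ) (hs0 : ∀ x, 0 ≤ s x)
    (hs : ∀ x, s x ≤ 4 * ‖x‖) (h : ∀ x μ, |F x μ| ≤ C * (1 + s x + m μ)) : Gr 1 F := by
  refine ⟨hc, fun μ => |C| * 4 * (1 + m μ), by fun_prop, fun x μ => (h x μ).trans ?_⟩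
  have h1 := hm0 μ
  have h2 := hs0 x
  calc C * (1 + s x + m μ) ≤ |C| * (1 + s x + m μ) :=
        mul_le_mul_of_nonneg_right (le_abs_self C) (by positivity)
    _ ≤ |C| * (4 * (1 + m μ) * (1 + ‖x‖) ^ 1) := by
        refine mul_le_mul_of_nonneg_left ?_ (abs_nonneg C)
        nlinarith [hs x, norm_nonneg x, mul_nonneg h1 (norm_nonneg x)]
    _ = _ := by ring

lemma gr_zero (hc : Continuous (fun a : X × P2 n => F a.1 a.2)) {C : ℝ}
    (h : ∀ x μ, |F x μ| ≤ C) : Gr 0 F :=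
  ⟨hc, fun _ => C, continuous_const, fun x μ => by simpa using h x μ⟩

lemma norm_le_1 (a : TX n × Eu n) : ‖a.1.2‖ ≤ ‖a‖ ∧ ‖a.2‖ ≤ ‖a‖ :=
  ⟨(norm_snd_le a.1).trans (norm_fst_le a), norm_snd_le a⟩

lemma norm_le_2 (a : (TX n × Eu n) × Eu n) : ‖a.1.1.2‖ ≤ ‖a‖ ∧ ‖a.1.2‖ ≤ ‖a‖ ∧ ‖a.2‖ ≤ ‖a‖ :=
  ⟨(norm_le_1 a.1).1.trans (norm_fst_le a), (norm_le_1 a.1).2.trans (norm_fst_le a),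
    norm_snd_le a⟩

lemma norm_le_3 (a : ((TX n × Eu n) × Eu n) × Eu n) :
    ‖a.1.1.1.2‖ ≤ ‖a‖ ∧ ‖a.1.1.2‖ ≤ ‖a‖ ∧ ‖a.1.2‖ ≤ ‖a‖ ∧ ‖a.2‖ ≤ ‖a‖ :=
  ⟨(norm_le_2 a.1).1.trans (norm_fst_le a), (norm_le_2 a.1).2.1.trans (norm_fst_le a),
    (norm_le_2 a.1).2.2.trans (norm_fst_le a), norm_snd_le a⟩

lemma sq_norm_le {x : Eu n} {r : ℝ} (h : ‖x‖ ≤ r) : ‖x‖ ^ 2 ≤ r ^ 2 :=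
  pow_le_pow_left₀ (norm_nonneg _) h 2

lemma continuous_m1_sq : Continuous (fun μ : P2 n => μ.m1 ^ 2) := P2.continuous_m1.pow 2

lemma m1_sq_nonneg (μ : P2 n) : 0 ≤ μ.m1 ^ 2 := sq_nonneg _

end Growth

/-- The function `V` with clamped time. -/
def ext (T : ℝ) (V : ℝ → Eu n → P2 n → ℝ) : TX n → P2 n → ℝ := fun a μ => V (tc T a.1) a.2 μ

lemma continuous_entry {α : Type*} [TopologicalSpace α] {A : α → Matrix (Fin n) (Fin n) ℝ}
    (h : Continuous A) (i j : Fin n) : Continuous fun a => A a i j := h.matrix_elem i j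

lemma continuous_coord {α : Type*} [TopologicalSpace α] {A : α → Eu n}
    (h : Continuous A) (i : Fin n) : Continuous fun a => A a i :=
  (EuclideanSpace.proj (𝕜 := ℝ) i).continuous.comp h

variable {T : ℝ} {V : ℝ → Eu n → P2 n → ℝ}

/-- The regularity data of `V`. -/
def MasterRegular.jet (hT : 0 ≤ T) (hr : MasterRegular T V) (hg : MasterGrowth T V)
    (hx : ∃ C : ℝ, ∀ t ∈ Icc 0 T, ∀ (x : Eu n) (μ : P2 n),
      ‖grad (fun x' => V t x' μ) x‖ ≤ C * (1 + ‖x‖ + μ.m1) ∧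
      frob (hess (fun x' => V t x' μ) x) ≤ C) : Jet (ext T V) where
  F1 := fun a μ => mderiv (V (tc T a.1.1) a.1.2) μ a.2
  F2 := fun a μ => mderiv2 (V (tc T a.1.1.1) a.1.1.2) μ a.1.2 a.2
  Fx := fun i a μ => pd i (fun x => V (tc T a.1) x μ) a.2
  Fxx := fun i j a μ => pd i (pd j (fun x => V (tc T a.1) x μ)) a.2
  Fy := fun i a μ => pd i (mderiv (V (tc T a.1.1) a.1.2) μ) a.2
  Fyy := fun i j a μ => pd i (pd j (mderiv (V (tc T a.1.1) a.1.2) μ)) a.2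
  Fxy := fun i j a μ => pd i (fun x => pd j (mderiv (V (tc T a.1.1) x) μ) a.2) a.1.2
  Fz := fun j a μ => pd j (mderiv2 (V (tc T a.1.1.1) a.1.1.2) μ a.1.2) a.2
  Fyz := fun i j a μ => pd i (fun y => pd j (mderiv2 (V (tc T a.1.1.1) a.1.1.2) μ y) a.2) a.1.2
  cont := (hr.cont.continuous hT).comp (f := fun a : TX n × P2 n => (a.1.1, (a.1.2, a.2)))
    (by fun_prop)
  gr1 := by
    obtain ⟨C, hC⟩ := hg
    refine gr_two ((hr.cont_m.continuous hT).comp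
      (f := fun a : (TX n × Eu n) × P2 n => (a.1.1.1, (a.1.1.2, a.2, a.1.2))) (by fun_prop))
      continuous_m1_sq m1_sq_nonneg (fun a => ‖a.1.2‖ ^ 2 + ‖a.2‖ ^ 2) (fun a => by positivity)
      (fun a => ?_) (fun a μ => ((hC _ (tc_mem hT _) a.1.2 μ a.2 0).1).trans_eq (by ring))
    have h1 := sq_norm_le (norm_le_1 a).1
    have h2 := sq_norm_le (norm_le_1 a).2
    have h3 := sq_nonneg ‖a‖
    linarith
  gr2 := by
    obtain ⟨C, hC⟩ := hg
    refine gr_two ((hr.cont_mm.continuous hT).comp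
      (f := fun a : ((TX n × Eu n) × Eu n) × P2 n =>
        (a.1.1.1.1, (a.1.1.1.2, a.2, a.1.1.2, a.1.2))) (by fun_prop))
      continuous_m1_sq m1_sq_nonneg (fun a => ‖a.1.1.2‖ ^ 2 + ‖a.1.2‖ ^ 2 + ‖a.2‖ ^ 2)
      (fun a => by positivity) (fun a => ?_)
      (fun a μ => ((hC _ (tc_mem hT _) a.1.1.2 μ a.1.2 a.2).2.1).trans_eq (by ring))
    have h1 := sq_norm_le (norm_le_2 a).1
    have h2 := sq_norm_le (norm_le_2 a).2.1
    have h3 := sq_norm_le (norm_le_2 a).2.2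
    have h4 := sq_nonneg ‖a‖
    linarith
  grx := fun i => by
    obtain ⟨C, hC⟩ := hx
    refine gr_one (continuous_coord ((hr.cont_x.continuous hT).comp
      (f := fun a : TX n × P2 n => (a.1.1, (a.1.2, a.2))) (by fun_prop)) i)
      P2.continuous_m1 P2.m1_nonneg (fun a => ‖a.2‖) (fun a => by positivity)
      (fun a => ?_) (fun a μ => (abs_pd_le _ _ _).trans (hC _ (tc_mem hT _) a.2 μ).1)
    have h1 := norm_snd_le a
    linarith [norm_nonneg a]
  grxx := fun i j => by
    obtain ⟨C, hC⟩ := hx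
    exact gr_zero (continuous_entry ((hr.cont_xx.continuous hT).comp
      (f := fun a : TX n × P2 n => (a.1.1, (a.1.2, a.2))) (by fun_prop)) i j)
      (fun a μ => (abs_le_frob _ i j).trans (hC _ (tc_mem hT _) a.2 μ).2)
  gry := fun i => by
    obtain ⟨C, hC⟩ := hg
    refine gr_one (continuous_coord ((hr.cont_y_m.continuous hT).comp
      (f := fun a : (TX n × Eu n) × P2 n => (a.1.1.1, (a.1.1.2, a.2, a.1.2))) (by fun_prop)) i)
      P2.continuous_m1 P2.m1_nonneg (fun a => ‖a.1.2‖ + ‖a.2‖) (fun a => by positivity)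
      (fun a => ?_) (fun a μ => ((abs_pd_le _ _ _).trans
        (hC _ (tc_mem hT _) a.1.2 μ a.2 0).2.2.1).trans_eq (by ring))
    have h1 := (norm_le_1 a).1
    have h2 := (norm_le_1 a).2
    linarith [norm_nonneg a]
  gryy := fun i j => by
    obtain ⟨C, hC⟩ := hg
    exact gr_zero (continuous_entry ((hr.cont_yy_m.continuous hT).comp
      (f := fun a : (TX n × Eu n) × P2 n => (a.1.1.1, (a.1.1.2, a.2, a.1.2))) (by fun_prop)) i j)
      (fun a μ => (abs_le_frob _ i j).trans (hC _ (tc_mem hT _) a.1.2 μ a.2 0).2.2.2.1)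
  grxy := fun i j => by
    obtain ⟨C, hC⟩ := hg
    exact gr_zero (continuous_entry ((hr.cont_xy_m.continuous hT).comp
      (f := fun a : (TX n × Eu n) × P2 n => (a.1.1.1, (a.1.1.2, a.2, a.1.2))) (by fun_prop)) i j)
      (fun a μ => (abs_le_frob _ i j).trans (hC _ (tc_mem hT _) a.1.2 μ a.2 0).2.2.2.2.1)
  gryz := fun i j => by
    obtain ⟨C, hC⟩ := hg
    exact gr_zero (continuous_entry ((hr.cont_yz_mm.continuous hT).comp
      (f := fun a : ((TX n × Eu n) × Eu n) × P2 n =>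
        (a.1.1.1.1, (a.1.1.1.2, a.2, a.1.1.2, a.1.2))) (by fun_prop)) i j)
      (fun a μ => (abs_le_frob _ i j).trans (hC _ (tc_mem hT _) a.1.1.2 μ a.1.2 a.2).2.2.2.2.2)
  md1 := fun a μ => hasMDeriv_mderiv ((hr.mdiff _ (tc_mem hT _) _).1 μ)
  md2 := fun a μ => hasMDeriv_mderiv ((hr.mdiff _ (tc_mem hT _) _).2 _ μ)
  pdx := fun i a μ => by
    have := ((hr.xdiff _ (tc_mem hT a.1) μ).1 a.2 i).hasLineDerivAt
    simpa [HasLineDerivAt, ext, pd] using this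
  pdxx := fun i j a μ => by
    have := ((hr.xdiff _ (tc_mem hT a.1) μ).2 j a.2 i).hasLineDerivAt
    simpa [HasLineDerivAt, pd] using this
  pdy := fun i a μ => by
    have := ((hr.ydiff _ (tc_mem hT a.1.1) a.1.2 μ).1 a.2 i).hasLineDerivAt
    simpa [HasLineDerivAt, pd] using this
  pdyy := fun i j a μ => by
    have := ((hr.ydiff _ (tc_mem hT a.1.1) a.1.2 μ).2 j a.2 i).hasLineDerivAt
    simpa [HasLineDerivAt, pd] using this
  pdxy := fun i j a μ => by
    have := ((hr.xydiff _ (tc_mem hT a.1.1) μ).2 a.2 j a.1.2 i).hasLineDerivAt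
    simpa [HasLineDerivAt, pd] using this
  pdz := fun j a μ => by
    have := ((hr.yzdiff _ (tc_mem hT a.1.1.1) a.1.1.2 μ).1 a.1.2 a.2 j).hasLineDerivAt
    simpa [HasLineDerivAt, pd] using this
  pdyz := fun i j a μ => by
    have := ((hr.yzdiff _ (tc_mem hT a.1.1.1) a.1.1.2 μ).2 a.2 j a.1.2 i).hasLineDerivAt
    simpa [HasLineDerivAt, pd] using this

lemma ClassV.growth_x (h : ClassV T V) : ∃ C : ℝ, ∀ t ∈ Icc 0 T, ∀ (x : Eu n) (μ : P2 n),
    ‖grad (fun x' => V t x' μ) x‖ ≤ C * (1 + ‖x‖ + μ.m1) ∧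
    frob (hess (fun x' => V t x' μ) x) ≤ C := by
  obtain ⟨C, hC⟩ := h.growth'
  exact ⟨C, fun t ht x μ => ⟨(hC t ht x μ 0 0 0).2.1, (hC t ht x μ 0 0 0).2.2.1⟩⟩

/-- The regularity data of a function in the class `𝒞_V`. -/
def ClassV.vjet (hT : 0 ≤ T) (h : ClassV T V) : VJet (ext T V) where
  toJet := h.regular.jet hT h.growth h.growth_x
  F3 := fun a μ => mderiv3 (V (tc T a.1.1.1.1) a.1.1.1.2) μ a.1.1.2 a.1.2 a.2
  F1x := fun i a μ => pd i (fun x => mderiv (V (tc T a.1.1) x) μ a.2) a.1.2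
  F1xx := fun i j a μ => pd i (pd j (fun x => mderiv (V (tc T a.1.1) x) μ a.2)) a.1.2
  F2x := fun i a μ => pd i (fun x => mderiv2 (V (tc T a.1.1.1) x) μ a.1.2 a.2) a.1.1.2
  F2y := fun i a μ => pd i (fun y => mderiv2 (V (tc T a.1.1.1) a.1.1.2) μ y a.2) a.1.2
  F2yy := fun i j a μ => pd i (pd j (fun y => mderiv2 (V (tc T a.1.1.1) a.1.1.2) μ y a.2)) a.1.2
  F2xy := fun i j a μ =>
    pd i (fun x => pd j (fun y => mderiv2 (V (tc T a.1.1.1) x) μ y a.2) a.1.2) a.1.1.2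
  F3y := fun i a μ => pd i (fun y => mderiv3 (V (tc T a.1.1.1.1) a.1.1.1.2) μ y a.1.2 a.2) a.1.1.2
  F3z := fun i a μ => pd i (fun z => mderiv3 (V (tc T a.1.1.1.1) a.1.1.1.2) μ a.1.1.2 z a.2) a.1.2
  F3yz := fun i j a μ =>
    pd i (fun y => pd j (fun z => mderiv3 (V (tc T a.1.1.1.1) a.1.1.1.2) μ y z a.2) a.1.2) a.1.1.2
  gr0 := by
    obtain ⟨C, hC⟩ := h.growth'
    refine gr_two ((h.regular.cont.continuous hT).comp
      (f := fun a : TX n × P2 n => (a.1.1, (a.1.2, a.2))) (by fun_prop))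
      continuous_m1_sq m1_sq_nonneg (fun a => ‖a.2‖ ^ 2) (fun a => by positivity)
      (fun a => ?_) (fun a μ => (hC _ (tc_mem hT _) a.2 μ 0 0 0).1)
    have h1 := sq_norm_le (norm_snd_le a)
    linarith [sq_nonneg ‖a‖]
  gr3 := by
    obtain ⟨C, hC⟩ := h.growth'
    refine gr_two ((h.cont_mmm.continuous hT).comp
      (f := fun a : (((TX n × Eu n) × Eu n) × Eu n) × P2 n =>
        (a.1.1.1.1.1, (a.1.1.1.1.2, a.2, a.1.1.1.2, a.1.1.2, a.1.2))) (by fun_prop))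
      continuous_m1_sq m1_sq_nonneg
      (fun a => ‖a.1.1.1.2‖ ^ 2 + ‖a.1.1.2‖ ^ 2 + ‖a.1.2‖ ^ 2 + ‖a.2‖ ^ 2)
      (fun a => by positivity) (fun a => ?_)
      (fun a μ => ((hC _ (tc_mem hT _) a.1.1.1.2 μ a.1.1.2 a.1.2 a.2).2.2.2.2.2.2.2.2.2.1).trans_eq
        (by ring))
    have h1 := sq_norm_le (norm_le_3 a).1
    have h2 := sq_norm_le (norm_le_3 a).2.1
    have h3 := sq_norm_le (norm_le_3 a).2.2.1
    have h4 := sq_norm_le (norm_le_3 a).2.2.2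
    linarith
  grF1x := fun i => by
    obtain ⟨C, hC⟩ := h.growth'
    refine gr_one (continuous_coord ((h.cont_x_m.continuous hT).comp
      (f := fun a : (TX n × Eu n) × P2 n => (a.1.1.1, (a.1.1.2, a.2, a.1.2))) (by fun_prop)) i)
      P2.continuous_m1 P2.m1_nonneg (fun a => ‖a.1.2‖ + ‖a.2‖) (fun a => by positivity)
      (fun a => ?_) (fun a μ => ((abs_pd_le _ _ _).trans
        (hC _ (tc_mem hT _) a.1.2 μ a.2 0 0).2.2.2.2.1).trans_eq (by ring))
    have h1 := (norm_le_1 a).1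
    have h2 := (norm_le_1 a).2
    linarith [norm_nonneg a]
  grF1xx := fun i j => by
    obtain ⟨C, hC⟩ := h.growth'
    exact gr_zero (continuous_entry ((h.cont_xx_m.continuous hT).comp
      (f := fun a : (TX n × Eu n) × P2 n => (a.1.1.1, (a.1.1.2, a.2, a.1.2))) (by fun_prop)) i j)
      (fun a μ => (abs_le_frob _ i j).trans (hC _ (tc_mem hT _) a.1.2 μ a.2 0 0).2.2.2.2.2.1)
  grF2y := fun i => by
    obtain ⟨C, hC⟩ := h.growth'
    refine gr_one (continuous_coord ((h.cont_y_mm.continuous hT).comp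
      (f := fun a : ((TX n × Eu n) × Eu n) × P2 n =>
        (a.1.1.1.1, (a.1.1.1.2, a.2, a.1.1.2, a.1.2))) (by fun_prop)) i)
      P2.continuous_m1 P2.m1_nonneg (fun a => ‖a.1.1.2‖ + ‖a.1.2‖ + ‖a.2‖)
      (fun a => by positivity) (fun a => ?_) (fun a μ => ((abs_pd_le _ _ _).trans
        (hC _ (tc_mem hT _) a.1.1.2 μ a.1.2 a.2 0).2.2.2.2.2.2.1).trans_eq (by ring))
    have h1 := (norm_le_2 a).1
    have h2 := (norm_le_2 a).2.1
    have h3 := (norm_le_2 a).2.2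
    linarith [norm_nonneg a]
  grF2yy := fun i j => by
    obtain ⟨C, hC⟩ := h.growth'
    exact gr_zero (continuous_entry ((h.cont_yy_mm.continuous hT).comp
      (f := fun a : ((TX n × Eu n) × Eu n) × P2 n =>
        (a.1.1.1.1, (a.1.1.1.2, a.2, a.1.1.2, a.1.2))) (by fun_prop)) i j)
      (fun a μ => (abs_le_frob _ i j).trans
        (hC _ (tc_mem hT _) a.1.1.2 μ a.1.2 a.2 0).2.2.2.2.2.2.2.1)
  grF2xy := fun i j => by
    obtain ⟨C, hC⟩ := h.growth'
    exact gr_zero (continuous_entry ((h.cont_xy_mm.continuous hT).comp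
      (f := fun a : ((TX n × Eu n) × Eu n) × P2 n =>
        (a.1.1.1.1, (a.1.1.1.2, a.2, a.1.1.2, a.1.2))) (by fun_prop)) i j)
      (fun a μ => (abs_le_frob _ i j).trans
        (hC _ (tc_mem hT _) a.1.1.2 μ a.1.2 a.2 0).2.2.2.2.2.2.2.2.1)
  grF3y := fun i => by
    obtain ⟨C, hC⟩ := h.growth'
    refine gr_one (continuous_coord ((h.cont_y_mmm.continuous hT).comp
      (f := fun a : (((TX n × Eu n) × Eu n) × Eu n) × P2 n =>
        (a.1.1.1.1.1, (a.1.1.1.1.2, a.2, a.1.1.1.2, a.1.1.2, a.1.2))) (by fun_prop)) i)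
      P2.continuous_m1 P2.m1_nonneg (fun a => ‖a.1.1.1.2‖ + ‖a.1.1.2‖ + ‖a.1.2‖ + ‖a.2‖)
      (fun a => by positivity) (fun a => ?_) (fun a μ => ((abs_pd_le _ _ _).trans
        (hC _ (tc_mem hT _) a.1.1.1.2 μ a.1.1.2 a.1.2 a.2).2.2.2.2.2.2.2.2.2.2.1).trans_eq
        (by ring))
    have h1 := (norm_le_3 a).1
    have h2 := (norm_le_3 a).2.1
    have h3 := (norm_le_3 a).2.2.1
    have h4 := (norm_le_3 a).2.2.2
    linarith
  grF3yz := fun i j => by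
    obtain ⟨C, hC⟩ := h.growth'
    exact gr_zero (continuous_entry ((h.cont_yz_mmm.continuous hT).comp
      (f := fun a : (((TX n × Eu n) × Eu n) × Eu n) × P2 n =>
        (a.1.1.1.1.1, (a.1.1.1.1.2, a.2, a.1.1.1.2, a.1.1.2, a.1.2))) (by fun_prop)) i j)
      (fun a μ => (abs_le_frob _ i j).trans
        (hC _ (tc_mem hT _) a.1.1.1.2 μ a.1.1.2 a.1.2 a.2).2.2.2.2.2.2.2.2.2.2.2)
  md3 := fun a μ => hasMDeriv_mderiv ((h.mdiff3 _ (tc_mem hT _) _).2 _ _ μ)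
  pdF1x := fun i a μ => by
    have := ((h.x_m _ (tc_mem hT a.1.1) μ a.2).1 a.1.2 i).hasLineDerivAt
    simpa [HasLineDerivAt, pd, MasterRegular.jet] using this
  pdF1xx := fun i j a μ => by
    have := ((h.x_m _ (tc_mem hT a.1.1) μ a.2).2 j a.1.2 i).hasLineDerivAt
    simpa [HasLineDerivAt, pd] using this
  pdF2x := fun i a μ => by
    have := (h.x_mm _ (tc_mem hT a.1.1.1) μ a.1.2 a.2 a.1.1.2 i).hasLineDerivAt
    simpa [HasLineDerivAt, pd, MasterRegular.jet] using this
  pdF2y := fun i a μ => by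
    have := ((h.y_mm _ (tc_mem hT a.1.1.1) a.1.1.2 μ a.2).1 a.1.2 i).hasLineDerivAt
    simpa [HasLineDerivAt, pd, MasterRegular.jet] using this
  pdF2yy := fun i j a μ => by
    have := ((h.y_mm _ (tc_mem hT a.1.1.1) a.1.1.2 μ a.2).2 j a.1.2 i).hasLineDerivAt
    simpa [HasLineDerivAt, pd] using this
  pdF2xy := fun i j a μ => by
    have := ((h.xy_mm _ (tc_mem hT a.1.1.1) μ a.2).2 a.1.2 j a.1.1.2 i).hasLineDerivAt
    simpa [HasLineDerivAt, pd] using this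
  pdF3y := fun i a μ => by
    have := (h.y_mmm _ (tc_mem hT a.1.1.1.1) a.1.1.1.2 μ a.1.2 a.2 a.1.1.2 i).hasLineDerivAt
    simpa [HasLineDerivAt, pd] using this
  pdF3z := fun i a μ => by
    have := ((h.yz_mmm _ (tc_mem hT a.1.1.1.1) a.1.1.1.2 μ a.2).1 a.1.1.2 a.1.2 i).hasLineDerivAt
    simpa [HasLineDerivAt, pd] using this
  pdF3yz := fun i j a μ => by
    have := ((h.yz_mmm _ (tc_mem hT a.1.1.1.1) a.1.1.1.2 μ a.2).2 a.1.2 j a.1.1.2 i).hasLineDerivAt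
    simpa [HasLineDerivAt, pd] using this

/-- The regularity data of a function in the class `𝒞_M`. -/
def ClassM.jet {M : ℝ → P2 n → ℝ} (hT : 0 ≤ T) (h : ClassM T M) :
    Jet (fun a μ => M (tc T a.1) μ) where
  F1 := fun a μ => mderiv (M (tc T a.1.1)) μ a.2
  F2 := fun a μ => mderiv2 (M (tc T a.1.1.1)) μ a.1.2 a.2
  Fx := fun _ _ _ => 0
  Fxx := fun _ _ _ _ => 0
  Fy := fun i a μ => pd i (mderiv (M (tc T a.1.1)) μ) a.2
  Fyy := fun i j a μ => pd i (pd j (mderiv (M (tc T a.1.1)) μ)) a.2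
  Fxy := fun _ _ _ _ => 0
  Fz := fun j a μ => pd j (mderiv2 (M (tc T a.1.1.1)) μ a.1.2) a.2
  Fyz := fun i j a μ => pd i (fun y => pd j (mderiv2 (M (tc T a.1.1.1)) μ y) a.2) a.1.2
  cont := (h.cont.continuous hT).comp (f := fun a : TX n × P2 n => (a.1.1, a.2)) (by fun_prop)
  gr1 := by
    obtain ⟨C, hC⟩ := h.growth
    refine gr_two ((h.cont_m.continuous hT).comp
      (f := fun a : (TX n × Eu n) × P2 n => (a.1.1.1, (a.2, a.1.2))) (by fun_prop))
      P2.continuous_m2 P2.m2_nonneg (fun a => ‖a.2‖ ^ 2) (fun a => by positivity)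
      (fun a => ?_) (fun a μ => (hC _ (tc_mem hT _) μ a.2 0).1)
    have h2 := sq_norm_le (norm_le_1 a).2
    linarith [sq_nonneg ‖a‖]
  gr2 := by
    obtain ⟨C, hC⟩ := h.growth
    refine gr_two ((h.cont_mm.continuous hT).comp
      (f := fun a : ((TX n × Eu n) × Eu n) × P2 n => (a.1.1.1.1, (a.2, a.1.1.2, a.1.2)))
      (by fun_prop)) P2.continuous_m2 P2.m2_nonneg (fun a => ‖a.1.2‖ ^ 2 + ‖a.2‖ ^ 2)
      (fun a => by positivity) (fun a => ?_)
      (fun a μ => ((hC _ (tc_mem hT _) μ a.1.2 a.2).2.1).trans_eq (by ring))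
    have h2 := sq_norm_le (norm_le_2 a).2.1
    have h3 := sq_norm_le (norm_le_2 a).2.2
    linarith [sq_nonneg ‖a‖]
  grx := fun _ => (Gr.const 0).mono (by norm_num)
  grxx := fun _ _ => Gr.const 0
  gry := fun i => by
    obtain ⟨C, hC⟩ := h.growth
    refine gr_one (continuous_coord ((h.cont_y_m.continuous hT).comp
      (f := fun a : (TX n × Eu n) × P2 n => (a.1.1.1, (a.2, a.1.2))) (by fun_prop)) i)
      P2.continuous_m1 P2.m1_nonneg (fun a => ‖a.2‖) (fun a => by positivity)
      (fun a => ?_) (fun a μ => (abs_pd_le _ _ _).trans (hC _ (tc_mem hT _) μ a.2 0).2.2.1)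
    have h2 := (norm_le_1 a).2
    linarith [norm_nonneg a]
  gryy := fun i j => by
    obtain ⟨C, hC⟩ := h.growth
    exact gr_zero (continuous_entry ((h.cont_yy_m.continuous hT).comp
      (f := fun a : (TX n × Eu n) × P2 n => (a.1.1.1, (a.2, a.1.2))) (by fun_prop)) i j)
      (fun a μ => (abs_le_frob _ i j).trans (hC _ (tc_mem hT _) μ a.2 0).2.2.2.1)
  grxy := fun _ _ => Gr.const 0
  gryz := fun i j => by
    obtain ⟨C, hC⟩ := h.growth
    exact gr_zero (continuous_entry ((h.cont_yz_mm.continuous hT).comp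
      (f := fun a : ((TX n × Eu n) × Eu n) × P2 n => (a.1.1.1.1, (a.2, a.1.1.2, a.1.2)))
      (by fun_prop)) i j)
      (fun a μ => (abs_le_frob _ i j).trans (hC _ (tc_mem hT _) μ a.1.2 a.2).2.2.2.2)
  md1 := fun a μ => hasMDeriv_mderiv ((h.mdiff _ (tc_mem hT _)).1 μ)
  md2 := fun a μ => hasMDeriv_mderiv ((h.mdiff _ (tc_mem hT _)).2 _ μ)
  pdx := fun i => HasPD.of_const (F := fun t μ => M (tc T t) μ) lin_fst rfl
  pdxx := fun i j => HasPD.of_const (F := fun _ _ => 0) (lin_fst (X := ℝ) (Y := Eu n)) rfl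
  pdy := fun i a μ => by
    have := ((h.ydiff _ (tc_mem hT a.1.1) μ).1 a.2 i).hasLineDerivAt
    simpa [HasLineDerivAt, pd] using this
  pdyy := fun i j a μ => by
    have := ((h.ydiff _ (tc_mem hT a.1.1) μ).2 j a.2 i).hasLineDerivAt
    simpa [HasLineDerivAt, pd] using this
  pdxy := fun i j a μ => by
    simpa [HasLineDerivAt] using hasDerivAt_const _ _
  pdz := fun j a μ => by
    have := ((h.yzdiff _ (tc_mem hT a.1.1.1) μ).1 a.1.2 a.2 j).hasLineDerivAt
    simpa [HasLineDerivAt, pd] using this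
  pdyz := fun i j a μ => by
    have := ((h.yzdiff _ (tc_mem hT a.1.1.1) μ).2 a.2 j a.1.2 i).hasLineDerivAt
    simpa [HasLineDerivAt, pd] using this

end SocialMFC

namespace SocialMFC
variable {n : ℕ}

/-! ### From regularity data to the classical notions -/

section Slice

variable {X Y Z : Type*} [NormedAddCommGroup X] [NormedSpace ℝ X] [NormedAddCommGroup Y]
  [NormedSpace ℝ Y] [NormedAddCommGroup Z] [NormedSpace ℝ Z]

lemma HasPD.slice_snd {v : Y} {G Gv : X × Y → P2 n → ℝ} (h : HasPD (0, v) G Gv) (x : X) (y : Y)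
    (μ : P2 n) : HasLineDerivAt ℝ (fun y => G (x, y) μ) (Gv (x, y) μ) y v := by
  simpa [HasLineDerivAt] using h (x, y) μ

lemma HasPD.slice_mid {v : Y} {G Gv : (X × Y) × Z → P2 n → ℝ} (h : HasPD ((0, v), 0) G Gv)
    (x : X) (y : Y) (z : Z) (μ : P2 n) :
    HasLineDerivAt ℝ (fun y => G ((x, y), z) μ) (Gv ((x, y), z) μ) y v := by
  simpa [HasLineDerivAt] using h ((x, y), z) μ

end Slice

namespace Jet

variable {T : ℝ} {F : ℝ → Eu n → P2 n → ℝ} {F' : TX n → P2 n → ℝ} {t : ℝ}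

/-- The hypothesis `e` identifies `F` with its time-clamped version at the single time `t`. This is
enough here and in the lemmas that follow, as they differentiate only in space and measure. -/
lemma mderiv_eq (J : Jet F') (e : ∀ x, F t x = F' (t, x)) (x : Eu n) (μ : P2 n) :
    mderiv (F t x) μ = fun y => J.F1 ((t, x), y) μ := by
  rw [e]; exact J.md1.mderiv_eq _ _

lemma mderiv2_eq (J : Jet F') (e : ∀ x, F t x = F' (t, x)) (x : Eu n) (μ : P2 n) (y : Eu n) :
    mderiv2 (F t x) μ y = fun z => J.F2 (((t, x), y), z) μ := by
  funext z
  simp only [mderiv2, J.mderiv_eq e]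
  rw [J.md2.mderiv_eq ((t, x), y) μ]

lemma pd_x (J : Jet F') (e : ∀ x, F t x = F' (t, x)) (i : Fin n) (μ : P2 n) :
    pd i (fun x => F t x μ) = fun x => J.Fx i (t, x) μ := by
  funext x
  simp only [e]
  exact ((J.pdx i).slice_snd t x μ).lineDeriv

lemma pd_xx (J : Jet F') (e : ∀ x, F t x = F' (t, x)) (i j : Fin n) (x : Eu n) (μ : P2 n) :
    pd i (pd j (fun x => F t x μ)) x = J.Fxx i j (t, x) μ := by
  rw [J.pd_x e]
  exact ((J.pdxx i j).slice_snd t x μ).lineDeriv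

lemma pd_y (J : Jet F') (e : ∀ x, F t x = F' (t, x)) (i : Fin n) (x : Eu n) (μ : P2 n) :
    pd i (mderiv (F t x) μ) = fun y => J.Fy i ((t, x), y) μ := by
  funext y
  rw [J.mderiv_eq e]
  exact ((J.pdy i).slice_snd (t, x) y μ).lineDeriv

lemma pd_yy (J : Jet F') (e : ∀ x, F t x = F' (t, x)) (i j : Fin n)
    (x : Eu n) (μ : P2 n) (y : Eu n) :
    pd i (pd j (mderiv (F t x) μ)) y = J.Fyy i j ((t, x), y) μ := by
  rw [J.pd_y e]
  exact ((J.pdyy i j).slice_snd (t, x) y μ).lineDeriv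

lemma pd_xy (J : Jet F') (e : ∀ x, F t x = F' (t, x)) (i j : Fin n)
    (x : Eu n) (μ : P2 n) (y : Eu n) :
    pd i (fun x => pd j (mderiv (F t x) μ) y) x = J.Fxy i j ((t, x), y) μ := by
  simp only [J.pd_y e]
  exact ((J.pdxy i j).slice_mid t x y μ).lineDeriv

lemma pd_z (J : Jet F') (e : ∀ x, F t x = F' (t, x)) (j : Fin n) (x : Eu n) (μ : P2 n) (y : Eu n) :
    pd j (mderiv2 (F t x) μ y) = fun z => J.Fz j (((t, x), y), z) μ := by
  funext z
  rw [J.mderiv2_eq e]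
  exact ((J.pdz j).slice_snd ((t, x), y) z μ).lineDeriv

lemma pd_yz (J : Jet F') (e : ∀ x, F t x = F' (t, x)) (i j : Fin n)
    (x : Eu n) (μ : P2 n) (y z : Eu n) :
    pd i (fun y => pd j (mderiv2 (F t x) μ y) z) y = J.Fyz i j (((t, x), y), z) μ := by
  simp only [J.pd_z e]
  exact ((J.pdyz i j).slice_mid (t, x) y z μ).lineDeriv

lemma mdiff2 (J : Jet F') (e : ∀ x, F t x = F' (t, x)) (x : Eu n) : MDiff2 (F t x) := by
  refine ⟨fun μ => ?_, fun y μ => ?_⟩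
  · rw [e]; exact ⟨_, J.md1 _ _⟩
  · simp only [J.mderiv_eq e]; exact ⟨_, J.md2 _ _⟩

lemma pdiff2_y (J : Jet F') (e : ∀ x, F t x = F' (t, x)) (x : Eu n) (μ : P2 n) :
    PDiff2 (mderiv (F t x) μ) := by
  refine ⟨fun y i => ?_, fun j y i => ?_⟩
  · rw [J.mderiv_eq e]
    exact ((J.pdy i).slice_snd (t, x) y μ).lineDifferentiableAt
  · rw [J.pd_y e]
    exact ((J.pdyy i j).slice_snd (t, x) y μ).lineDifferentiableAt

lemma mixedDiff_yz (J : Jet F') (e : ∀ x, F t x = F' (t, x)) (x : Eu n) (μ : P2 n) :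
    MixedDiff (mderiv2 (F t x) μ) := by
  refine ⟨fun y z i => ?_, fun z j y i => ?_⟩
  · rw [J.mderiv2_eq e]
    exact ((J.pdz i).slice_snd ((t, x), y) z μ).lineDifferentiableAt
  · simp only [J.pd_z e]
    exact ((J.pdyz i j).slice_mid (t, x) y z μ).lineDifferentiableAt

lemma continuous_toLp {α : Type*} [TopologicalSpace α] {f : α → Fin n → ℝ}
    (h : ∀ i, Continuous fun a => f a i) : Continuous fun a => (WithLp.toLp 2 (f a) : Eu n) :=
  (PiLp.continuous_toLp 2 _).comp (continuous_pi h)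

/-- Regularity data and a continuous time derivative make a function regular. -/
lemma masterRegular (J : Jet F') (e : ∀ t ∈ Icc 0 T, ∀ x, F t x = F' (t, x))
    (ht : ∀ x μ, TDiff T (fun t => F t x μ))
    (hct : JointCont T (fun t (a : Eu n × P2 n) => dt T (fun s => F s a.1 a.2) t)) :
    MasterRegular T F where
  tdiff := ht
  xdiff := fun t ht μ => by
    refine ⟨fun x i => ?_, fun j x i => ?_⟩
    · simp only [e t ht]
      exact ((J.pdx i).slice_snd t x μ).lineDifferentiableAt
    · rw [J.pd_x (e t ht)]
      exact ((J.pdxx i j).slice_snd t x μ).lineDifferentiableAt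
  mdiff := fun t ht x => J.mdiff2 (e t ht) x
  ydiff := fun t ht x μ => J.pdiff2_y (e t ht) x μ
  xydiff := fun t ht μ => by
    refine ⟨fun x => (J.pdiff2_y (e t ht) x μ).1, fun y j x i => ?_⟩
    simp only [J.pd_y (e t ht)]
    exact ((J.pdxy i j).slice_mid t x y μ).lineDifferentiableAt
  yzdiff := fun t ht x μ => J.mixedDiff_yz (e t ht) x μ
  cont := jointCont_of_continuous (G' := fun t (a : Eu n × P2 n) => F' (t, a.1) a.2)
    (J.cont.comp (f := fun q : ℝ × Eu n × P2 n => ((q.1, q.2.1), q.2.2)) (by fun_prop))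
    fun t ht a => by rw [e t ht]
  cont_t := hct
  cont_x := jointCont_of_continuous
    (G' := fun t (a : Eu n × P2 n) => WithLp.toLp 2 fun i => J.Fx i (t, a.1) a.2)
    (continuous_toLp fun i => (J.grx i).1.comp
      (f := fun q : ℝ × Eu n × P2 n => ((q.1, q.2.1), q.2.2)) (by fun_prop))
    fun t ht a => by simp only [grad, J.pd_x (e t ht)]
  cont_xx := jointCont_of_continuous
    (G' := fun t (a : Eu n × P2 n) => Matrix.of fun i j => J.Fxx i j (t, a.1) a.2)
    (continuous_matrix fun i j => (J.grxx i j).1.comp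
      (f := fun q : ℝ × Eu n × P2 n => ((q.1, q.2.1), q.2.2)) (by fun_prop))
    fun t ht a => by simp only [hess, J.pd_xx (e t ht)]
  cont_m := jointCont_of_continuous
    (G' := fun t (a : Eu n × P2 n × Eu n) => J.F1 ((t, a.1), a.2.2) a.2.1)
    (J.gr1.1.comp (f := fun q : ℝ × Eu n × P2 n × Eu n => (((q.1, q.2.1), q.2.2.2), q.2.2.1))
      (by fun_prop))
    fun t ht a => by rw [J.mderiv_eq (e t ht)]
  cont_mm := jointCont_of_continuous
    (G' := fun t (a : Eu n × P2 n × Eu n × Eu n) => J.F2 (((t, a.1), a.2.2.1), a.2.2.2) a.2.1)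
    (J.gr2.1.comp (f := fun q : ℝ × Eu n × P2 n × Eu n × Eu n =>
      ((((q.1, q.2.1), q.2.2.2.1), q.2.2.2.2), q.2.2.1)) (by fun_prop))
    fun t ht a => by rw [J.mderiv2_eq (e t ht)]
  cont_y_m := jointCont_of_continuous
    (G' := fun t (a : Eu n × P2 n × Eu n) =>
      WithLp.toLp 2 fun i => J.Fy i ((t, a.1), a.2.2) a.2.1)
    (continuous_toLp fun i => (J.gry i).1.comp
      (f := fun q : ℝ × Eu n × P2 n × Eu n => (((q.1, q.2.1), q.2.2.2), q.2.2.1)) (by fun_prop))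
    fun t ht a => by simp only [grad, J.pd_y (e t ht)]
  cont_yy_m := jointCont_of_continuous
    (G' := fun t (a : Eu n × P2 n × Eu n) =>
      Matrix.of fun i j => J.Fyy i j ((t, a.1), a.2.2) a.2.1)
    (continuous_matrix fun i j => (J.gryy i j).1.comp
      (f := fun q : ℝ × Eu n × P2 n × Eu n => (((q.1, q.2.1), q.2.2.2), q.2.2.1)) (by fun_prop))
    fun t ht a => by simp only [hess, J.pd_yy (e t ht)]
  cont_xy_m := jointCont_of_continuous
    (G' := fun t (a : Eu n × P2 n × Eu n) =>
      Matrix.of fun i j => J.Fxy i j ((t, a.1), a.2.2) a.2.1)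
    (continuous_matrix fun i j => (J.grxy i j).1.comp
      (f := fun q : ℝ × Eu n × P2 n × Eu n => (((q.1, q.2.1), q.2.2.2), q.2.2.1)) (by fun_prop))
    fun t ht a => by simp only [mixed, J.pd_xy (e t ht)]
  cont_yz_mm := jointCont_of_continuous
    (G' := fun t (a : Eu n × P2 n × Eu n × Eu n) =>
      Matrix.of fun i j => J.Fyz i j (((t, a.1), a.2.2.1), a.2.2.2) a.2.1)
    (continuous_matrix fun i j => (J.gryz i j).1.comp
      (f := fun q : ℝ × Eu n × P2 n × Eu n × Eu n =>
        ((((q.1, q.2.1), q.2.2.2.1), q.2.2.2.2), q.2.2.1)) (by fun_prop))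
    fun t ht a => by simp only [mixed, J.pd_yz (e t ht)]

end Jet

/-! ### The generator in coordinates -/

section Generator

/-- The pairing `Tr[B A]` in coordinates. -/
def pair (A : Matrix (Fin n) (Fin n) ℝ) (B : Fin n → Fin n → ℝ) : ℝ := ∑ i, ∑ j, B i j * A j i

lemma trace_eq_pair (A : Matrix (Fin n) (Fin n) ℝ) (B : Matrix (Fin n) (Fin n) ℝ) :
    (B * A).trace = pair A B := by
  simp [Matrix.trace, Matrix.mul_apply, pair]

lemma integral_pair {α : Type*} [MeasurableSpace α] (m : Measure α) (A : Matrix (Fin n) (Fin n) ℝ)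
    {B : Fin n → Fin n → α → ℝ} (h : ∀ i j, Integrable (B i j) m) :
    ∫ y, pair A (fun i j => B i j y) ∂m = pair A (fun i j => ∫ y, B i j y ∂m) := by
  simp only [pair]
  rw [integral_finsetSum _ fun i _ => integrable_finsetSum _ fun j _ => (h i j).mul_const _]
  refine Finset.sum_congr rfl fun i _ => ?_
  rw [integral_finsetSum _ fun j _ => (h i j).mul_const _]
  exact Finset.sum_congr rfl fun j _ => integral_mul_const _ _

lemma integrable_pair {α : Type*} [MeasurableSpace α] {m : Measure α}
    (A : Matrix (Fin n) (Fin n) ℝ) {B : Fin n → Fin n → α → ℝ} (h : ∀ i j, Integrable (B i j) m) :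
    Integrable (fun y => pair A (fun i j => B i j y)) m :=
  integrable_finsetSum _ fun i _ => integrable_finsetSum _ fun j _ => (h i j).mul_const _

lemma pair_add (A : Matrix (Fin n) (Fin n) ℝ) (B B' : Fin n → Fin n → ℝ) :
    pair A (fun i j => B i j + B' i j) = pair A B + pair A B' := by
  simp [pair, add_mul, Finset.sum_add_distrib]

lemma pair_sub (A : Matrix (Fin n) (Fin n) ℝ) (B B' : Fin n → Fin n → ℝ) :
    pair A (fun i j => B i j - B' i j) = pair A B - pair A B' := by
  simp [pair, sub_mul, Finset.sum_sub_distrib]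

lemma pair_const_mul (A : Matrix (Fin n) (Fin n) ℝ) (c : ℝ) (B : Fin n → Fin n → ℝ) :
    pair A (fun i j => c * B i j) = c * pair A B := by
  simp [pair, Finset.mul_sum, mul_assoc]

lemma pair_add_left (A A' : Matrix (Fin n) (Fin n) ℝ) (B : Fin n → Fin n → ℝ) :
    pair (A + A') B = pair A B + pair A' B := by
  simp [pair, mul_add, Finset.sum_add_distrib]

lemma pair_swap {A : Matrix (Fin n) (Fin n) ℝ} (hA : A.transpose = A) (B : Fin n → Fin n → ℝ) :
    pair A (fun i j => B j i) = pair A B := by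
  have h : ∀ i j, A i j = A j i := fun i j => congrFun (congrFun hA.symm i) j
  rw [pair, Finset.sum_comm]
  simp only [pair]
  exact Finset.sum_congr rfl fun i _ => Finset.sum_congr rfl fun j _ => by rw [h]

lemma inner_eq_sum (v w : Eu n) : inner ℝ v w = ∑ i, v i * w i := by
  rw [PiLp.inner_apply]
  exact Finset.sum_congr rfl fun i _ => by simp [mul_comm]

variable {F : TX n → P2 n → ℝ} (J : Jet F)

/-- The drift part of the generator on the measure variable. -/
def Jet.pop1 (b : Fin n → TX n → P2 n → ℝ) (i : Fin n) (a : TX n) (μ : P2 n) : ℝ :=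
  ∫ y, J.Fy i (a, y) μ * b i (a.1, y) μ ∂μ.meas

/-- The second order part of the generator on the measure variable. -/
def Jet.pop2 (i j : Fin n) (a : TX n) (μ : P2 n) : ℝ := ∫ y, J.Fyy i j (a, y) μ ∂μ.meas

/-- The common noise part of the generator on the measure variable. -/
def Jet.pop3 (i j : Fin n) (a : TX n) (μ : P2 n) : ℝ :=
  ∫ y, ∫ z, J.Fyz i j ((a, y), z) μ ∂μ.meas ∂μ.meas

/-- The part of the generator that acts on the measure variable, in coordinates. -/
def Jet.pop (A A₀ : Matrix (Fin n) (Fin n) ℝ) (b : Fin n → TX n → P2 n → ℝ) (a : TX n)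
    (μ : P2 n) : ℝ :=
  ∑ i, J.pop1 b i a μ + 1 / 2 * pair A (fun i j => J.pop2 i j a μ)
    + 1 / 2 * pair A₀ (fun i j => J.pop3 i j a μ)

/-- The drift part of the generator. -/
def Jet.gen1 (b : Fin n → TX n → P2 n → ℝ) (i : Fin n) (a : TX n) (μ : P2 n) : ℝ :=
  J.Fx i a μ * b i a μ + J.pop1 b i a μ

/-- The second order part of the generator. -/
def Jet.gen2 (i j : Fin n) (a : TX n) (μ : P2 n) : ℝ := J.Fxx i j a μ + J.pop2 i j a μ

/-- The common noise part of the generator. -/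
def Jet.gen3 (i j : Fin n) (a : TX n) (μ : P2 n) : ℝ :=
  1 / 2 * J.pop3 i j a μ + ∫ y, J.Fxy i j (a, y) μ ∂μ.meas

/-- The generator in coordinates. -/
def Jet.gen (A A₀ : Matrix (Fin n) (Fin n) ℝ) (b : Fin n → TX n → P2 n → ℝ) (a : TX n)
    (μ : P2 n) : ℝ :=
  ∑ i, J.gen1 b i a μ + 1 / 2 * pair A (fun i j => J.gen2 i j a μ)
    + pair A₀ (fun i j => J.gen3 i j a μ)

/-- Linear growth times linear growth is quadratic, the largest growth that `P2` integrates. -/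
lemma Jet.gr_pop1 {b : Fin n → TX n → P2 n → ℝ} (hb : ∀ i, Gr 1 (b i)) (i : Fin n) :
    Gr 2 (fun (a : TX n × Eu n) μ => J.Fy i a μ * b i (a.1.1, a.2) μ) :=
  (J.gry i).mul ((hb i).comp (A := fun a : TX n × Eu n => (a.1.1, a.2))
    ⟨fun _ _ _ => rfl, by fun_prop⟩)

variable {m p q : ℕ} (P : Model n m p q) {G : ℝ → Eu n → P2 n → ℝ} {t : ℝ}

section Concrete

variable {b : Fin n → TX n → P2 n → ℝ} {c : Eu n → P2 n → Eu n}

lemma Jet.inner_grad_y (e : ∀ x, G t x = F (t, x)) (w : Eu n) (x : Eu n) (μ : P2 n) (y : Eu n) :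
    inner ℝ (grad (mderiv (G t x) μ) y) w = ∑ i, J.Fy i ((t, x), y) μ * w i := by
  simp only [inner_eq_sum, grad, J.pd_y e]

lemma Jet.trace_hess_y (e : ∀ x, G t x = F (t, x))
    (A : Matrix (Fin n) (Fin n) ℝ) (x : Eu n) (μ : P2 n) (y : Eu n) :
    (hess (mderiv (G t x) μ) y * A).trace = pair A (fun i j => J.Fyy i j ((t, x), y) μ) := by
  rw [trace_eq_pair]
  simp only [hess, Matrix.of_apply, pair, J.pd_yy e]

lemma Jet.trace_mixed_xy (e : ∀ x, G t x = F (t, x))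
    (A : Matrix (Fin n) (Fin n) ℝ) (x : Eu n) (μ : P2 n) (y : Eu n) :
    (mixed (fun x => mderiv (G t x) μ) x y * A).trace =
      pair A (fun i j => J.Fxy i j ((t, x), y) μ) := by
  rw [trace_eq_pair]
  simp only [mixed, Matrix.of_apply, pair, J.pd_xy e]

lemma Jet.trace_mixed_yz (e : ∀ x, G t x = F (t, x))
    (A : Matrix (Fin n) (Fin n) ℝ) (x : Eu n) (μ : P2 n) (y z : Eu n) :
    (mixed (mderiv2 (G t x) μ) y z * A).trace =
      pair A (fun i j => J.Fyz i j (((t, x), y), z) μ) := by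
  rw [trace_eq_pair]
  simp only [mixed, Matrix.of_apply, pair, J.pd_yz e]

lemma Jet.integrable_hess_y (J : Jet F) (e : ∀ x, G t x = F (t, x))
    (A : Matrix (Fin n) (Fin n) ℝ) (x : Eu n) (μ : P2 n) :
    Integrable (fun y => (hess (mderiv (G t x) μ) y * A).trace) μ.meas := by
  simp only [J.trace_hess_y e]
  exact integrable_pair A fun i j => (J.gryy i j).integrable (by norm_num) (t, x) μ μ

lemma Jet.integrable_mixed_xy (J : Jet F) (e : ∀ x, G t x = F (t, x))
    (A : Matrix (Fin n) (Fin n) ℝ) (x : Eu n) (μ : P2 n) :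
    Integrable (fun y => (mixed (fun x => mderiv (G t x) μ) x y * A).trace) μ.meas := by
  simp only [J.trace_mixed_xy e]
  exact integrable_pair A fun i j => (J.grxy i j).integrable (by norm_num) (t, x) μ μ

lemma Jet.integrable_mixed_yz (J : Jet F) (e : ∀ x, G t x = F (t, x))
    (A : Matrix (Fin n) (Fin n) ℝ) (x : Eu n) (μ : P2 n) :
    Integrable (fun a : Eu n × Eu n => (mixed (mderiv2 (G t x) μ) a.1 a.2 * A).trace)
      (μ.meas.prod μ.meas) := by
  simp only [J.trace_mixed_yz e]
  exact integrable_pair A fun i j => (J.gryz i j).integrable_prod (by norm_num) (t, x) μ μ μ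

lemma Jet.integrable_grad_y (J : Jet F) (e : ∀ x, G t x = F (t, x)) (hb : ∀ i, Gr 1 (b i))
    (hc : ∀ x μ i, c x μ i = b i (t, x) μ) (x : Eu n) (μ : P2 n) :
    Integrable (fun y => inner ℝ (grad (mderiv (G t x) μ) y) (c y μ)) μ.meas := by
  simp only [J.inner_grad_y e, hc]
  exact integrable_finsetSum _ fun i _ => (J.gr_pop1 hb i).integrable le_rfl (t, x) μ μ

lemma Jet.popGen_eq (e : ∀ x, G t x = F (t, x)) (hb : ∀ i, Gr 1 (b i))
    (hc : ∀ x μ i, c x μ i = b i (t, x) μ) (x : Eu n) (μ : P2 n) :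
    P.popGen (fun y => c y μ) (G t x) μ = J.pop (P.S + P.S₀) P.S₀ b (t, x) μ := by
  simp only [Model.popGen, J.inner_grad_y e, J.trace_hess_y e, J.trace_mixed_yz e, Jet.pop, hc]
  rw [integral_finsetSum _ fun i _ => (J.gr_pop1 hb i).integrable le_rfl (t, x) μ μ,
    integral_pair _ _ fun i j => (J.gryy i j).integrable (by norm_num) (t, x) μ μ,
    integral_pair _ _ fun i j => (J.gryz i j).integrable_prod (by norm_num) (t, x) μ μ μ]
  have := μ.prob
  simp only [integral_prod _ ((J.gryz _ _).integrable_prod (by norm_num) (t, x) μ μ μ)]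
  rfl

lemma Jet.gen_eq (e : ∀ x, G t x = F (t, x)) (hb : ∀ i, Gr 1 (b i))
    (hc : ∀ x μ i, c x μ i = b i (t, x) μ) (x : Eu n) (μ : P2 n) :
    P.gen (fun y => c y μ) (G t) x μ = J.gen (P.S + P.S₀) P.S₀ b (t, x) μ := by
  rw [Model.gen, J.popGen_eq P e hb hc, trace_eq_pair]
  simp only [inner_eq_sum, grad, J.pd_x e, hc, J.trace_mixed_xy e]
  rw [integral_pair _ _ fun i j => (J.grxy i j).integrable (by norm_num) (t, x) μ μ]
  simp only [Jet.gen, Jet.pop, Jet.gen1, Jet.gen2, Jet.gen3, pair_add, pair_const_mul,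
    Finset.sum_add_distrib]
  have : pair (P.S + P.S₀) (hess (fun x' => G t x' μ) x) =
      pair (P.S + P.S₀) (fun i j => J.Fxx i j (t, x) μ) := by
    simp only [hess, pair, Matrix.of_apply, J.pd_xx e]
  rw [this]
  ring

end Concrete

end Generator

end SocialMFC

namespace SocialMFC
variable {n : ℕ}

/-! ### Linearity of the generator -/

section Linear

variable {F G : TX n → P2 n → ℝ} (J : Jet F) (K : Jet G) {A A₀ : Matrix (Fin n) (Fin n) ℝ}
  {b : Fin n → TX n → P2 n → ℝ}

lemma Jet.pop_add (hb : ∀ i, Gr 1 (b i)) (a : TX n) (μ : P2 n) :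
    (J.add K).pop A A₀ b a μ = J.pop A A₀ b a μ + K.pop A A₀ b a μ := by
  have h1 : ∀ i, (J.add K).pop1 b i a μ = J.pop1 b i a μ + K.pop1 b i a μ := fun i => by
    simp only [Jet.pop1, Jet.add, add_mul]
    exact integral_add ((J.gr_pop1 hb i).integrable le_rfl a μ μ)
      ((K.gr_pop1 hb i).integrable le_rfl a μ μ)
  have h2 : ∀ i j, (J.add K).pop2 i j a μ = J.pop2 i j a μ + K.pop2 i j a μ := fun i j =>
    integral_add ((J.gryy i j).integrable (by norm_num) a μ μ)
      ((K.gryy i j).integrable (by norm_num) a μ μ)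
  have h3 : ∀ i j, (J.add K).pop3 i j a μ = J.pop3 i j a μ + K.pop3 i j a μ := fun i j => by
    have h : ∀ y, ∫ z, (J.add K).Fyz i j ((a, y), z) μ ∂μ.meas =
        (∫ z, J.Fyz i j ((a, y), z) μ ∂μ.meas) + ∫ z, K.Fyz i j ((a, y), z) μ ∂μ.meas :=
      fun y => integral_add ((J.gryz i j).integrable (by norm_num) (a, y) μ μ)
        ((K.gryz i j).integrable (by norm_num) (a, y) μ μ)
    simp only [Jet.pop3, h]
    exact integral_add (((J.gryz i j).integral (by norm_num)).integrable (by norm_num) a μ μ)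
      (((K.gryz i j).integral (by norm_num)).integrable (by norm_num) a μ μ)
  simp only [Jet.pop, h1, h2, h3, pair_add, Finset.sum_add_distrib]
  ring

lemma Jet.pop_sub (hb : ∀ i, Gr 1 (b i)) (a : TX n) (μ : P2 n) :
    (J.sub K).pop A A₀ b a μ = J.pop A A₀ b a μ - K.pop A A₀ b a μ := by
  have h1 : ∀ i, (J.sub K).pop1 b i a μ = J.pop1 b i a μ - K.pop1 b i a μ := fun i => by
    simp only [Jet.pop1, Jet.sub, sub_mul]
    exact integral_sub ((J.gr_pop1 hb i).integrable le_rfl a μ μ)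
      ((K.gr_pop1 hb i).integrable le_rfl a μ μ)
  have h2 : ∀ i j, (J.sub K).pop2 i j a μ = J.pop2 i j a μ - K.pop2 i j a μ := fun i j =>
    integral_sub ((J.gryy i j).integrable (by norm_num) a μ μ)
      ((K.gryy i j).integrable (by norm_num) a μ μ)
  have h3 : ∀ i j, (J.sub K).pop3 i j a μ = J.pop3 i j a μ - K.pop3 i j a μ := fun i j => by
    have h : ∀ y, ∫ z, (J.sub K).Fyz i j ((a, y), z) μ ∂μ.meas =
        (∫ z, J.Fyz i j ((a, y), z) μ ∂μ.meas) - ∫ z, K.Fyz i j ((a, y), z) μ ∂μ.meas :=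
      fun y => integral_sub ((J.gryz i j).integrable (by norm_num) (a, y) μ μ)
        ((K.gryz i j).integrable (by norm_num) (a, y) μ μ)
    simp only [Jet.pop3, h]
    exact integral_sub (((J.gryz i j).integral (by norm_num)).integrable (by norm_num) a μ μ)
      (((K.gryz i j).integral (by norm_num)).integrable (by norm_num) a μ μ)
  simp only [Jet.pop, h1, h2, h3, pair_sub, Finset.sum_sub_distrib]
  ring

lemma Jet.gen_eq_pop (a : TX n) (μ : P2 n) : J.gen A A₀ b a μ =
    ∑ i, J.Fx i a μ * b i a μ + 1 / 2 * pair A (fun i j => J.Fxx i j a μ) + J.pop A A₀ b a μ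
      + pair A₀ (fun i j => ∫ y, J.Fxy i j (a, y) μ ∂μ.meas) := by
  simp only [Jet.gen, Jet.pop, Jet.gen1, Jet.gen2, Jet.gen3, pair_add, pair_const_mul,
    Finset.sum_add_distrib]
  ring

lemma Jet.gen_add (hb : ∀ i, Gr 1 (b i)) (a : TX n) (μ : P2 n) :
    (J.add K).gen A A₀ b a μ = J.gen A A₀ b a μ + K.gen A A₀ b a μ := by
  have h : ∀ i j, ∫ y, (J.add K).Fxy i j (a, y) μ ∂μ.meas =
      (∫ y, J.Fxy i j (a, y) μ ∂μ.meas) + ∫ y, K.Fxy i j (a, y) μ ∂μ.meas := fun i j =>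
    integral_add ((J.grxy i j).integrable (by norm_num) a μ μ)
      ((K.grxy i j).integrable (by norm_num) a μ μ)
  simp only [Jet.gen_eq_pop, J.pop_add K hb, h, pair_add]
  simp only [Jet.add, add_mul, Finset.sum_add_distrib, pair_add]
  ring

lemma Jet.gen_sub (hb : ∀ i, Gr 1 (b i)) (a : TX n) (μ : P2 n) :
    (J.sub K).gen A A₀ b a μ = J.gen A A₀ b a μ - K.gen A A₀ b a μ := by
  have h : ∀ i j, ∫ y, (J.sub K).Fxy i j (a, y) μ ∂μ.meas =
      (∫ y, J.Fxy i j (a, y) μ ∂μ.meas) - ∫ y, K.Fxy i j (a, y) μ ∂μ.meas := fun i j =>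
    integral_sub ((J.grxy i j).integrable (by norm_num) a μ μ)
      ((K.grxy i j).integrable (by norm_num) a μ μ)
  simp only [Jet.gen_eq_pop, J.pop_sub K hb, h, pair_sub]
  simp only [Jet.sub, sub_mul, Finset.sum_sub_distrib, pair_sub]
  ring

end Linear

/-! ### Integral identities -/

section Integrals

variable {E : Type*} [MeasurableSpace E] {m : Measure E} [IsProbabilityMeasure m]

/-- Fubini bookkeeping for the averaged drift. `f₁` and `f₃` carry the state drift and the
new-variable drift, `f₂` and `g₃` the derivative of the drift coefficient. The difference `g₂ - g₁`
is the expression of `∂_z δ_{μμ} F` found in `Fz_eq`. -/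
lemma integral_drift_identity {f₁ f₂ f₃ : E → ℝ} {g₁ g₂ g₃ : E × E → ℝ} (hf₁ : Integrable f₁ m)
    (hf₂ : Integrable f₂ m) (hf₃ : Integrable f₃ m) (hg₁ : Integrable g₁ (m.prod m))
    (hg₂ : Integrable g₂ (m.prod m)) (hg₃ : Integrable g₃ (m.prod m))
    (hs₂ : ∀ y, Integrable (fun z => g₂ (y, z)) m) (hs₃ : ∀ y, Integrable (fun z => g₃ (y, z)) m)
    (ht₁ : ∀ z, Integrable (fun y => g₁ (y, z)) m) (ht₂ : ∀ z, Integrable (fun y => g₂ (y, z)) m) :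
    ∫ y, (f₁ y + f₂ y + (f₃ y - ∫ z, g₁ (y, z) ∂m + ∫ z, (g₂ (y, z) + g₃ (y, z)) ∂m)) ∂m =
      ((∫ y, f₃ y ∂m) + ∫ z, (f₁ z + ∫ y, (g₂ (y, z) - g₁ (y, z)) ∂m) ∂m)
        + ((∫ y, f₂ y ∂m) + ∫ z, ∫ y, g₃ (y, z) ∂m ∂m) := by
  have i₁ := hg₁.integral_prod_left
  have i₂ := hg₂.integral_prod_left
  have i₃ := hg₃.integral_prod_left
  have j₁ := hg₁.integral_prod_right
  have j₂ := hg₂.integral_prod_right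
  have e : ∀ y, ∫ z, (g₂ (y, z) + g₃ (y, z)) ∂m = (∫ z, g₂ (y, z) ∂m) + ∫ z, g₃ (y, z) ∂m :=
    fun y => integral_add (hs₂ y) (hs₃ y)
  have e' : ∀ z, ∫ y, (g₂ (y, z) - g₁ (y, z)) ∂m = (∫ y, g₂ (y, z) ∂m) - ∫ y, g₁ (y, z) ∂m :=
    fun z => integral_sub (ht₂ z) (ht₁ z)
  simp only [e, e']
  rw [integral_add (by fun_prop) (by fun_prop), integral_add (by fun_prop) (by fun_prop),
    integral_add (by fun_prop) (by fun_prop), integral_add (by fun_prop) (by fun_prop),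
    integral_sub (by fun_prop) (by fun_prop), integral_add hf₁ (by fun_prop),
    integral_sub (by fun_prop) (by fun_prop), ← integral_prod _ hg₁, ← integral_prod _ hg₂,
    ← integral_prod _ hg₃, ← integral_prod_symm _ hg₁, ← integral_prod_symm _ hg₂,
    ← integral_prod_symm _ hg₃]
  ring

lemma integral_second_identity {f₁ f₂ : E → ℝ} {g₁ g₂ : E × E → ℝ} (hf₁ : Integrable f₁ m)
    (hf₂ : Integrable f₂ m) (hg₁ : Integrable g₁ (m.prod m)) (hg₂ : Integrable g₂ (m.prod m))
    (ht₁ : ∀ z, Integrable (fun y => g₁ (y, z)) m) (ht₂ : ∀ z, Integrable (fun y => g₂ (y, z)) m) :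
    ∫ y, (f₁ y + (f₂ y - ∫ z, g₁ (y, z) ∂m + ∫ z, g₂ (y, z) ∂m)) ∂m =
      (∫ y, f₂ y ∂m) + ∫ z, (f₁ z + ∫ y, (g₂ (y, z) - g₁ (y, z)) ∂m) ∂m := by
  have i₁ := hg₁.integral_prod_left
  have i₂ := hg₂.integral_prod_left
  have j₁ := hg₁.integral_prod_right
  have j₂ := hg₂.integral_prod_right
  have e' : ∀ z, ∫ y, (g₂ (y, z) - g₁ (y, z)) ∂m = (∫ y, g₂ (y, z) ∂m) - ∫ y, g₁ (y, z) ∂m :=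
    fun z => integral_sub (ht₂ z) (ht₁ z)
  simp only [e']
  rw [integral_add (by fun_prop) (by fun_prop), integral_add (by fun_prop) (by fun_prop),
    integral_sub (by fun_prop) (by fun_prop), integral_add hf₁ (by fun_prop),
    integral_sub (by fun_prop) (by fun_prop), ← integral_prod _ hg₁, ← integral_prod _ hg₂,
    ← integral_prod_symm _ hg₁, ← integral_prod_symm _ hg₂]
  ring

/-- Fubini bookkeeping for the averaged common noise part. The double integral of `q` occurs twice
with a minus sign, hence the factor `2`, which is also the one in `F3zw`. -/
lemma integral_common_identity {u : E → ℝ} {p r v o : E × E → ℝ} {q s : E × E × E → ℝ}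
    (hu : Integrable u m) (hp : Integrable p (m.prod m)) (hr : Integrable r (m.prod m))
    (hv : Integrable v (m.prod m)) (ho : Integrable o (m.prod m))
    (hq : Integrable q (m.prod (m.prod m))) (hs : Integrable s (m.prod (m.prod m)))
    (hr' : ∀ x, Integrable (fun y => r (x, y)) m)
    (hq' : ∀ x, Integrable (fun y => q (x, y)) (m.prod m))
    (hs' : ∀ x, Integrable (fun y => s (x, y)) (m.prod m)) :
    ∫ x, (1 / 2 * ((∫ w, p (x, w) ∂m) - (∫ y, ∫ w, q (x, y, w) ∂m ∂m)
        + ∫ y, (r (x, y) - (∫ w, q (x, y, w) ∂m) + ∫ w, s (x, y, w) ∂m) ∂m)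
      + (u x - (∫ y, v (x, y) ∂m) + ∫ y, o (x, y) ∂m)) ∂m =
    1 / 2 * ((∫ a, p a ∂(m.prod m)) + (∫ a, r a ∂(m.prod m))
      + (∫ a, (s a - 2 * q a) ∂(m.prod (m.prod m))))
      + ((∫ x, u x ∂m) + ∫ a, (o a - v a) ∂(m.prod m)) := by
  have e₁ : ∀ x, ∫ y, ∫ w, q (x, y, w) ∂m ∂m = ∫ a, q (x, a) ∂(m.prod m) := fun x =>
    (integral_prod _ (hq' x)).symm
  have e₂ : ∀ x, ∫ y, (r (x, y) - (∫ w, q (x, y, w) ∂m) + ∫ w, s (x, y, w) ∂m) ∂m =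
      (∫ y, r (x, y) ∂m) - (∫ a, q (x, a) ∂(m.prod m)) + ∫ a, s (x, a) ∂(m.prod m) := fun x => by
    have h₁ := (hq' x).integral_prod_left
    have h₂ := (hs' x).integral_prod_left
    have h₃ := hr' x
    rw [integral_add (by exact h₃.sub h₁) h₂, integral_sub h₃ h₁,
      integral_prod _ (hq' x), integral_prod _ (hs' x)]
  simp only [e₁, e₂]
  have ip := hp.integral_prod_left
  have ir := hr.integral_prod_left
  have iv := hv.integral_prod_left
  have io := ho.integral_prod_left
  have iq := hq.integral_prod_left
  have is := hs.integral_prod_left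
  rw [integral_add (by fun_prop) (by fun_prop), integral_const_mul,
    integral_add (by fun_prop) (by fun_prop), integral_sub (by fun_prop) (by fun_prop),
    integral_add (by fun_prop) (by fun_prop), integral_sub (by fun_prop) (by fun_prop),
    integral_add (by fun_prop) (by fun_prop), integral_sub (by fun_prop) (by fun_prop),
    ← integral_prod _ hp, ← integral_prod _ hr, ← integral_prod _ hv, ← integral_prod _ ho,
    ← integral_prod _ hq, ← integral_prod _ hs, integral_sub (by fun_prop) (by fun_prop),
    integral_sub (by fun_prop) (by fun_prop), integral_const_mul]
  ring

lemma integral_common_identity' {k k' : E × E → ℝ} {q : E × E × E → ℝ}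
    (hk : Integrable k (m.prod m)) (hk' : Integrable k' (m.prod m))
    (hq : Integrable q (m.prod (m.prod m))) :
    ∫ y, ∫ w, (k (y, w) + k' (w, y) + ∫ x, q (x, y, w) ∂m) ∂m ∂m =
      (∫ a, k a ∂(m.prod m)) + (∫ a, k' a ∂(m.prod m)) + ∫ a, q a ∂(m.prod (m.prod m)) := by
  have h₁ : Integrable (fun a : E × E => k' (a.2, a.1)) (m.prod m) := hk'.swap
  have h₂ : Integrable (fun a : E × E => ∫ x, q (x, a) ∂m) (m.prod m) := hq.integral_prod_right
  have h₃ : Integrable (fun a : E × E => k (a.1, a.2)) (m.prod m) := hk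
  have h₄ : Integrable (fun a : E × E => k (a.1, a.2) + k' (a.2, a.1) + ∫ x, q (x, a) ∂m)
    (m.prod m) := (h₃.add h₁).add h₂
  have e := integral_prod _ h₄
  rw [← e, integral_add (by exact h₃.add h₁) h₂, integral_add h₃ h₁,
    integral_prod_symm _ hq, ← integral_prod_swap k']
  rfl

end Integrals

end SocialMFC

namespace SocialMFC
variable {n : ℕ}

lemma MD.pair {X : Type*} [NormedAddCommGroup X] [NormedSpace ℝ X]
    (A : Matrix (Fin n) (Fin n) ℝ) {B : Fin n → Fin n → X → P2 n → ℝ}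
    {B' : Fin n → Fin n → X × Eu n → P2 n → ℝ} (h : ∀ i j, MD (B i j) (B' i j)) :
    MD (fun x μ => SocialMFC.pair A (fun i j => B i j x μ))
      (fun a μ => SocialMFC.pair A (fun i j => B' i j a μ)) := by
  refine MD.sum _ fun i => MD.sum _ fun j => ?_
  simpa only [mul_comm] using (h i j).const_mul (A j i)

lemma Gr.pair {X : Type*} [NormedAddCommGroup X] [NormedSpace ℝ X] {k : ℕ}
    (A : Matrix (Fin n) (Fin n) ℝ) {B : Fin n → Fin n → X → P2 n → ℝ}
    (h : ∀ i j, Gr k (B i j)) : Gr k (fun x μ => SocialMFC.pair A (fun i j => B i j x μ)) := by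
  refine Gr.sum _ fun i => Gr.sum _ fun j => ?_
  simpa only [mul_comm] using (h i j).const_mul (A j i)

/-- For coefficients of degree zero a finite measure suffices, so diagonals and triple products can
be treated along any continuous map. -/
lemma Gr.integrable_bounded {X Z : Type*} [NormedAddCommGroup X] [NormedSpace ℝ X]
    [TopologicalSpace Z] [MeasurableSpace Z] [OpensMeasurableSpace Z] {F : X → P2 n → ℝ}
    (h : Gr 0 F) {f : Z → X} (hf : Continuous f) (μ : P2 n) (m : Measure Z) [IsFiniteMeasure m] :
    Integrable (fun z => F (f z) μ) m := by
  obtain ⟨hc, K, -, hK⟩ := h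
  refine Integrable.of_bound ((hc.comp (f := fun z => (f z, μ)) (by fun_prop)).aestronglyMeasurable)
    (K μ) (Eventually.of_forall fun z => ?_)
  simpa using hK (f z) μ

/-! ### The measure derivative of the generator -/

namespace VJet

variable {F : TX n → P2 n → ℝ} (J : VJet F) {b : Fin n → TX n → P2 n → ℝ}
  {db : Fin n → TX n × Eu n → P2 n → ℝ}

/-- Space and measure derivatives commute by `MD.hasPD`. Here and in the next lemmas this allows
every coefficient of the generator to be differentiated in `μ`. -/
lemma mdx (i : Fin n) : MD (J.Fx i) (J.F1x i) :=
  J.md1.hasPD (J.pdx i) (J.pdF1x i) ((J.grF1x i).mono (by norm_num))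

lemma mdxx (i j : Fin n) : MD (J.Fxx i j) (J.F1xx i j) :=
  (J.mdx j).hasPD (J.pdxx i j) (J.pdF1xx i j) ((J.grF1xx i j).mono (by norm_num))

lemma mdy (i : Fin n) : MD (J.Fy i) (J.F2y i) :=
  J.md2.hasPD (J.pdy i) (J.pdF2y i) ((J.grF2y i).mono (by norm_num))

lemma mdyy (i j : Fin n) : MD (J.Fyy i j) (J.F2yy i j) :=
  (J.mdy j).hasPD (J.pdyy i j) (J.pdF2yy i j) ((J.grF2yy i j).mono (by norm_num))

lemma mdxy (i j : Fin n) : MD (J.Fxy i j) (J.F2xy i j) :=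
  (J.mdy j).hasPD (J.pdxy i j) (J.pdF2xy i j) ((J.grF2xy i j).mono (by norm_num))

lemma mdz (i : Fin n) : MD (J.Fz i) (J.F3z i) :=
  J.md3.hasPD (J.pdz i) (J.pdF3z i) ((J.grF3z i).mono (by norm_num))

lemma mdyz (i j : Fin n) : MD (J.Fyz i j) (J.F3yz i j) :=
  (J.mdz j).hasPD (J.pdyz i j) (J.pdF3yz i j) ((J.grF3yz i j).mono (by norm_num))

/-- The first-order corrections in the symmetry rule depend on only one of the two measure
variables, so the mixed derivative removes them. -/
lemma Fyz_symm (i j : Fin n) (a : (TX n × Eu n) × Eu n) (μ : P2 n) :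
    J.Fyz i j a μ = J.Fyz j i (swapLast a) μ := by
  have h1 := J.pdyz i j
  rw [J.Fz_eq] at h1
  have h2 := (HasPD.comp (v := (((0 : TX n), (bas i : Eu n)), (0 : Eu n))) lin_swapLast
    (J.pdF2zy i j)).sub (HasPD.of_const (F := J.Fy j)
      (v := (((0 : TX n), (bas i : Eu n)), (0 : Eu n))) lin_skip rfl)
  have h3 := congrFun (congrFun (HasPD.unique h1 h2) a) μ
  simpa using h3

/-- `δ_μ` of the drift part of the generator. -/
def dgen1 (b : Fin n → TX n → P2 n → ℝ) (db : Fin n → TX n × Eu n → P2 n → ℝ) (i : Fin n)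
    (a : TX n × Eu n) (μ : P2 n) : ℝ :=
  J.F1x i a μ * b i a.1 μ + J.Fx i a.1 μ * db i a μ +
    (J.Fy i a μ * b i (proj a) μ - ∫ y, J.Fy i (a.1, y) μ * b i (proj (a.1, y)) μ ∂μ.meas +
      ∫ y, (J.F2y i ((a.1, y), a.2) μ * b i (proj (a.1, y)) μ +
        J.Fy i (a.1, y) μ * db i (proj (a.1, y), a.2) μ) ∂μ.meas)

/-- `δ_μ` of the second order part of the generator. -/
def dgen2 (i j : Fin n) (a : TX n × Eu n) (μ : P2 n) : ℝ :=
  J.F1xx i j a μ + (J.Fyy i j a μ - ∫ y, J.Fyy i j (a.1, y) μ ∂μ.meas +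
    ∫ y, J.F2yy i j ((a.1, y), a.2) μ ∂μ.meas)

/-- `δ_μ` of the common noise part of the generator. -/
def dgen3 (i j : Fin n) (a : TX n × Eu n) (μ : P2 n) : ℝ :=
  1 / 2 * ((∫ w, J.Fyz i j (a, w) μ ∂μ.meas)
      - (∫ y, ∫ w, J.Fyz i j ((a.1, y), w) μ ∂μ.meas ∂μ.meas)
      + ∫ y, (J.Fyz i j ((a.1, y), a.2) μ - (∫ w, J.Fyz i j ((a.1, y), w) μ ∂μ.meas)
        + ∫ w, J.F3yz i j (((a.1, y), w), a.2) μ ∂μ.meas) ∂μ.meas)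
    + (J.Fxy i j a μ - (∫ y, J.Fxy i j (a.1, y) μ ∂μ.meas)
      + ∫ y, J.F2xy i j ((a.1, y), a.2) μ ∂μ.meas)

section Growth

lemma gr_drift₁ (hb : ∀ i, Gr 1 (b i)) (i : Fin n) :
    Gr 2 (fun (a : (TX n × Eu n) × Eu n) μ => J.F2y i a μ * b i (proj a.1) μ) :=
  (J.grF2y i).mul (((hb i).comp lin_proj).comp lin_fst)

lemma gr_drift₂ (hdb : ∀ i, Gr 1 (db i)) (i : Fin n) :
    Gr 2 (fun (a : (TX n × Eu n) × Eu n) μ => J.Fy i a.1 μ * db i (proj a.1, a.2) μ) :=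
  ((J.gry i).comp lin_fst).mul ((hdb i).comp lin_proj.map_fst)

lemma md_gen1 (hb : ∀ i, Gr 1 (b i)) (hdb : ∀ i, Gr 1 (db i)) (h : ∀ i, MD (b i) (db i))
    (i : Fin n) : MD (J.gen1 b i) (J.dgen1 b db i) :=
  ((J.mdx i).mul (h i)).add (((J.mdy i).mul ((h i).comp proj)).integral (J.gr_pop1 hb i)
    ((J.gr_drift₁ hb i).add (J.gr_drift₂ hdb i)))

lemma md_gen2 (i j : Fin n) : MD (J.gen2 i j) (J.dgen2 i j) :=
  (J.mdxx i j).add ((J.mdyy i j).integral ((J.gryy i j).mono (by norm_num))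
    ((J.grF2yy i j).mono (by norm_num)))

lemma gr_common (i j : Fin n) : Gr 0 (fun (a : (TX n × Eu n) × Eu n) μ =>
    J.Fyz i j a μ - (∫ w, J.Fyz i j (a.1, w) μ ∂μ.meas)
      + ∫ w, J.F3yz i j ((a.1, w), a.2) μ ∂μ.meas) :=
  ((J.gryz i j).sub (((J.gryz i j).integral (by norm_num)).comp lin_fst)).add
    (((J.grF3yz i j).comp lin_swapLast).integral (by norm_num))

lemma md_gen3 (i j : Fin n) : MD (J.gen3 i j) (J.dgen3 i j) :=
  ((((J.mdyz i j).integral ((J.gryz i j).mono (by norm_num))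
    ((J.grF3yz i j).mono (by norm_num))).integral
      (((J.gryz i j).integral (by norm_num)).mono (by norm_num))
      ((J.gr_common i j).mono (by norm_num))).const_mul (1 / 2)).add
    ((J.mdxy i j).integral ((J.grxy i j).mono (by norm_num)) ((J.grF2xy i j).mono (by norm_num)))

lemma gr_dgen1 (hb : ∀ i, Gr 1 (b i)) (hdb : ∀ i, Gr 1 (db i)) (i : Fin n) :
    Gr 2 (J.dgen1 b db i) := by
  have h1 : Gr 2 (fun (a : TX n × Eu n) μ => J.F1x i a μ * b i a.1 μ) :=
    (J.grF1x i).mul ((hb i).comp lin_fst)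
  have h2 : Gr 2 (fun (a : TX n × Eu n) μ => J.Fx i a.1 μ * db i a μ) :=
    ((J.grx i).comp lin_fst).mul (hdb i)
  exact (h1.add h2).add (((J.gr_pop1 hb i).sub
    (((J.gr_pop1 hb i).integral le_rfl).comp lin_fst)).add
    ((((J.gr_drift₁ hb i).add (J.gr_drift₂ hdb i)).comp lin_swapLast).integral le_rfl))

lemma gr_dgen2 (i j : Fin n) : Gr 2 (J.dgen2 i j) := by
  have h : Gr 0 (J.dgen2 i j) := (J.grF1xx i j).add (((J.gryy i j).sub
    (((J.gryy i j).integral (by norm_num)).comp lin_fst)).add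
    (((J.grF2yy i j).comp lin_swapLast).integral (by norm_num)))
  exact h.mono (by norm_num)

lemma gr_dgen3 (i j : Fin n) : Gr 2 (J.dgen3 i j) := by
  have h1 := (J.gryz i j).integral (by norm_num)
  have h : Gr 0 (J.dgen3 i j) := (((h1.sub ((h1.integral (by norm_num)).comp lin_fst)).add
    (((J.gr_common i j).comp lin_swapLast).integral (by norm_num))).const_mul (1 / 2)).add
    (((J.grxy i j).sub (((J.grxy i j).integral (by norm_num)).comp lin_fst)).add
      (((J.grF2xy i j).comp lin_swapLast).integral (by norm_num)))
  exact h.mono (by norm_num)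

end Growth

end VJet

end SocialMFC

namespace SocialMFC
variable {n : ℕ}

namespace VJet

variable {F : TX n → P2 n → ℝ} (J : VJet F) {b : Fin n → TX n → P2 n → ℝ}
  {db : Fin n → TX n × Eu n → P2 n → ℝ}

/-! ### Averages of the derivative of the generator over the state -/

/-- `∂_z δ_μ W(x;z)` is the sum of `∂_z δ_μ F(z;x)` and the average of `∂_z δ_{μμ} F(y;x,z)`, so the
terms containing `b` reassemble into the drift part for `W`. The two terms containing `db` pair it
with `∂_z δ_μ Ū(z)`. -/
lemma integral_dgen1_exch (hb : ∀ i, Gr 1 (b i)) (hdb : ∀ i, Gr 1 (db i)) (i : Fin n) (a : TX n)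
    (μ : P2 n) : ∫ y, J.dgen1 b db i (exch (a, y)) μ ∂μ.meas = J.preW.jet.gen1 b i a μ +
      ((∫ y, J.Fx i (a.1, y) μ * db i ((a.1, y), a.2) μ ∂μ.meas) +
        ∫ z, ∫ y, J.Fy i ((a.1, y), z) μ * db i ((a.1, z), a.2) μ ∂μ.meas ∂μ.meas) := by
  have := μ.prob
  have g1 : Gr 2 (fun (a : TX n × Eu n) μ => J.F1x i (exch a) μ * b i (proj a) μ) :=
    ((J.grF1x i).comp lin_exch).mul ((hb i).comp lin_proj)
  have g2 : Gr 2 (fun (a : TX n × Eu n) μ => J.Fx i (proj a) μ * db i (exch a) μ) :=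
    ((J.grx i).comp lin_proj).mul ((hdb i).comp lin_exch)
  have g3 : Gr 2 (fun (a : TX n × Eu n) μ => J.Fy i (exch a) μ * b i a.1 μ) :=
    ((J.gry i).comp lin_exch).mul ((hb i).comp lin_fst)
  have k1 : Gr 2 (fun (a : (TX n × Eu n) × Eu n) μ =>
      J.Fy i (proj a.1, a.2) μ * b i (a.1.1.1, a.2) μ) :=
    ((J.gry i).comp lin_proj.map_fst).mul ((hb i).comp
      (A := fun a : (TX n × Eu n) × Eu n => (a.1.1.1, a.2)) ⟨fun _ _ _ => rfl, by fun_prop⟩)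
  have k2 : Gr 2 (fun (a : (TX n × Eu n) × Eu n) μ =>
      J.F2y i ((proj a.1, a.2), a.1.1.2) μ * b i (a.1.1.1, a.2) μ) :=
    ((J.grF2y i).comp (A := fun a : (TX n × Eu n) × Eu n => ((proj a.1, a.2), a.1.1.2))
      ⟨fun _ _ _ => rfl, by unfold proj; fun_prop⟩).mul ((hb i).comp
      (A := fun a : (TX n × Eu n) × Eu n => (a.1.1.1, a.2)) ⟨fun _ _ _ => rfl, by fun_prop⟩)
  have k3 : Gr 2 (fun (a : (TX n × Eu n) × Eu n) μ =>
      J.Fy i (proj a.1, a.2) μ * db i ((a.1.1.1, a.2), a.1.1.2) μ) :=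
    ((J.gry i).comp lin_proj.map_fst).mul ((hdb i).comp
      (A := fun a : (TX n × Eu n) × Eu n => ((a.1.1.1, a.2), a.1.1.2))
      ⟨fun _ _ _ => rfl, by fun_prop⟩)
  refine (integral_drift_identity (m := μ.meas) (g1.integrable le_rfl a μ μ)
    (g2.integrable le_rfl a μ μ) (g3.integrable le_rfl a μ μ)
    (k1.integrable_prod le_rfl a μ μ μ) (k2.integrable_prod le_rfl a μ μ μ)
    (k3.integrable_prod le_rfl a μ μ μ) (fun y => k2.integrable le_rfl (a, y) μ μ)
    (fun y => k3.integrable le_rfl (a, y) μ μ)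
    (fun z => (k1.comp lin_swapLast).integrable le_rfl (a, z) μ μ)
    (fun z => (k2.comp lin_swapLast).integrable le_rfl (a, z) μ μ)).trans ?_
  congr 1
  simp only [Jet.gen1, Jet.pop1, Pre.jet, preW, J.Fz_eq, add_mul, ← integral_mul_const, sub_mul,
    swapLast, exch, proj]

lemma integral_dgen1_diag (hb : ∀ i, Gr 1 (b i)) (hdb : ∀ i, Gr 1 (db i)) (i : Fin n) (a : TX n)
    (μ : P2 n) : ∫ y, J.dgen1 b db i (diag (a, y)) μ ∂μ.meas = J.preD.jet.gen1 b i a μ +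
      ((∫ y, J.Fx i (a.1, y) μ * db i ((a.1, y), y) μ ∂μ.meas) +
        ∫ z, ∫ y, J.Fy i ((a.1, y), z) μ * db i ((a.1, z), y) μ ∂μ.meas ∂μ.meas) := by
  have := μ.prob
  have g1 : Gr 2 (fun (a : TX n × Eu n) μ => J.F1x i (diag a) μ * b i (proj a) μ) :=
    ((J.grF1x i).comp lin_diag).mul ((hb i).comp lin_proj)
  have g2 : Gr 2 (fun (a : TX n × Eu n) μ => J.Fx i (proj a) μ * db i (diag a) μ) :=
    ((J.grx i).comp lin_proj).mul ((hdb i).comp lin_diag)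
  have g3 : Gr 2 (fun (a : TX n × Eu n) μ => J.Fy i (diag a) μ * b i (proj a) μ) :=
    ((J.gry i).comp lin_diag).mul ((hb i).comp lin_proj)
  have k1 : Gr 2 (fun (a : (TX n × Eu n) × Eu n) μ =>
      J.Fy i (proj a.1, a.2) μ * b i (a.1.1.1, a.2) μ) :=
    ((J.gry i).comp lin_proj.map_fst).mul ((hb i).comp
      (A := fun a : (TX n × Eu n) × Eu n => (a.1.1.1, a.2)) ⟨fun _ _ _ => rfl, by fun_prop⟩)
  have k2 : Gr 2 (fun (a : (TX n × Eu n) × Eu n) μ =>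
      J.F2y i ((proj a.1, a.2), a.1.2) μ * b i (a.1.1.1, a.2) μ) :=
    ((J.grF2y i).comp (A := fun a : (TX n × Eu n) × Eu n => ((proj a.1, a.2), a.1.2))
      ⟨fun _ _ _ => rfl, by unfold proj; fun_prop⟩).mul ((hb i).comp
      (A := fun a : (TX n × Eu n) × Eu n => (a.1.1.1, a.2)) ⟨fun _ _ _ => rfl, by fun_prop⟩)
  have k3 : Gr 2 (fun (a : (TX n × Eu n) × Eu n) μ =>
      J.Fy i (proj a.1, a.2) μ * db i ((a.1.1.1, a.2), a.1.2) μ) :=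
    ((J.gry i).comp lin_proj.map_fst).mul ((hdb i).comp
      (A := fun a : (TX n × Eu n) × Eu n => ((a.1.1.1, a.2), a.1.2))
      ⟨fun _ _ _ => rfl, by fun_prop⟩)
  refine (integral_drift_identity (m := μ.meas) (g1.integrable le_rfl a μ μ)
    (g2.integrable le_rfl a μ μ) (g3.integrable le_rfl a μ μ)
    (k1.integrable_prod le_rfl a μ μ μ) (k2.integrable_prod le_rfl a μ μ μ)
    (k3.integrable_prod le_rfl a μ μ μ) (fun y => k2.integrable le_rfl (a, y) μ μ)
    (fun y => k3.integrable le_rfl (a, y) μ μ)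
    (fun z => (k1.comp lin_swapLast).integrable le_rfl (a, z) μ μ)
    (fun z => (k2.comp lin_swapLast).integrable le_rfl (a, z) μ μ)).trans ?_
  congr 1
  have i1 := g1.integrable le_rfl a μ μ
  have i3 := g3.integrable le_rfl a μ μ
  have i4 := (((k2.comp lin_swapLast).sub (k1.comp lin_swapLast)).integral le_rfl).integrable
    le_rfl a μ μ
  simp only [Jet.gen1, Jet.pop1, Pre.jet, preD, J.Fz_eq, add_mul, ← integral_mul_const, sub_mul,
    swapLast, diag, proj, integral_zero, zero_mul, zero_add] at i1 i3 i4 ⊢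
  rw [integral_add i1 i4, integral_add (by exact i1.add i3) i4, integral_add i1 i3]
  ring

lemma integral_dgen2_exch (i j : Fin n) (a : TX n) (μ : P2 n) :
    ∫ y, J.dgen2 i j (exch (a, y)) μ ∂μ.meas = J.preW.jet.gen2 i j a μ := by
  have := μ.prob
  refine (integral_second_identity (m := μ.meas)
    ((J.grF1xx i j).integrable_bounded (f := fun y => exch (a, y)) (by unfold exch; fun_prop) μ _)
    ((J.gryy i j).integrable_bounded (f := fun y => exch (a, y)) (by unfold exch; fun_prop) μ _)
    ((J.gryy i j).integrable_bounded (f := fun z : Eu n × Eu n => ((a.1, z.1), z.2))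
      (by fun_prop) μ _)
    ((J.grF2yy i j).integrable_bounded (f := fun z : Eu n × Eu n => (((a.1, z.1), z.2), a.2))
      (by fun_prop) μ _)
    (fun z => (J.gryy i j).integrable_bounded (f := fun y => ((a.1, y), z)) (by fun_prop) μ _)
    (fun z => (J.grF2yy i j).integrable_bounded (f := fun y => (((a.1, y), z), a.2))
      (by fun_prop) μ _)).trans ?_
  rfl

/-- `δ_μ` of the second order part has second derivatives in the state and in the new variable but
no mixed ones, whereas the Hessian along the diagonal has both cross terms. They are the correction.
-/
lemma integral_dgen2_diag (i j : Fin n) (a : TX n) (μ : P2 n) :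
    ∫ y, J.dgen2 i j (diag (a, y)) μ ∂μ.meas = J.preD.jet.gen2 i j a μ -
      ∫ y, (J.Fxy i j ((a.1, y), y) μ + J.Fxy j i ((a.1, y), y) μ) ∂μ.meas := by
  have := μ.prob
  have i1 := (J.grF1xx i j).integrable_bounded (f := fun y => diag (a, y))
    (by unfold diag; fun_prop) μ μ.meas
  have i2 := (J.gryy i j).integrable_bounded (f := fun y => diag (a, y))
    (by unfold diag; fun_prop) μ μ.meas
  have i3 := (J.grxy i j).integrable_bounded (f := fun y => diag (a, y))
    (by unfold diag; fun_prop) μ μ.meas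
  have i4 := (J.grxy j i).integrable_bounded (f := fun y => diag (a, y))
    (by unfold diag; fun_prop) μ μ.meas
  have i5 := (((J.grFzz i j).comp lin_diag.map_fst).comp lin_swapLast).integral (by norm_num)
    |>.integrable (by norm_num) a μ μ
  refine (integral_second_identity (m := μ.meas) i1 i2
    ((J.gryy i j).integrable_bounded (f := fun z : Eu n × Eu n => ((a.1, z.1), z.2))
      (by fun_prop) μ _)
    ((J.grF2yy i j).integrable_bounded (f := fun z : Eu n × Eu n => (((a.1, z.1), z.2), z.1))
      (by fun_prop) μ _)
    (fun z => (J.gryy i j).integrable_bounded (f := fun y => ((a.1, y), z)) (by fun_prop) μ _)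
    (fun z => (J.grF2yy i j).integrable_bounded (f := fun y => (((a.1, y), z), y))
      (by fun_prop) μ _)).trans ?_
  simp only [Jet.gen2, Jet.pop2, Pre.jet, preD, integral_zero, zero_add]
  simp only [diag, swapLast, Fzz] at i1 i2 i3 i4 i5 ⊢
  rw [integral_add i1 i5, integral_add (by exact (i1.add i4).add (i3.add i2)) i5,
    integral_add (by exact i1.add i4) (by exact i3.add i2), integral_add i1 i4, integral_add i3 i2,
    integral_add i3 i4]
  ring

section Common

variable (i j : Fin n) (a : TX n) (μ : P2 n)

lemma integrable_common_q : Integrable (fun z : Eu n × Eu n × Eu n =>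
    J.F3yz i j ((((a.1, z.1), z.2.1), z.2.2), a.2) μ - 2 * J.Fyz i j (((a.1, z.1), z.2.1), z.2.2) μ)
      (μ.meas.prod (μ.meas.prod μ.meas)) := by
  have := μ.prob
  exact ((J.grF3yz i j).integrable_bounded (f := fun z : Eu n × Eu n × Eu n =>
    ((((a.1, z.1), z.2.1), z.2.2), a.2)) (by fun_prop) μ _).sub
    (((J.gryz i j).integrable_bounded (f := fun z : Eu n × Eu n × Eu n =>
    (((a.1, z.1), z.2.1), z.2.2)) (by fun_prop) μ _).const_mul 2)

lemma integral_dgen3_exch : ∫ y, J.dgen3 i j (exch (a, y)) μ ∂μ.meas =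
    1 / 2 * ((∫ z, J.Fyz i j (((a.1, z.1), a.2), z.2) μ ∂(μ.meas.prod μ.meas))
      + (∫ z, J.Fyz j i (((a.1, z.1), a.2), z.2) μ ∂(μ.meas.prod μ.meas))
      + ∫ z : Eu n × Eu n × Eu n, (J.F3yz i j ((((a.1, z.1), z.2.1), z.2.2), a.2) μ
        - 2 * J.Fyz i j (((a.1, z.1), z.2.1), z.2.2) μ) ∂(μ.meas.prod (μ.meas.prod μ.meas)))
    + ((∫ y, J.Fxy i j ((a.1, y), a.2) μ ∂μ.meas)
      + ∫ z, J.F2xz i j (((a.1, z.1), a.2), z.2) μ ∂(μ.meas.prod μ.meas)) := by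
  have := μ.prob
  refine (integral_common_identity (m := μ.meas)
    (u := fun y => J.Fxy i j ((a.1, y), a.2) μ)
    (p := fun z => J.Fyz i j (((a.1, z.1), a.2), z.2) μ)
    (r := fun z => J.Fyz i j (((a.1, z.1), z.2), a.2) μ)
    (v := fun z => J.Fxy i j ((a.1, z.1), z.2) μ)
    (o := fun z => J.F2xy i j (((a.1, z.1), z.2), a.2) μ)
    (q := fun z => J.Fyz i j (((a.1, z.1), z.2.1), z.2.2) μ)
    (s := fun z => J.F3yz i j ((((a.1, z.1), z.2.1), z.2.2), a.2) μ)
    ((J.grxy i j).integrable_bounded (f := fun y => ((a.1, y), a.2)) (by fun_prop) μ _)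
    ((J.gryz i j).integrable_bounded (f := fun z : Eu n × Eu n => (((a.1, z.1), a.2), z.2))
      (by fun_prop) μ _)
    ((J.gryz i j).integrable_bounded (f := fun z : Eu n × Eu n => (((a.1, z.1), z.2), a.2))
      (by fun_prop) μ _)
    ((J.grxy i j).integrable_bounded (f := fun z : Eu n × Eu n => ((a.1, z.1), z.2))
      (by fun_prop) μ _)
    ((J.grF2xy i j).integrable_bounded (f := fun z : Eu n × Eu n => (((a.1, z.1), z.2), a.2))
      (by fun_prop) μ _)
    ((J.gryz i j).integrable_bounded (f := fun z : Eu n × Eu n × Eu n =>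
      (((a.1, z.1), z.2.1), z.2.2)) (by fun_prop) μ _)
    ((J.grF3yz i j).integrable_bounded (f := fun z : Eu n × Eu n × Eu n =>
      ((((a.1, z.1), z.2.1), z.2.2), a.2)) (by fun_prop) μ _)
    (fun x => (J.gryz i j).integrable_bounded (f := fun y => (((a.1, x), y), a.2))
      (by fun_prop) μ _)
    (fun x => (J.gryz i j).integrable_bounded (f := fun z : Eu n × Eu n => (((a.1, x), z.1), z.2))
      (by fun_prop) μ _)
    (fun x => (J.grF3yz i j).integrable_bounded (f := fun z : Eu n × Eu n =>
      ((((a.1, x), z.1), z.2), a.2)) (by fun_prop) μ _)).trans ?_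
  have e : ∀ z : Eu n × Eu n, J.Fyz i j (((a.1, z.1), z.2), a.2) μ =
    J.Fyz j i (((a.1, z.1), a.2), z.2) μ := fun z => J.Fyz_symm i j _ μ
  simp only [e, F2xz, swapLast]

/-- Compared with `integral_dgen3_exch`, the terms in `∂_{yz} δ_{μμ} F` and in `∂_{xz} δ_{μμ} F`
have changed places, and so have the indices of `Fxy`: the averaged state of `F` is a population
variable for `W`. The two expressions agree only after adding the transposed indices. -/
lemma gen3_preW : J.preW.jet.gen3 i j a μ =
    1 / 2 * ((∫ z, J.F2xz i j (((a.1, z.1), a.2), z.2) μ ∂(μ.meas.prod μ.meas))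
      + (∫ z, J.F2xz j i (((a.1, z.1), a.2), z.2) μ ∂(μ.meas.prod μ.meas))
      + ∫ z : Eu n × Eu n × Eu n, (J.F3yz i j ((((a.1, z.1), z.2.1), z.2.2), a.2) μ
        - 2 * J.Fyz i j (((a.1, z.1), z.2.1), z.2.2) μ) ∂(μ.meas.prod (μ.meas.prod μ.meas)))
    + ((∫ y, J.Fxy j i ((a.1, y), a.2) μ ∂μ.meas)
      + ∫ z, J.Fyz i j (((a.1, z.1), a.2), z.2) μ ∂(μ.meas.prod μ.meas)) := by
  have := μ.prob
  have h1 := integral_common_identity' (m := μ.meas)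
    (k := fun z => J.F2xz i j (((a.1, z.1), a.2), z.2) μ)
    (k' := fun z => J.F2xz j i (((a.1, z.1), a.2), z.2) μ)
    ((J.grF2xz i j).integrable_bounded (f := fun z : Eu n × Eu n => (((a.1, z.1), a.2), z.2))
      (by fun_prop) μ _)
    ((J.grF2xz j i).integrable_bounded (f := fun z : Eu n × Eu n => (((a.1, z.1), a.2), z.2))
      (by fun_prop) μ _) (J.integrable_common_q i j a μ)
  have hp : Integrable (fun z : Eu n × Eu n => J.Fyz i j (((a.1, z.1), a.2), z.2) μ)
    (μ.meas.prod μ.meas) := (J.gryz i j).integrable_bounded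
      (f := fun z : Eu n × Eu n => (((a.1, z.1), a.2), z.2)) (by fun_prop) μ _
  rw [← h1, integral_prod_symm _ hp, ← integral_add ((J.grxy j i).integrable_bounded
    (f := fun y => ((a.1, y), a.2)) (by fun_prop) μ _) hp.integral_prod_right]
  rfl

lemma integral_dgen3_exch_symm :
    (∫ y, J.dgen3 i j (exch (a, y)) μ ∂μ.meas) + ∫ y, J.dgen3 j i (exch (a, y)) μ ∂μ.meas =
      J.preW.jet.gen3 i j a μ + J.preW.jet.gen3 j i a μ := by
  rw [integral_dgen3_exch, integral_dgen3_exch, gen3_preW, gen3_preW]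
  ring

lemma integrable_diag_q : Integrable (fun z : Eu n × Eu n × Eu n =>
    J.F3yz i j ((((a.1, z.1), z.2.1), z.2.2), z.1) μ - 2 * J.Fyz i j (((a.1, z.1), z.2.1), z.2.2) μ)
      (μ.meas.prod (μ.meas.prod μ.meas)) := by
  have := μ.prob
  exact ((J.grF3yz i j).integrable_bounded (f := fun z : Eu n × Eu n × Eu n =>
    ((((a.1, z.1), z.2.1), z.2.2), z.1)) (by fun_prop) μ _).sub
    (((J.gryz i j).integrable_bounded (f := fun z : Eu n × Eu n × Eu n =>
    (((a.1, z.1), z.2.1), z.2.2)) (by fun_prop) μ _).const_mul 2)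

lemma integral_dgen3_diag : ∫ y, J.dgen3 i j (diag (a, y)) μ ∂μ.meas =
    1 / 2 * ((∫ z, J.Fyz i j (((a.1, z.1), z.1), z.2) μ ∂(μ.meas.prod μ.meas))
      + (∫ z, J.Fyz j i (((a.1, z.1), z.1), z.2) μ ∂(μ.meas.prod μ.meas))
      + ∫ z : Eu n × Eu n × Eu n, (J.F3yz i j ((((a.1, z.1), z.2.1), z.2.2), z.1) μ
        - 2 * J.Fyz i j (((a.1, z.1), z.2.1), z.2.2) μ) ∂(μ.meas.prod (μ.meas.prod μ.meas)))
    + ((∫ y, J.Fxy i j ((a.1, y), y) μ ∂μ.meas)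
      + ∫ z, J.F2xz i j (((a.1, z.1), z.1), z.2) μ ∂(μ.meas.prod μ.meas)) := by
  have := μ.prob
  refine (integral_common_identity (m := μ.meas)
    (u := fun y => J.Fxy i j ((a.1, y), y) μ)
    (p := fun z => J.Fyz i j (((a.1, z.1), z.1), z.2) μ)
    (r := fun z => J.Fyz i j (((a.1, z.1), z.2), z.1) μ)
    (v := fun z => J.Fxy i j ((a.1, z.1), z.2) μ)
    (o := fun z => J.F2xy i j (((a.1, z.1), z.2), z.1) μ)
    (q := fun z => J.Fyz i j (((a.1, z.1), z.2.1), z.2.2) μ)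
    (s := fun z => J.F3yz i j ((((a.1, z.1), z.2.1), z.2.2), z.1) μ)
    ((J.grxy i j).integrable_bounded (f := fun y => ((a.1, y), y)) (by fun_prop) μ _)
    ((J.gryz i j).integrable_bounded (f := fun z : Eu n × Eu n => (((a.1, z.1), z.1), z.2))
      (by fun_prop) μ _)
    ((J.gryz i j).integrable_bounded (f := fun z : Eu n × Eu n => (((a.1, z.1), z.2), z.1))
      (by fun_prop) μ _)
    ((J.grxy i j).integrable_bounded (f := fun z : Eu n × Eu n => ((a.1, z.1), z.2))
      (by fun_prop) μ _)
    ((J.grF2xy i j).integrable_bounded (f := fun z : Eu n × Eu n => (((a.1, z.1), z.2), z.1))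
      (by fun_prop) μ _)
    ((J.gryz i j).integrable_bounded (f := fun z : Eu n × Eu n × Eu n =>
      (((a.1, z.1), z.2.1), z.2.2)) (by fun_prop) μ _)
    ((J.grF3yz i j).integrable_bounded (f := fun z : Eu n × Eu n × Eu n =>
      ((((a.1, z.1), z.2.1), z.2.2), z.1)) (by fun_prop) μ _)
    (fun x => (J.gryz i j).integrable_bounded (f := fun y => (((a.1, x), y), x))
      (by fun_prop) μ _)
    (fun x => (J.gryz i j).integrable_bounded (f := fun z : Eu n × Eu n => (((a.1, x), z.1), z.2))
      (by fun_prop) μ _)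
    (fun x => (J.grF3yz i j).integrable_bounded (f := fun z : Eu n × Eu n =>
      ((((a.1, x), z.1), z.2), x)) (by fun_prop) μ _)).trans ?_
  have e : ∀ z : Eu n × Eu n, J.Fyz i j (((a.1, z.1), z.2), z.1) μ =
    J.Fyz j i (((a.1, z.1), z.1), z.2) μ := fun z => J.Fyz_symm i j _ μ
  simp only [e, F2xz, swapLast]

lemma gen3_preD : J.preD.jet.gen3 i j a μ =
    1 / 2 * (((∫ z, J.F2xz i j (((a.1, z.1), z.1), z.2) μ ∂(μ.meas.prod μ.meas))
        + ∫ z, J.Fyz i j (((a.1, z.1), z.1), z.2) μ ∂(μ.meas.prod μ.meas))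
      + ((∫ z, J.F2xz j i (((a.1, z.1), z.1), z.2) μ ∂(μ.meas.prod μ.meas))
        + ∫ z, J.Fyz j i (((a.1, z.1), z.1), z.2) μ ∂(μ.meas.prod μ.meas))
      + ∫ z : Eu n × Eu n × Eu n, (J.F3yz i j ((((a.1, z.1), z.2.1), z.2.2), z.1) μ
        - 2 * J.Fyz i j (((a.1, z.1), z.2.1), z.2.2) μ) ∂(μ.meas.prod (μ.meas.prod μ.meas))) := by
  have := μ.prob
  have hk : ∀ i j, Integrable (fun z : Eu n × Eu n => J.F2xz i j (((a.1, z.1), z.1), z.2) μ)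
    (μ.meas.prod μ.meas) := fun i j => (J.grF2xz i j).integrable_bounded
      (f := fun z : Eu n × Eu n => (((a.1, z.1), z.1), z.2)) (by fun_prop) μ _
  have hp : ∀ i j, Integrable (fun z : Eu n × Eu n => J.Fyz i j (((a.1, z.1), z.1), z.2) μ)
    (μ.meas.prod μ.meas) := fun i j => (J.gryz i j).integrable_bounded
      (f := fun z : Eu n × Eu n => (((a.1, z.1), z.1), z.2)) (by fun_prop) μ _
  have h1 := integral_common_identity' (m := μ.meas)
    (k := fun z => J.F2xz i j (((a.1, z.1), z.1), z.2) μ + J.Fyz i j (((a.1, z.1), z.1), z.2) μ)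
    (k' := fun z => J.F2xz j i (((a.1, z.1), z.1), z.2) μ + J.Fyz j i (((a.1, z.1), z.1), z.2) μ)
    ((hk i j).add (hp i j)) ((hk j i).add (hp j i)) (J.integrable_diag_q i j a μ)
  rw [← integral_add (hk i j) (hp i j), ← integral_add (hk j i) (hp j i),
    ← h1]
  simp only [Jet.gen3, Jet.pop3, Pre.jet, preD, integral_zero, add_zero]
  rfl

/-- `D` does not depend on the state, so its generator has no state–population term. The
contribution of `∂_{xy} δ_μ F` on the diagonal is therefore left over. -/
lemma integral_dgen3_diag_symm :
    (∫ y, J.dgen3 i j (diag (a, y)) μ ∂μ.meas) + ∫ y, J.dgen3 j i (diag (a, y)) μ ∂μ.meas =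
      J.preD.jet.gen3 i j a μ + J.preD.jet.gen3 j i a μ +
        ∫ y, (J.Fxy i j ((a.1, y), y) μ + J.Fxy j i ((a.1, y), y) μ) ∂μ.meas := by
  have := μ.prob
  rw [integral_dgen3_diag, integral_dgen3_diag, gen3_preD, gen3_preD,
    integral_add ((J.grxy i j).integrable_bounded (f := fun y => ((a.1, y), y)) (by fun_prop) μ _)
    ((J.grxy j i).integrable_bounded (f := fun y => ((a.1, y), y)) (by fun_prop) μ _)]
  ring

end Common

end VJet

end SocialMFC

/-! ### The equations of the two averages of `δ_μ V`. -/

namespace SocialMFC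
variable {n : ℕ}

lemma pair_symm_part {A : Matrix (Fin n) (Fin n) ℝ} (hA : A.transpose = A)
    (B : Fin n → Fin n → ℝ) : pair A B = 1 / 2 * pair A (fun i j => B i j + B j i) := by
  rw [pair_add, pair_swap hA]
  ring

namespace VJet

variable {F : TX n → P2 n → ℝ} (J : VJet F) {b : Fin n → TX n → P2 n → ℝ}
  {db : Fin n → TX n × Eu n → P2 n → ℝ} {A A₀ : Matrix (Fin n) (Fin n) ℝ}

/-- `δ_μ` of the generator. -/
def dgen (A A₀ : Matrix (Fin n) (Fin n) ℝ) (b : Fin n → TX n → P2 n → ℝ)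
    (db : Fin n → TX n × Eu n → P2 n → ℝ) (a : TX n × Eu n) (μ : P2 n) : ℝ :=
  ∑ i, J.dgen1 b db i a μ + 1 / 2 * pair A (fun i j => J.dgen2 i j a μ)
    + pair A₀ (fun i j => J.dgen3 i j a μ)

lemma md_gen (hb : ∀ i, Gr 1 (b i)) (hdb : ∀ i, Gr 1 (db i)) (h : ∀ i, MD (b i) (db i)) :
    MD (J.gen A A₀ b) (J.dgen A A₀ b db) :=
  ((MD.sum _ fun i => J.md_gen1 hb hdb h i).add ((MD.pair A J.md_gen2).const_mul (1 / 2))).add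
    (MD.pair A₀ J.md_gen3)

lemma integral_dgen {κ : TX n × Eu n → TX n × Eu n} (hκ : Lin κ) (hb : ∀ i, Gr 1 (b i))
    (hdb : ∀ i, Gr 1 (db i)) (a : TX n) (μ : P2 n) :
    ∫ y, J.dgen A A₀ b db (κ (a, y)) μ ∂μ.meas =
      ∑ i, (∫ y, J.dgen1 b db i (κ (a, y)) μ ∂μ.meas)
      + 1 / 2 * pair A (fun i j => ∫ y, J.dgen2 i j (κ (a, y)) μ ∂μ.meas)
      + pair A₀ (fun i j => ∫ y, J.dgen3 i j (κ (a, y)) μ ∂μ.meas) := by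
  have h1 : ∀ i, Integrable (fun y => J.dgen1 b db i (κ (a, y)) μ) μ.meas := fun i =>
    ((J.gr_dgen1 hb hdb i).comp hκ).integrable le_rfl a μ μ
  have h2 : ∀ i j, Integrable (fun y => J.dgen2 i j (κ (a, y)) μ) μ.meas := fun i j =>
    ((J.gr_dgen2 i j).comp hκ).integrable le_rfl a μ μ
  have h3 : ∀ i j, Integrable (fun y => J.dgen3 i j (κ (a, y)) μ) μ.meas := fun i j =>
    ((J.gr_dgen3 i j).comp hκ).integrable le_rfl a μ μ
  have s1 := integrable_finsetSum Finset.univ fun i _ => h1 i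
  have s2 := (integrable_pair A h2).const_mul (1 / 2)
  have s3 := integrable_pair A₀ h3
  simp only [dgen]
  rw [integral_add (by exact s1.add s2) s3, integral_add s1 s2,
    integral_finsetSum _ fun i _ => h1 i, integral_const_mul, integral_pair _ _ h2,
    integral_pair _ _ h3]

section Equation

variable {Vt ℓ : TX n → P2 n → ℝ} {V1t dℓ : TX n × Eu n → P2 n → ℝ}

/-- The left side of `E` is the zero function of the measure, so its measure derivative vanishes by
uniqueness. The map `κ` stands for `exch` or `diag`. -/
lemma integral_equation {κ : TX n × Eu n → TX n × Eu n} (hκ : Lin κ) (hb : ∀ i, Gr 1 (b i))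
    (hdb : ∀ i, Gr 1 (db i)) (hmb : ∀ i, MD (b i) (db i)) (hVt : MD Vt V1t) (hℓ : MD ℓ dℓ)
    (gVt : Gr 2 V1t) (gℓ : Gr 2 dℓ)
    (E : ∀ a μ, Vt a μ + J.gen A A₀ b a μ + ℓ a μ = 0) (a : TX n) (μ : P2 n) :
    (∫ y, V1t (κ (a, y)) μ ∂μ.meas)
      + (∑ i, (∫ y, J.dgen1 b db i (κ (a, y)) μ ∂μ.meas)
      + 1 / 2 * pair A (fun i j => ∫ y, J.dgen2 i j (κ (a, y)) μ ∂μ.meas)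
      + pair A₀ (fun i j => ∫ y, J.dgen3 i j (κ (a, y)) μ ∂μ.meas))
      + ∫ y, dℓ (κ (a, y)) μ ∂μ.meas = 0 := by
  have gg : Gr 2 (J.dgen A A₀ b db) :=
    ((Gr.sum _ fun i => J.gr_dgen1 hb hdb i).add
      ((Gr.pair A J.gr_dgen2).const_mul (1 / 2))).add (Gr.pair A₀ J.gr_dgen3)
  have h0 : ∀ (a : TX n × Eu n) (μ : P2 n), V1t a μ + J.dgen A A₀ b db a μ + dℓ a μ = 0 := by
    intro a μ
    have h1 : MD (fun a μ => Vt a μ + J.gen A A₀ b a μ + ℓ a μ)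
        (fun a μ => V1t a μ + J.dgen A A₀ b db a μ + dℓ a μ) :=
      (hVt.add (J.md_gen hb hdb hmb)).add hℓ
    have e : (fun a μ => Vt a μ + J.gen A A₀ b a μ + ℓ a μ) = fun _ _ => (0 : ℝ) := by
      funext a μ; exact E a μ
    rw [e] at h1
    exact h1.unique (G' := fun _ _ => 0) (fun x μ => HasMDeriv.const 0 μ) a μ
  have i1 := (gVt.comp hκ).integrable le_rfl a μ μ
  have i2 := (gg.comp hκ).integrable le_rfl a μ μ
  have i3 := (gℓ.comp hκ).integrable le_rfl a μ μ
  rw [← J.integral_dgen hκ hb hdb, ← integral_add i1 i2, ← integral_add (by exact i1.add i2) i3]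
  simp only [h0, integral_zero]

lemma equation_exch (hb : ∀ i, Gr 1 (b i))
    (hdb : ∀ i, Gr 1 (db i)) (hmb : ∀ i, MD (b i) (db i)) (hVt : MD Vt V1t) (hℓ : MD ℓ dℓ)
    (gVt : Gr 2 V1t) (gℓ : Gr 2 dℓ) (hA₀ : A₀.transpose = A₀)
    (E : ∀ a μ, Vt a μ + J.gen A A₀ b a μ + ℓ a μ = 0) (a : TX n) (μ : P2 n) :
    (∫ y, V1t (exch (a, y)) μ ∂μ.meas) + J.preW.jet.gen A A₀ b a μ
      + (∑ i, ((∫ y, J.Fx i (a.1, y) μ * db i ((a.1, y), a.2) μ ∂μ.meas) +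
        ∫ z, ∫ y, J.Fy i ((a.1, y), z) μ * db i ((a.1, z), a.2) μ ∂μ.meas ∂μ.meas))
      + ∫ y, dℓ (exch (a, y)) μ ∂μ.meas = 0 := by
  have h := J.integral_equation lin_exch hb hdb hmb hVt hℓ gVt gℓ E a μ
  rw [pair_symm_part hA₀] at h
  simp only [J.integral_dgen1_exch hb hdb, J.integral_dgen2_exch,
    J.integral_dgen3_exch_symm, Finset.sum_add_distrib] at h
  rw [← pair_symm_part hA₀] at h
  simp only [Jet.gen, Finset.sum_add_distrib]
  linarith

/-- The cross terms enter with weight `A` from the second order part and with weight `A₀` and the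
opposite sign from the common noise part. For `A = Σ + Σ₀` and `A₀ = Σ₀` only `Σ` remains. -/
lemma equation_diag (hb : ∀ i, Gr 1 (b i))
    (hdb : ∀ i, Gr 1 (db i)) (hmb : ∀ i, MD (b i) (db i)) (hVt : MD Vt V1t) (hℓ : MD ℓ dℓ)
    (gVt : Gr 2 V1t) (gℓ : Gr 2 dℓ) (hA₀ : A₀.transpose = A₀)
    (E : ∀ a μ, Vt a μ + J.gen A A₀ b a μ + ℓ a μ = 0) (a : TX n) (μ : P2 n) :
    (∫ y, V1t (diag (a, y)) μ ∂μ.meas) + J.preD.jet.gen A A₀ b a μ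
      - 1 / 2 * (pair A (fun i j =>
          ∫ y, (J.Fxy i j ((a.1, y), y) μ + J.Fxy j i ((a.1, y), y) μ) ∂μ.meas)
        - pair A₀ (fun i j =>
          ∫ y, (J.Fxy i j ((a.1, y), y) μ + J.Fxy j i ((a.1, y), y) μ) ∂μ.meas))
      + (∑ i, ((∫ y, J.Fx i (a.1, y) μ * db i ((a.1, y), y) μ ∂μ.meas) +
        ∫ z, ∫ y, J.Fy i ((a.1, y), z) μ * db i ((a.1, z), y) μ ∂μ.meas ∂μ.meas))
      + ∫ y, dℓ (diag (a, y)) μ ∂μ.meas = 0 := by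
  have h := J.integral_equation lin_diag hb hdb hmb hVt hℓ gVt gℓ E a μ
  -- `A₀` is symmetric, so the common noise part may be symmetrized; only in that form are its
  -- averages known.
  rw [pair_symm_part hA₀] at h
  simp only [J.integral_dgen1_diag hb hdb, J.integral_dgen2_diag,
    J.integral_dgen3_diag_symm, Finset.sum_add_distrib] at h
  rw [pair_add, pair_sub, mul_add (1 / 2 : ℝ) (pair A₀ _) (pair A₀ _), ← pair_symm_part hA₀] at h
  simp only [Jet.gen, Finset.sum_add_distrib]
  linarith

/-- The difference of the leftovers of `W` and `D` has `δ_μ f*(z;y)` under the double integral where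
the left side has `δ_μ f*(z;z)`. The last term is the one supplied by the equation of `M`. -/
lemma integral_ubar_drift (hdb : ∀ i, Gr 1 (db i)) (i : Fin n) (a : TX n) (μ : P2 n) :
    ∫ z, J.preU.jet.Fy i (a, z) μ * (db i ((a.1, z), a.2) μ - db i ((a.1, z), z) μ) ∂μ.meas =
      ((∫ y, J.Fx i (a.1, y) μ * db i ((a.1, y), a.2) μ ∂μ.meas) +
        ∫ z, ∫ y, J.Fy i ((a.1, y), z) μ * db i ((a.1, z), a.2) μ ∂μ.meas ∂μ.meas)
      - ((∫ y, J.Fx i (a.1, y) μ * db i ((a.1, y), y) μ ∂μ.meas) +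
        ∫ z, ∫ y, J.Fy i ((a.1, y), z) μ * db i ((a.1, z), y) μ ∂μ.meas ∂μ.meas)
      + ∫ z, ∫ y, J.Fy i ((a.1, y), z) μ * (db i ((a.1, z), y) μ - db i ((a.1, z), z) μ)
          ∂μ.meas ∂μ.meas := by
  have := μ.prob
  have g1 : Gr 2 (fun (a : TX n × Eu n) μ => J.Fx i (proj a) μ * db i (exch a) μ) :=
    ((J.grx i).comp lin_proj).mul ((hdb i).comp lin_exch)
  have g2 : Gr 2 (fun (a : TX n × Eu n) μ => J.Fx i (proj a) μ * db i (diag a) μ) :=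
    ((J.grx i).comp lin_proj).mul ((hdb i).comp lin_diag)
  have gy : Gr 1 (fun (a : (TX n × Eu n) × Eu n) μ => J.Fy i (proj (swapLast a).1, a.1.2) μ) :=
    (J.gry i).comp (A := fun a : (TX n × Eu n) × Eu n => (proj (swapLast a).1, a.1.2))
      ⟨fun _ _ _ => rfl, by unfold proj swapLast; fun_prop⟩
  have k1 : Gr 2 (fun (a : (TX n × Eu n) × Eu n) μ =>
      J.Fy i (proj (swapLast a).1, a.1.2) μ * db i (exch a.1) μ) :=
    gy.mul ((hdb i).comp (A := fun a : (TX n × Eu n) × Eu n => exch a.1)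
      ⟨fun _ _ _ => rfl, by unfold exch; fun_prop⟩)
  have k2 : Gr 2 (fun (a : (TX n × Eu n) × Eu n) μ =>
      J.Fy i (proj (swapLast a).1, a.1.2) μ * db i (diag a.1) μ) :=
    gy.mul ((hdb i).comp (A := fun a : (TX n × Eu n) × Eu n => diag a.1)
      ⟨fun _ _ _ => rfl, by unfold diag; fun_prop⟩)
  have k3 : Gr 2 (fun (a : (TX n × Eu n) × Eu n) μ =>
      J.Fy i (proj (swapLast a).1, a.1.2) μ * db i (proj a.1, a.2) μ) :=
    gy.mul ((hdb i).comp lin_proj.map_fst)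
  have s2 := fun z => k2.integrable le_rfl (a, z) μ μ
  have s3 := fun z => k3.integrable le_rfl (a, z) μ μ
  have i1 := g1.integrable le_rfl a μ μ
  have i2 := g2.integrable le_rfl a μ μ
  have j1 := (k1.integral le_rfl).integrable le_rfl a μ μ
  have j2 := (k2.integral le_rfl).integrable le_rfl a μ μ
  have j3 := (k3.integral le_rfl).integrable le_rfl a μ μ
  simp only [Pre.jet, preU, proj, exch, diag, swapLast] at *
  simp only [mul_sub, add_mul, ← integral_mul_const]
  have e : ∀ z, ∫ y, (J.Fy i ((a.1, y), z) μ * db i ((a.1, z), y) μ -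
      J.Fy i ((a.1, y), z) μ * db i ((a.1, z), z) μ) ∂μ.meas =
      (∫ y, J.Fy i ((a.1, y), z) μ * db i ((a.1, z), y) μ ∂μ.meas) -
      ∫ y, J.Fy i ((a.1, y), z) μ * db i ((a.1, z), z) μ ∂μ.meas := fun z =>
    integral_sub (s3 z) (s2 z)
  simp only [e]
  rw [integral_sub (by exact i1.add j1) (by exact i2.add j2), integral_add i1 j1,
    integral_add i2 j2, integral_sub j3 j2]
  ring

/-- Differentiating `Ū` twice in the measure lets either variable be the state of `F`, which gives
the two cross terms; differentiating `F` itself twice gives the remaining average, which comes from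
the equation of `M`. -/
lemma integral_ubar_noise (i j : Fin n) (a : TX n) (μ : P2 n) :
    ∫ z, J.preU.jet.Fyz i j ((a, z), z) μ ∂μ.meas =
      (∫ y, (J.Fxy i j ((a.1, y), y) μ + J.Fxy j i ((a.1, y), y) μ) ∂μ.meas)
      + ∫ z, ∫ y, J.Fyz i j (((a.1, y), z), z) μ ∂μ.meas ∂μ.meas := by
  have := μ.prob
  have i1 := (J.grxy i j).integrable_bounded (f := fun y => diag (a, y))
    (by unfold diag; fun_prop) μ μ.meas
  have i2 := (J.grxy j i).integrable_bounded (f := fun y => diag (a, y))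
    (by unfold diag; fun_prop) μ μ.meas
  have h3 : Integrable (fun z : Eu n × Eu n => J.Fyz i j (((a.1, z.2), z.1), z.1) μ)
    (μ.meas.prod μ.meas) := (J.gryz i j).integrable_bounded
      (f := fun z : Eu n × Eu n => (((a.1, z.2), z.1), z.1)) (by fun_prop) μ _
  have i3 := h3.integral_prod_left
  simp only [diag] at i1 i2
  exact integral_add (i1.add i2) i3

end Equation

end VJet

end SocialMFC

namespace SocialMFC
variable {n : ℕ}

/-! ### Time derivatives -/

section Time

variable {T : ℝ} {V : ℝ → Eu n → P2 n → ℝ} {M : ℝ → P2 n → ℝ}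

/-- `∂_t V` with clamped time. -/
def vt (T : ℝ) (V : ℝ → Eu n → P2 n → ℝ) : TX n → P2 n → ℝ :=
  fun a μ => dt T (fun s => V s a.2 μ) (tc T a.1)

/-- `∂_t δ_μ V` with clamped time. -/
def v1t (T : ℝ) (V : ℝ → Eu n → P2 n → ℝ) : TX n × Eu n → P2 n → ℝ :=
  fun a μ => dt T (fun s => mderiv (V s a.1.2) μ a.2) (tc T a.1.1)

lemma TDiff.hasDerivWithinAt {ψ : ℝ → ℝ} (h : TDiff T ψ) {t : ℝ} (ht : t ∈ Icc 0 T) :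
    HasDerivWithinAt ψ (dt T ψ t) (Icc 0 T) t := (h t ht).hasDerivWithinAt

lemma neBot_icc_diff (hT : 0 < T) {t : ℝ} (ht : t ∈ Icc 0 T) :
    (𝓝[Icc 0 T \ {t}] t).NeBot :=
  accPt_principal_iff_nhdsWithin.1 (uniqueDiffWithinAt_iff_accPt.1 (uniqueDiffOn_Icc hT t ht))

lemma ClassV.gr_v1t (hT : 0 ≤ T) (h : ClassV T V) : Gr 2 (v1t T V) := by
  obtain ⟨C, hC⟩ := h.growth'
  refine gr_two ((h.cont_t_m.continuous hT).comp
    (f := fun a : (TX n × Eu n) × P2 n => (a.1.1.1, (a.1.1.2, a.2, a.1.2))) (by fun_prop))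
    continuous_m1_sq m1_sq_nonneg (fun a => ‖a.1.2‖ ^ 2 + ‖a.2‖ ^ 2) (fun a => by positivity)
    (fun a => ?_) (fun a μ => ((hC _ (tc_mem hT _) a.1.2 μ a.2 0 0).2.2.2.1).trans_eq (by ring))
  have h1 := sq_norm_le (norm_le_1 a).1
  have h2 := sq_norm_le (norm_le_1 a).2
  linarith [sq_nonneg ‖a‖]

lemma ClassV.md_vt (hT : 0 < T) (h : ClassV T V) : MD (vt T V) (v1t T V) := by
  intro a μ
  obtain ⟨-, K, hK, hb⟩ := h.gr_v1t hT.le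
  have hmem := tc_mem hT.le a.1
  have := neBot_icc_diff hT hmem
  refine hasMDeriv_deriv (convex_Icc 0 T) (F := fun t ν => V t a.2 ν)
    (R := fun t ν => dt T (fun s => V s a.2 ν) t) (F' := fun t ν => mderiv (V t a.2) ν)
    (Q := fun t ν y => dt T (fun s => mderiv (V s a.2) ν y) t)
    (K := fun ν => K ν * (1 + (T + ‖a.2‖)) ^ 2 * 2)
    (fun t ht ν => hasMDeriv_mderiv ((h.regular.mdiff t ht _).1 ν)) hmem
    (fun ν => (h.regular.tdiff a.2 ν).hasDerivWithinAt hmem)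
    (fun t ht ν y => (h.t_m a.2 ν y).hasDerivWithinAt ht) ?_ (by fun_prop) (fun t ht ν y => ?_) μ
  · exact h.cont_t_m.comp (f := fun p : ℝ × P2 n × Eu n => (p.1, (a.2, p.2.1, p.2.2)))
      (by fun_prop) fun p hp => ⟨hp.1, mem_univ _⟩
  · have h1 := Gr.abs_prod_le le_rfl hb (t, a.2) y ν
    simp only [v1t, tc_of_mem ht] at h1
    refine h1.trans ?_
    have h2 : ‖(t, a.2)‖ ≤ T + ‖a.2‖ := by
      refine (norm_prod_le_iff).2 ⟨?_, ?_⟩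
      · simp only [Real.norm_eq_abs, abs_of_nonneg ht.1]
        linarith [ht.2, norm_nonneg a.2]
      · simp only
        linarith
    have h3 := Gr.nonneg_of_bound hb ν
    gcongr

/-- `c` is constant for the exchanged integrand and the identity for the diagonal one, so one
argument gives the time derivatives of both `W` and `D`. -/
lemma ClassV.hasDerivWithinAt_integral_mderiv (hT : 0 ≤ T) (h : ClassV T V)
    {κ : TX n × Eu n → TX n × Eu n} (hκ : Lin κ) {c : Eu n → Eu n} {x : Eu n}
    (e : ∀ t y, κ ((t, x), y) = ((t, y), c y)) (μ : P2 n) {t : ℝ} (ht : t ∈ Icc 0 T) :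
    HasDerivWithinAt (fun s => ∫ y, mderiv (V s y) μ (c y) ∂μ.meas)
      (∫ y, v1t T V (κ ((t, x), y)) μ ∂μ.meas) (Icc 0 T) t := by
  obtain ⟨hc, K, hK, hb⟩ := (h.gr_v1t hT).comp hκ
  have h0 := hasDerivWithinAt_integral (convex_Icc 0 T) (m := μ.meas)
    (F := fun s y => mderiv (V s y) μ (c y))
    (F' := fun s y => dt T (fun r => mderiv (V r y) μ (c y)) s)
    (bound := fun y => K μ * (1 + (T + ‖x‖)) ^ 2 * 2 * (1 + ‖y‖ ^ 2)) ht ?_ ?_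
    (μ.integrable_one_add_sq.const_mul _) ?_
  · simpa only [v1t, e, tc_of_mem ht] using h0
  · intro s hs
    have h1 := ((h.vjet hT).gr1.comp hκ).integrable le_rfl (s, x) μ μ
    simpa only [e, ClassV.vjet, MasterRegular.jet, tc_of_mem hs] using h1
  · intro s hs y
    exact (h.t_m y μ (c y)).hasDerivWithinAt hs
  · intro s hs y
    have h1 := Gr.abs_prod_le le_rfl hb (s, x) y μ
    simp only [v1t, e, tc_of_mem hs] at h1
    refine h1.trans ?_
    have h2 : ‖(s, x)‖ ≤ T + ‖x‖ := by
      refine (norm_prod_le_iff).2 ⟨?_, ?_⟩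
      · simp only [Real.norm_eq_abs, abs_of_nonneg hs.1]
        linarith [hs.2, norm_nonneg x]
      · simp only
        linarith
    have h3 := Gr.nonneg_of_bound hb μ
    gcongr

/-- The regularity data of the instrumental value function. -/
def ClassV.ivfJet (hT : 0 ≤ T) (hV : ClassV T V) (hM : ClassM T M) :
    Jet (fun a μ => (ext T V a μ + M (tc T a.1) μ) +
      (Pre.int (fun a μ => (hV.vjet hT).F1 (VJet.exch a) μ) a μ -
        Pre.int (fun a μ => (hV.vjet hT).F1 (VJet.diag a) μ) a μ)) :=
  ((hV.vjet hT).toJet.add (hM.jet hT)).add ((hV.vjet hT).preW.jet.sub (hV.vjet hT).preD.jet)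

lemma ClassV.ivf_split (hT : 0 ≤ T) (hV : ClassV T V) {t : ℝ} (ht : t ∈ Icc 0 T) (x : Eu n)
    (μ : P2 n) : IVF V M t x μ = (V t x μ + M t μ) +
      ((∫ y, mderiv (V t y) μ x ∂μ.meas) - ∫ y, mderiv (V t y) μ y ∂μ.meas) := by
  have h1 := ((hV.vjet hT).gr1.comp VJet.lin_exch).integrable le_rfl (t, x) μ μ
  have h2 := ((hV.vjet hT).gr1.comp VJet.lin_diag).integrable le_rfl (t, x) μ μ
  simp only [ClassV.vjet, MasterRegular.jet, VJet.exch, VJet.diag, tc_of_mem ht] at h1 h2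
  rw [IVF, integral_sub h1 h2]

lemma ClassV.ivf_eq (hT : 0 ≤ T) (hV : ClassV T V) {t : ℝ} (ht : t ∈ Icc 0 T) (x : Eu n) :
    IVF V M t x = fun μ => (ext T V (t, x) μ + M (tc T t) μ) +
      (Pre.int (fun a μ => (hV.vjet hT).F1 (VJet.exch a) μ) (t, x) μ -
        Pre.int (fun a μ => (hV.vjet hT).F1 (VJet.diag a) μ) (t, x) μ) := by
  funext μ
  rw [hV.ivf_split hT ht]
  simp only [ext, Pre.int, ClassV.vjet, MasterRegular.jet, VJet.exch, VJet.diag, tc_of_mem ht]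

lemma ClassV.hasDerivWithinAt_ivf (hT : 0 ≤ T) (hV : ClassV T V) (hM : ClassM T M) (x : Eu n)
    (μ : P2 n) {t : ℝ} (ht : t ∈ Icc 0 T) :
    HasDerivWithinAt (fun s => IVF V M s x μ)
      (vt T V (t, x) μ + dt T (fun s => M s μ) (tc T t) +
        ((∫ y, v1t T V (VJet.exch ((t, x), y)) μ ∂μ.meas)
          - ∫ y, v1t T V (VJet.diag ((t, x), y)) μ ∂μ.meas)) (Icc 0 T) t := by
  have h1 := (hV.regular.tdiff x μ).hasDerivWithinAt ht
  have h2 := (hM.tdiff μ).hasDerivWithinAt ht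
  have h3 := hV.hasDerivWithinAt_integral_mderiv hT VJet.lin_exch (c := fun _ => x) (x := x)
    (fun _ _ => rfl) μ ht
  have h4 := hV.hasDerivWithinAt_integral_mderiv hT VJet.lin_diag (c := fun y => y) (x := x)
    (fun _ _ => rfl) μ ht
  have h5 := (h1.add h2).add (h3.sub h4)
  simp only [vt, tc_of_mem ht]
  exact h5.congr (fun s hs => hV.ivf_split hT hs x μ) (hV.ivf_split hT ht x μ)

lemma ClassV.dt_ivf (hT : 0 < T) (hV : ClassV T V) (hM : ClassM T M) (x : Eu n)
    (μ : P2 n) {t : ℝ} (ht : t ∈ Icc 0 T) : dt T (fun s => IVF V M s x μ) t =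
      vt T V (t, x) μ + dt T (fun s => M s μ) (tc T t) +
        ((∫ y, v1t T V (VJet.exch ((t, x), y)) μ ∂μ.meas)
          - ∫ y, v1t T V (VJet.diag ((t, x), y)) μ ∂μ.meas) :=
  (hV.hasDerivWithinAt_ivf hT.le hM x μ ht).derivWithin (uniqueDiffOn_Icc hT t ht)

lemma ClassV.ivf_regular (hT : 0 < T) (hV : ClassV T V) (hM : ClassM T M) :
    MasterRegular T (IVF V M) := by
  refine (hV.ivfJet hT.le hM).masterRegular (fun t ht x => hV.ivf_eq hT.le ht x)
    (fun x μ t ht => (hV.hasDerivWithinAt_ivf hT.le hM x μ ht).differentiableWithinAt) ?_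
  refine jointCont_of_continuous (G' := fun t (a : Eu n × P2 n) =>
    vt T V (t, a.1) a.2 + dt T (fun s => M s a.2) (tc T t) +
        ((∫ y, v1t T V (VJet.exch ((t, a.1), y)) a.2 ∂a.2.meas)
          - ∫ y, v1t T V (VJet.diag ((t, a.1), y)) a.2 ∂a.2.meas)) ?_
    fun t ht a => hV.dt_ivf hT hM a.1 a.2 ht
  have hf : Continuous (fun q : ℝ × Eu n × P2 n => (((q.1, q.2.1) : TX n), q.2.2)) := by fun_prop
  exact ((hV.regular.cont_t.continuous hT.le).add ((hM.cont_t.continuous hT.le).comp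
    (f := fun q : ℝ × Eu n × P2 n => (q.1, q.2.2)) (by fun_prop))).add
    (((((hV.gr_v1t hT.le).comp VJet.lin_exch).integral le_rfl).1.comp hf).sub
      ((((hV.gr_v1t hT.le).comp VJet.lin_diag).integral le_rfl).1.comp hf))

lemma ubar_eq {t : ℝ} (ht : t ∈ Icc 0 T) (x : Eu n) :
    Ubar V t = Pre.int (fun a μ => ext T V (VJet.proj a) μ) (t, x) := by
  funext μ
  simp only [Ubar, ext, Pre.int, VJet.proj, tc_of_mem ht]

end Time

/-! ### The coefficients -/

namespace Model

variable {m p q : ℕ} {P : Model n m p q} {V : ℝ → Eu n → P2 n → ℝ} {φ : ℝ → Eu n → P2 n → Eu m}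

/-- The components of the closed-loop drift, with clamped time. -/
def drift (P : Model n m p q) (φ : ℝ → Eu n → P2 n → Eu m) (i : Fin n) : TX n → P2 n → ℝ :=
  fun a μ => P.fstar φ (tc P.T a.1) a.2 μ i

/-- `δ_μ` of the components of the closed-loop drift. -/
def ddrift (P : Model n m p q) (φ : ℝ → Eu n → P2 n → Eu m) (i : Fin n) :
    TX n × Eu n → P2 n → ℝ :=
  fun a μ => mderiv (fun ν => P.fstar φ (tc P.T a.1.1) a.1.2 ν i) μ a.2

/-- The closed-loop running cost, with clamped time. -/
def cost (P : Model n m p q) (φ : ℝ → Eu n → P2 n → Eu m) : TX n → P2 n → ℝ :=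
  fun a μ => P.Lstar φ (tc P.T a.1) a.2 μ

/-- `δ_μ` of the closed-loop running cost. -/
def dcost (P : Model n m p q) (φ : ℝ → Eu n → P2 n → Eu m) : TX n × Eu n → P2 n → ℝ :=
  fun a μ => mderiv (P.Lstar φ (tc P.T a.1.1) a.1.2) μ a.2

lemma IsMasterSolution.gr_drift (hP : P.Standing) (h : P.IsMasterSolution V φ) (i : Fin n) :
    Gr 1 (P.drift φ i) := by
  have hT := hP.T_pos.le
  obtain ⟨C, hC⟩ := hP.f_growth
  obtain ⟨D, hD⟩ := h.φ_growth
  have hφ := (h.φ_cont.continuous hT).comp (f := fun a : TX n × P2 n => (a.1.1, (a.1.2, a.2)))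
    (by fun_prop)
  have hf : Continuous fun a : TX n × P2 n => P.f a.1.2 (φ (tc P.T a.1.1) a.1.2 a.2) a.2 := by
    refine continuousOn_univ.1 (hP.f_cont.comp
      (f := fun a : TX n × P2 n => (a.1.2, (φ (tc P.T a.1.1) a.1.2 a.2, a.2))) ?_ ?_)
    · exact ((continuous_snd.comp continuous_fst).prodMk
        (hφ.prodMk continuous_snd)).continuousOn
    · exact fun a _ => ⟨mem_univ _, h.φ_mem _ (tc_mem hT _) _ _, mem_univ _⟩
  refine gr_one (continuous_coord hf i) (C := |C| * (1 + |D|)) P2.continuous_m1 P2.m1_nonneg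
    (fun a => ‖a.2‖) (fun a => norm_nonneg _) (fun a => ?_) (fun a μ => ?_)
  · linarith [norm_snd_le a, norm_nonneg a]
  · have h1 := hC a.2 _ (h.φ_mem _ (tc_mem hT a.1) a.2 μ) μ
    have h2 := hD _ (tc_mem hT a.1) a.2 μ
    have h3 : |P.drift φ i a μ| ≤ ‖P.f a.2 (φ (tc P.T a.1) a.2 μ) μ‖ :=
      PiLp.norm_apply_le (P.f a.2 (φ (tc P.T a.1) a.2 μ) μ) i
    have h4 := P2.m1_nonneg μ
    have h5 : 0 ≤ 1 + ‖a.2‖ + μ.m1 := by positivity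
    have h6 : ‖φ (tc P.T a.1) a.2 μ‖ ≤ |D| * (1 + ‖a.2‖ + μ.m1) :=
      h2.trans (mul_le_mul_of_nonneg_right (le_abs_self D) h5)
    calc |P.drift φ i a μ| ≤ C * (1 + ‖a.2‖ + ‖φ (tc P.T a.1) a.2 μ‖ + μ.m1) := h3.trans h1
      _ ≤ |C| * (1 + ‖a.2‖ + ‖φ (tc P.T a.1) a.2 μ‖ + μ.m1) :=
        mul_le_mul_of_nonneg_right (le_abs_self C) (by positivity)
      _ ≤ |C| * (1 + ‖a.2‖ + |D| * (1 + ‖a.2‖ + μ.m1) + μ.m1) := by gcongr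
      _ = _ := by ring

lemma CoeffRegular.gr_ddrift (hP : P.Standing) (h : P.CoeffRegular φ) (i : Fin n) :
    Gr 1 (P.ddrift φ i) := by
  have hT := hP.T_pos.le
  obtain ⟨C, hC⟩ := h.growth
  refine gr_one (continuous_coord ((h.f_cont_m.continuous hT).comp
    (f := fun a : (TX n × Eu n) × P2 n => (a.1.1.1, (a.1.1.2, a.2, a.1.2))) (by fun_prop)) i)
    (C := C) P2.continuous_m1 P2.m1_nonneg (fun a => ‖a.1.2‖ + ‖a.2‖) (fun a => by positivity)
    (fun a => ?_) (fun a μ => ?_)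
  · linarith [(norm_le_1 a).1, (norm_le_1 a).2, norm_nonneg a]
  · have h1 := (hC _ (tc_mem hT a.1.1) a.1.2 μ a.2 0).1
    have h3 : |P.ddrift φ i a μ| ≤ ‖mderivVec (P.fstar φ (tc P.T a.1.1) a.1.2) μ a.2‖ :=
      PiLp.norm_apply_le (mderivVec (P.fstar φ (tc P.T a.1.1) a.1.2) μ a.2) i
    exact (h3.trans h1).trans_eq (by ring)

lemma CoeffRegular.md_drift (hP : P.Standing) (h : P.CoeffRegular φ) (i : Fin n) :
    MD (P.drift φ i) (P.ddrift φ i) :=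
  fun _ μ => hasMDeriv_mderiv ((h.f_mdiff _ (tc_mem hP.T_pos.le _) _ i).1 μ)

lemma CoeffRegular.gr_dcost (hP : P.Standing) (h : P.CoeffRegular φ) : Gr 2 (P.dcost φ) := by
  have hT := hP.T_pos.le
  obtain ⟨C, hC⟩ := h.growth
  refine gr_two ((h.L_cont_m.continuous hT).comp
    (f := fun a : (TX n × Eu n) × P2 n => (a.1.1.1, (a.1.1.2, a.2, a.1.2))) (by fun_prop))
    (C := C) continuous_m1_sq m1_sq_nonneg (fun a => ‖a.1.2‖ ^ 2 + ‖a.2‖ ^ 2)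
    (fun a => by positivity) (fun a => ?_)
    (fun a μ => ((hC _ (tc_mem hT _) a.1.2 μ a.2 0).2.2.1).trans_eq (by ring))
  linarith [sq_norm_le (norm_le_1 a).1, sq_norm_le (norm_le_1 a).2, sq_nonneg ‖a‖]

lemma CoeffRegular.md_cost (hP : P.Standing) (h : P.CoeffRegular φ) :
    MD (P.cost φ) (P.dcost φ) :=
  fun _ μ => hasMDeriv_mderiv ((h.L_mdiff _ (tc_mem hP.T_pos.le _) _).1 μ)

lemma CoeffRegular.gr_dterminal (hP : P.Standing) (h : P.CoeffRegular φ) :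
    Gr 2 (fun (a : Eu n × Eu n) μ => mderiv (P.g a.1) μ a.2) := by
  obtain ⟨C, hC⟩ := h.growth
  refine gr_two (h.g_cont_m.comp (f := fun a : (Eu n × Eu n) × P2 n => (a.1.1, a.2, a.1.2))
    (by fun_prop)) (C := C) continuous_m1_sq m1_sq_nonneg (fun a => ‖a.1‖ ^ 2 + ‖a.2‖ ^ 2)
    (fun a => by positivity) (fun a => ?_)
    (fun a μ => ((hC 0 ⟨le_rfl, hP.T_pos.le⟩ a.1 μ a.2 0).2.2.2.2.1).trans_eq (by ring))
  linarith [sq_norm_le (norm_fst_le a), sq_norm_le (norm_snd_le a), sq_nonneg ‖a‖]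

lemma transpose_S₀ (P : Model n m p q) : P.S₀.transpose = P.S₀ := by
  simp [S₀, Matrix.transpose_mul]

end Model

end SocialMFC

namespace SocialMFC
variable {n : ℕ}

/-! ### The master equation of the instrumental value function -/

namespace Model

variable {m p q : ℕ} {P : Model n m p q} {V : ℝ → Eu n → P2 n → ℝ} {φ : ℝ → Eu n → P2 n → Eu m}
  {M : ℝ → P2 n → ℝ}

lemma IsMasterSolution.equation_coord (hP : P.Standing) (hV : ClassV P.T V)
    (h : P.IsMasterSolution V φ) (a : TX n) (μ : P2 n) :
    vt P.T V a μ + (hV.vjet hP.T_pos.le).gen (P.S + P.S₀) P.S₀ (P.drift φ) a μ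
      + P.cost φ a μ = 0 := by
  have h1 := h.equation _ (tc_mem hP.T_pos.le a.1) a.2 μ
  have h2 := (hV.vjet hP.T_pos.le).gen_eq P (G := fun t => V (tc P.T t)) (t := a.1)
    (fun _ => rfl) (h.gr_drift hP) (c := P.fstar φ (tc P.T a.1)) (fun _ _ _ => rfl) a.2 μ
  rw [h2] at h1
  simp only [vt, cost]
  linarith

lemma IsAdjustment.equation_coord (hP : P.Standing) (hV : ClassV P.T V)
    (h : P.IsMasterSolution V φ) (hc : P.CoeffRegular φ) (hM : P.IsAdjustment V φ M)
    (a : TX n) (μ : P2 n) :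
    dt P.T (fun s => M s μ) (tc P.T a.1)
      + (hM.mem.jet hP.T_pos.le).gen (P.S + P.S₀) P.S₀ (P.drift φ) a μ
      + (∑ i, ∫ z, ∫ y, (hV.vjet hP.T_pos.le).Fy i ((a.1, y), z) μ *
          (P.ddrift φ i ((a.1, z), y) μ - P.ddrift φ i ((a.1, z), z) μ) ∂μ.meas ∂μ.meas)
      + 1 / 2 * pair P.S (fun i j => ∫ z, ∫ y,
          (hV.vjet hP.T_pos.le).Fyz i j (((a.1, y), z), z) μ ∂μ.meas ∂μ.meas) = 0 := by
  have := μ.prob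
  set J := hV.vjet hP.T_pos.le with hJ
  have h1 := hM.equation _ (tc_mem hP.T_pos.le a.1) μ
  have h2 := (hM.mem.jet hP.T_pos.le).popGen_eq P (G := fun t _ => M (tc P.T t)) (t := a.1)
    (fun _ => rfl) (h.gr_drift hP) (c := P.fstar φ (tc P.T a.1)) (fun _ _ _ => rfl) a.2 μ
  have h3 : (hM.mem.jet hP.T_pos.le).gen (P.S + P.S₀) P.S₀ (P.drift φ) a μ =
      -- `M` does not depend on the state, so the full generator reduces to its measure part.
      (hM.mem.jet hP.T_pos.le).pop (P.S + P.S₀) P.S₀ (P.drift φ) a μ := by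
    rw [Jet.gen_eq_pop]
    simp [ClassM.jet, pair]
  have hi : ∀ i, Integrable (fun z : Eu n × Eu n => J.Fy i ((a.1, z.2), z.1) μ *
      (P.ddrift φ i ((a.1, z.1), z.2) μ - P.ddrift φ i ((a.1, z.1), z.1) μ))
      (μ.meas.prod μ.meas) := fun i => by
    have g : Gr 2 (fun (b : (TX n × Eu n) × Eu n) μ =>
        J.Fy i ((b.1.1.1, b.2), b.1.2) μ * (P.ddrift φ i ((b.1.1.1, b.1.2), b.2) μ -
          P.ddrift φ i ((b.1.1.1, b.1.2), b.1.2) μ)) :=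
      ((J.gry i).comp (A := fun b : (TX n × Eu n) × Eu n => ((b.1.1.1, b.2), b.1.2))
        ⟨fun _ _ _ => rfl, by fun_prop⟩).mul
      (((hc.gr_ddrift hP i).comp (A := fun b : (TX n × Eu n) × Eu n => ((b.1.1.1, b.1.2), b.2))
        ⟨fun _ _ _ => rfl, by fun_prop⟩).sub
      ((hc.gr_ddrift hP i).comp (A := fun b : (TX n × Eu n) × Eu n => ((b.1.1.1, b.1.2), b.1.2))
        ⟨fun _ _ _ => rfl, by fun_prop⟩))
    exact g.integrable_prod le_rfl a μ μ μ
  have hn : ∀ i j, Integrable (fun z : Eu n × Eu n => J.Fyz i j (((a.1, z.2), z.1), z.1) μ)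
      (μ.meas.prod μ.meas) := fun i j => (J.gryz i j).integrable_bounded
        (f := fun z : Eu n × Eu n => (((a.1, z.2), z.1), z.1)) (by fun_prop) μ _
  -- The first coordinate of `b`, at which the drift is evaluated, becomes the outer variable; the
  -- state of `V` is the inner one, matching `integral_ubar_drift`.
  have h4 : ∫ b : Eu n × Eu n, inner ℝ (grad (mderiv (V (tc P.T a.1) b.2) μ) b.1)
      (mderivVec (P.fstar φ (tc P.T a.1) b.1) μ b.2 - mderivVec (P.fstar φ (tc P.T a.1) b.1) μ b.1)
      ∂(μ.meas.prod μ.meas) =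
      ∑ i, ∫ z, ∫ y, J.Fy i ((a.1, y), z) μ *
          (P.ddrift φ i ((a.1, z), y) μ - P.ddrift φ i ((a.1, z), z) μ) ∂μ.meas ∂μ.meas := by
    simp only [J.inner_grad_y (G := fun t => V (tc P.T t)) (t := a.1) (fun _ => rfl)]
    rw [integral_finsetSum]
    · exact Finset.sum_congr rfl fun i _ => integral_prod _ (hi i)
    · exact fun i _ => hi i
  have h5 : ∫ b : Eu n × Eu n, (mixed (mderiv2 (V (tc P.T a.1) b.2) μ) b.1 b.1 * P.S).trace
      ∂(μ.meas.prod μ.meas) = pair P.S (fun i j => ∫ z, ∫ y,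
          J.Fyz i j (((a.1, y), z), z) μ ∂μ.meas ∂μ.meas) := by
    simp only [J.trace_mixed_yz (G := fun t => V (tc P.T t)) (t := a.1) (fun _ => rfl)]
    rw [integral_pair _ _ hn]
    simp only [integral_prod _ (hn _ _)]
  rw [h2, h4, h5] at h1
  rw [h3]
  exact h1.symm

lemma isIVFSolution_equation (hP : P.Standing) (hV : ClassV P.T V)
    (h : P.IsMasterSolution V φ) (hc : P.CoeffRegular φ) (hM : P.IsAdjustment V φ M)
    {t : ℝ} (ht : t ∈ Icc 0 P.T) (x : Eu n) (μ : P2 n) :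
    0 = dt P.T (fun s => IVF V M s x μ) t
      + P.gen (fun y => P.fstar φ t y μ) (IVF V M t) x μ
      + P.Lstar φ t x μ
      + (∫ y, (mderiv (P.Lstar φ t y) μ x - mderiv (P.Lstar φ t y) μ y) ∂μ.meas)
      + (∫ y, inner ℝ (grad (mderiv (Ubar V t) μ) y)
          (mderivVec (P.fstar φ t y) μ x - mderivVec (P.fstar φ t y) μ y) ∂μ.meas)
      + 1 / 2 * (∫ y, (mixed (mderiv2 (Ubar V t) μ) y y * P.S).trace ∂μ.meas) := by
  have := μ.prob
  have hT := hP.T_pos.le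
  set J := hV.vjet hT with hJ
  have hb := h.gr_drift hP
  have hdb := hc.gr_ddrift hP
  have e1 := h.equation_coord hP hV (t, x) μ
  have e2 := J.equation_exch hb hdb (hc.md_drift hP) (hV.md_vt hP.T_pos) (hc.md_cost hP)
    (hV.gr_v1t hT) (hc.gr_dcost hP) P.transpose_S₀ (h.equation_coord hP hV) (t, x) μ
  have e3 := J.equation_diag hb hdb (hc.md_drift hP) (hV.md_vt hP.T_pos) (hc.md_cost hP)
    (hV.gr_v1t hT) (hc.gr_dcost hP) P.transpose_S₀ (h.equation_coord hP hV) (t, x) μ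
  have e4 := hM.equation_coord hP hV h hc (t, x) μ
  have eg : P.gen (fun y => P.fstar φ t y μ) (IVF V M t) x μ =
      J.gen (P.S + P.S₀) P.S₀ (P.drift φ) (t, x) μ
      + (hM.mem.jet hT).gen (P.S + P.S₀) P.S₀ (P.drift φ) (t, x) μ
      + (J.preW.jet.gen (P.S + P.S₀) P.S₀ (P.drift φ) (t, x) μ
        - J.preD.jet.gen (P.S + P.S₀) P.S₀ (P.drift φ) (t, x) μ) := by
    rw [(hV.ivfJet hT hM.mem).gen_eq P (G := IVF V M) (t := t) (fun x => hV.ivf_eq hT ht x) hb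
      (c := P.fstar φ t) (fun x μ i => by simp only [drift, tc_of_mem ht]) x μ]
    rw [ClassV.ivfJet, Jet.gen_add _ _ hb, Jet.gen_add _ _ hb, Jet.gen_sub _ _ hb]
  have ec : ∫ y, (mderiv (P.Lstar φ t y) μ x - mderiv (P.Lstar φ t y) μ y) ∂μ.meas =
      (∫ y, P.dcost φ (VJet.exch ((t, x), y)) μ ∂μ.meas)
        - ∫ y, P.dcost φ (VJet.diag ((t, x), y)) μ ∂μ.meas := by
    rw [← integral_sub (((hc.gr_dcost hP).comp VJet.lin_exch).integrable le_rfl (t, x) μ μ)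
      (((hc.gr_dcost hP).comp VJet.lin_diag).integrable le_rfl (t, x) μ μ)]
    simp only [dcost, VJet.exch, VJet.diag, tc_of_mem ht]
  have hgd : ∀ i, Gr 2 (fun (a : TX n × Eu n) μ => J.preU.jet.Fy i a μ *
      (P.ddrift φ i (VJet.exch a) μ - P.ddrift φ i (VJet.diag a) μ)) := fun i =>
    (J.preU.jet.gry i).mul (((hdb i).comp VJet.lin_exch).sub ((hdb i).comp VJet.lin_diag))
  have ed : ∫ y, inner ℝ (grad (mderiv (Ubar V t) μ) y)
          (mderivVec (P.fstar φ t y) μ x - mderivVec (P.fstar φ t y) μ y) ∂μ.meas =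
      ∑ i, ∫ z, J.preU.jet.Fy i ((t, x), z) μ *
        (P.ddrift φ i ((t, z), x) μ - P.ddrift φ i ((t, z), z) μ) ∂μ.meas := by
    simp only [J.preU.jet.inner_grad_y (G := fun t _ => Ubar V t) (t := t)
      (fun x => ubar_eq ht x) _ x]
    refine Eq.trans ?_ (integral_finsetSum _ fun i _ => (hgd i).integrable le_rfl (t, x) μ μ)
    simp only [ddrift, tc_of_mem ht, mderivVec, PiLp.sub_apply]
  have en : ∫ y, (mixed (mderiv2 (Ubar V t) μ) y y * P.S).trace ∂μ.meas =
      pair P.S (fun i j => ∫ z, J.preU.jet.Fyz i j (((t, x), z), z) μ ∂μ.meas) := by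
    simp only [J.preU.jet.trace_mixed_yz (G := fun t _ => Ubar V t) (t := t)
      (fun x => ubar_eq ht x) _ x]
    exact integral_pair _ _ fun i j => (J.preU.jet.gryz i j).integrable_bounded
      (f := fun z => (((t, x), z), z)) (by fun_prop) μ _
  -- All terms are now in coordinates, and the equation is the combination `e1 + e2 - e3 + e4`, that
  -- is, `V` plus `W` minus `D` plus `M`.
  rw [hV.dt_ivf hP.T_pos hM.mem x μ ht, eg, ec, ed, en]
  simp only [J.integral_ubar_drift hdb, J.integral_ubar_noise, pair_add, Finset.sum_add_distrib,
    Finset.sum_sub_distrib, pair_add_left] at e1 e2 e3 e4 ⊢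
  have el : P.Lstar φ t x μ = P.cost φ (t, x) μ := by simp only [cost, tc_of_mem ht]
  rw [el]
  linarith

lemma isIVFSolution_ivf (hP : P.Standing) (hV : ClassV P.T V) (hVφ : P.IsMasterSolution V φ)
    (hcoeff : P.CoeffRegular φ) (hM : P.IsAdjustment V φ M) :
    P.IsIVFSolution V φ (IVF V M) := by
  have hT := hP.T_pos.le
  have hb := hVφ.gr_drift hP
  have hdb := hcoeff.gr_ddrift hP
  exact
  { regular := hV.ivf_regular hP.T_pos hM.mem
    -- `Ū` is treated as a function of time and state that is constant in the state; the value `0`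
    -- is an arbitrary state.
    ubar_mdiff := fun t ht => (hV.vjet hT).preU.jet.mdiff2 (F := fun t _ => Ubar V t)
      (fun x => ubar_eq ht x) 0
    ubar_ydiff := fun t ht μ => ((hV.vjet hT).preU.jet.pdiff2_y (F := fun t _ => Ubar V t)
      (fun x => ubar_eq ht x) 0 μ).1
    ubar_yzdiff := fun t ht μ => (hV.vjet hT).preU.jet.mixedDiff_yz (F := fun t _ => Ubar V t)
      (fun x => ubar_eq ht x) 0 μ
    int_y := fun t ht x μ => (hV.ivfJet hT hM.mem).integrable_grad_y
      (fun x => hV.ivf_eq hT ht x) hb (c := P.fstar φ t)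
      (fun x μ i => by simp only [drift, tc_of_mem ht]) x μ
    int_yy := fun t ht x μ => (hV.ivfJet hT hM.mem).integrable_hess_y
      (fun x => hV.ivf_eq hT ht x) _ x μ
    int_xy := fun t ht x μ => (hV.ivfJet hT hM.mem).integrable_mixed_xy
      (fun x => hV.ivf_eq hT ht x) _ x μ
    int_yz := fun t ht x μ => (hV.ivfJet hT hM.mem).integrable_mixed_yz
      (fun x => hV.ivf_eq hT ht x) _ x μ
    int_L := fun t ht x μ => by
      have h1 := (((hcoeff.gr_dcost hP).comp VJet.lin_exch).sub
        ((hcoeff.gr_dcost hP).comp VJet.lin_diag)).integrable le_rfl (t, x) μ μ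
      simpa only [dcost, VJet.exch, VJet.diag, tc_of_mem ht] using h1
    int_f := fun t ht x μ => by
      have hg : ∀ i, Gr 2 (fun (a : TX n × Eu n) μ => (hV.vjet hT).preU.jet.Fy i a μ *
          (P.ddrift φ i (VJet.exch a) μ - P.ddrift φ i (VJet.diag a) μ)) := fun i =>
        ((hV.vjet hT).preU.jet.gry i).mul
          (((hdb i).comp VJet.lin_exch).sub ((hdb i).comp VJet.lin_diag))
      simp only [(hV.vjet hT).preU.jet.inner_grad_y (G := fun t _ => Ubar V t) (t := t)
        (fun x => ubar_eq ht x) _ x]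
      have h1 := (Gr.sum Finset.univ hg).integrable le_rfl (t, x) μ μ
      simpa only [ddrift, VJet.exch, VJet.diag, tc_of_mem ht, mderivVec, PiLp.sub_apply] using h1
    int_ubar := fun t ht μ => by
      simp only [(hV.vjet hT).preU.jet.trace_mixed_yz (G := fun t _ => Ubar V t) (t := t)
        (fun x => ubar_eq ht x) _ 0]
      exact integrable_pair _ fun i j => ((hV.vjet hT).preU.jet.gryz i j).integrable_bounded
        (f := fun z => (((t, 0), z), z)) (by fun_prop) μ _
    int_terminal := fun x μ => by
      have h1 := hcoeff.gr_dterminal hP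
      exact ((h1.comp (A := fun a : Eu n × Eu n => (a.2, a.1)) ⟨fun _ _ _ => rfl, by fun_prop⟩).sub
        (h1.comp (A := fun a : Eu n × Eu n => (a.2, a.2))
          ⟨fun _ _ _ => rfl, by fun_prop⟩)).integrable le_rfl x μ μ
    equation := fun t ht x μ => isIVFSolution_equation hP hV hVφ hcoeff hM ht x μ
    terminal := fun x μ => by
      have e : ∀ y, V P.T y = P.g y := fun y => funext fun ν => hVφ.terminal y ν
      simp only [IVF, e, hM.terminal, add_zero] }

end Model

end SocialMFC

end

theorem mainTheorem3 {n m p q : ℕ} (P : SocialMFC.Model n m p q) (hP : P.Standing)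
    (V : ℝ → SocialMFC.Eu n → SocialMFC.P2 n → ℝ)
    (φ : ℝ → SocialMFC.Eu n → SocialMFC.P2 n → SocialMFC.Eu m)
    (hV : SocialMFC.ClassV P.T V) (hVφ : P.IsMasterSolution V φ)
    (hcoeff : P.CoeffRegular φ)
    (M : ℝ → SocialMFC.P2 n → ℝ) (hM : P.IsAdjustment V φ M) :
    P.IsIVFSolution V φ (SocialMFC.IVF V M) :=
  SocialMFC.Model.isIVFSolution_ivf hP hV hVφ hcoeff hM
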